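/- **Setting.** Let $\mathcal W_1$ be a countable alphabet with a $0$–$1$ transition matrix, $\Sigma^+$ the associated one-sided Markov shift with left shift $\sigma$, assumed topologically mixing. A word is admissible if its consecutive letters are allowed transitions; $[w]\subset\Sigma^+$ is the cylinder of a word $w$, $|w|$ its length, and $\mathcal W^{B,b}_n$ is the set of admissible words of length $n$ with first letter $B$ and last letter $b$. Let $R:\Sigma^+\to(0,\infty)$ with $\log R$ locally Hölder continuous (there are $C>0$, $\theta\in(0,1)$ with $|\log R(y)-\log R(z)|\le C\theta^n$ whenever $n\ge 2$ and $y,z$ share their first $n$ letters), and write $R_n(z)=R(z)R(\sigma z)\cdots R(\sigma^{n-1}z)$. Assume that the Gurevič pressure of $\log R$ is $0$ and that $R$ is strongly positively recurrent: for every letter $B$ the sums $\sum_{\sigma^nz=z,\,z_0=B}R_n(z)$ are bounded above and away from $0$ for all large $n$, and $$\gamma_B(\mathrm{SPR})=\limsup_{n\to\infty}\Big(\sum_{\sigma^nz=z,\;z_0=B,\;z_i\ne B\,(0<i<n)}R_n(z)\Big)^{1/n}<1 .$$ Let $G$ be a countable discrete group, $\mathfrak s:\mathcal W_1\to G$ a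 map, $\underline{\mathfrak s}(w_1\cdots w_n)=\mathfrak s(w_1)\cdots\mathfrak s(w_n)$, and $T_{\mathfrak s}(z,g)=(\sigma z,\mathfrak s(z_0)^{-1}g)$ the skew product. Let $\rho$ on $\mathcal H$ be a countable direct sum of quotient representations $\ell^2(G/H_j)$, $[\rho(g)f](yH_j)=f(g^{-1}yH_j)$, and $\mathcal H_+$ the cone of non-negative functions. For $\varphi:G\to\mathbb R$ put $\varphi*_\rho f=\sum_{g}\varphi(g)\rho(g)f$. Fix letters $A,a$ and $x\in\Sigma^+$ such that $ax$ is admissible. For $c:\mathbb N\to(0,\infty)$ and $t>0$ put $$\phi_{c;\le N}[t](g)=\sum_{n=1}^{N}t^{-n}c_n\sum_{w\in\mathcal W_n^{A,a},\ \underline{\mathfrak s}(w)=g}R_n(wx),\qquad \phi_c[t]=\lim_{N\to\infty}\phi_{c;\le N}[t],$$ $\phi_{\le N}[t]=\phi_{1;\le N}[t]$, and $\gamma=\gamma(\phi*_\rho f)=\inf\{t>0:\sup_N\|\phi_{\le N}[t]*_\rho f\|<\infty\}$. A function $c:\mathbb N\to(0,\infty)$ is slowly increasing if it is non-decreasing,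 $c_n\to\infty$, and $c_{n+k}/c_n\to1$ as $n\to\infty$ for each $k$. **Lemma.** Let $0\ne f\in\mathcal H_+$. Assume that $\Sigma^+$ is compact, or that $x_0=A$ and $\gamma>\gamma_B(\mathrm{SPR})$ for some letter $B$. Then there are a slowly increasing $c$ and a sequence $t_k>\gamma$, $t_k\to\gamma$, such that the vectors $Q_k=\phi_c[t_k]*_\rho f\in\mathcal H$ are well defined and nonzero, the limit $$\Upsilon_c(g)=\lim_{k\to\infty}\frac{\langle\rho(g)Q_k,Q_k\rangle}{\langle Q_k,Q_k\rangle}$$ exists for every $g\in G$, and there is a Borel measure $\nu_c$ on $\Sigma^+$, finite on the cylinders of nonempty words, such that $$\gamma^{n}\int_{[wA]}R_n^{-1}\,d\nu_c=\Upsilon_c(\underline{\mathfrak s}(w))$$ for every $n\ge0$ and every word $w$ of length $n$ with $wA$ admissible. The measure $\nu_c$ is a twisted measure in the following sense. For every $g\in G$ the measures $$\nu^{g}_{k}=\sum_{v}t_k^{-|v|}c_{|v|}R_{|v|}(vx)\,\frac{\langle\rho(\underline{\mathfrak s}(v))f,\rho(g)^{-1}Q_k\rangle}{\langle Q_k,Q_k\rangle}\,\delta_{vx}$$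 (sum over all admissible words $v$ with last letter $a$) are finite on cylinders of nonempty words and converge as $k\to\infty$, on every one-letter cylinder against bounded continuous functions, to a measure finite on cylinders of nonempty words, and $\nu_c$ is the limit for $g=e$. If moreover $T_{\mathfrak s}$ is topologically transitive, then there is $h:G\times\Sigma^+\to[0,\infty)$, measurable in the second variable, such that for every nonempty admissible word $w$ of length $n$ the push-forward of $\nu_c|_{\sigma^n[w]}$ under $z\mapsto wz$ is absolutely continuous with respect to $\nu_c|_{[w]}$ with density $z\mapsto\gamma^{n}R_n(z)^{-1}h(\underline{\mathfrak s}(w),z)$. -/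

import Mathlib

open Set Filter Topology MeasureTheory
open scoped ENNReal BoundedContinuousFunction

noncomputable section

/-! ### One-sided countable Markov shifts -/

/-- The one-sided Markov shift `Σ⁺` with alphabet `W` and transitions `τ`. -/
structure MarkovShift {W : Type*} (τ : W → W → Prop) where
  /-- the sequence of letters -/
  seq : ℕ → W
  /-- consecutive letters are allowed transitions -/
  adm : ∀ i, τ (seq i) (seq (i + 1))

namespace MarkovShift

variable {W : Type*} {τ : W → W → Prop}

/-- The topology induced by the product topology. -/
instance [TopologicalSpace W] : TopologicalSpace (MarkovShift τ) :=
  TopologicalSpace.induced MarkovShift.seq inferInstance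

/-- The Borel `σ`-algebra. -/
instance [TopologicalSpace W] : MeasurableSpace (MarkovShift τ) := borel _

instance [TopologicalSpace W] : BorelSpace (MarkovShift τ) := ⟨rfl⟩

/-- The left shift `σ`. -/
def shift (x : MarkovShift τ) : MarkovShift τ :=
  ⟨fun i => x.seq (i + 1), fun i => x.adm (i + 1)⟩

/-- The cylinder `[w]` of points whose first `|w|` letters spell `w`. -/
def cylinder (τ : W → W → Prop) (w : List W) : Set (MarkovShift τ) :=
  {x | ∀ i : ℕ, ∀ b : W, w[i]? = some b → x.seq i = b}

/-- The sequence `wz`, the word `w` followed by the sequence `z`. -/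
def concat (w : List W) (z : ℕ → W) : ℕ → W :=
  fun i => w.getD i (z (i - w.length))

open Classical in
/-- The point `wz` of the shift. If `wz` is not admissible the value is the irrelevant `z`. -/
def prepend (w : List W) (z : MarkovShift τ) : MarkovShift τ :=
  if h : ∀ i, τ (concat w z.seq i) (concat w z.seq (i + 1)) then ⟨concat w z.seq, h⟩ else z

/-- `𝓦ₙ^{B,b}`: admissible words of length `n` with first letter `B` and last letter `b`. -/
def IsWord (τ : W → W → Prop) (B b : W) (n : ℕ) (w : List W) : Prop :=
  w.length = n ∧ w.IsChain τ ∧ w.head? = some B ∧ w.getLast? = some b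

/-- Topological mixing of the shift, expressed with one-letter cylinders. -/
def IsMixing (τ : W → W → Prop) : Prop :=
  ∀ b d : W, ∃ N : ℕ, ∀ n ≥ N, ∃ x : MarkovShift τ, x.seq 0 = b ∧ x.seq n = d

/-! ### The potential -/

/-- `Rₙ(x) = R(x) R(σ x) ⋯ R(σ^{n-1} x)`. -/
def birkhoffProd (R : MarkovShift τ → ℝ) (n : ℕ) (x : MarkovShift τ) : ℝ :=
  ∏ i ∈ Finset.range n, R (shift^[i] x)

/-- `log R` is locally Hölder: its variation over points sharing the first `n ≥ 2` letters is at
most `C θⁿ`. -/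
def IsLocallyHolder (R : MarkovShift τ → ℝ) : Prop :=
  ∃ C θ : ℝ, 0 < θ ∧ θ < 1 ∧ ∀ n : ℕ, 2 ≤ n → ∀ x y : MarkovShift τ,
    (∀ i < n, x.seq i = y.seq i) → |Real.log (R x) - Real.log (R y)| ≤ C * θ ^ n

/-- `∑ Rₙ(x)` over the points of `[B]` with `σⁿ x = x`. -/
def periodicSum (R : MarkovShift τ → ℝ) (B : W) (n : ℕ) : ℝ≥0∞ :=
  ∑' x : {x : MarkovShift τ // shift^[n] x = x ∧ x.seq 0 = B},
    ENNReal.ofReal (birkhoffProd R n x.1)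

/-- `∑ Rₙ(x)` over the points of `[B]` with `σⁿ x = x` and first return time `n` to `[B]`. -/
def firstReturnSum (R : MarkovShift τ → ℝ) (B : W) (n : ℕ) : ℝ≥0∞ :=
  ∑' x : {x : MarkovShift τ // shift^[n] x = x ∧ x.seq 0 = B ∧ ∀ i, 0 < i → i < n → x.seq i ≠ B},
    ENNReal.ofReal (birkhoffProd R n x.1)

/-- The Gurevič pressure `P(log R, σ)`, computed at the letter `B`. -/
def gurevicPressure (R : MarkovShift τ → ℝ) (B : W) : EReal :=
  limsup (fun n : ℕ => (((n : ℝ)⁻¹ : ℝ) : EReal) * ENNReal.log (periodicSum R B n)) atTop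

/-- Positive recurrence (for a potential of zero pressure). -/
def IsPositiveRecurrent (R : MarkovShift τ → ℝ) : Prop :=
  ∀ B : W, ∃ M : ℝ, 0 < M ∧ ∀ᶠ n : ℕ in atTop,
    ENNReal.ofReal M⁻¹ ≤ periodicSum R B n ∧ periodicSum R B n ≤ ENNReal.ofReal M

/-- `γ(SPR)`: the exponential growth rate of the first returns to the letter `B`. -/
def gammaSPR (R : MarkovShift τ → ℝ) (B : W) : ℝ≥0∞ :=
  limsup (fun n : ℕ => firstReturnSum R B n ^ ((n : ℝ)⁻¹)) atTop

/-- Strong positive recurrence (for a potential of zero pressure). -/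
def IsStronglyPositiveRecurrent (R : MarkovShift τ → ℝ) : Prop :=
  IsPositiveRecurrent R ∧ ∀ B : W, gammaSPR R B < 1

/-! ### Group extensions -/

/-- `𝔰(w) = 𝔰(w₁) ⋯ 𝔰(wₙ)`. -/
def wordProd {G : Type*} [Group G] (s : W → G) (w : List W) : G := (w.map s).prod

/-- The skew product `T_𝔰(x, g) = (σ x, 𝔰(x₀)⁻¹ g)`. -/
def skewProduct {G : Type*} [Group G] (s : W → G) (p : MarkovShift τ × G) : MarkovShift τ × G :=
  (shift p.1, (s (p.1.seq 0))⁻¹ * p.2)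

/-- Topological transitivity of `T_𝔰`, where `G` is discrete. -/
def IsTransitiveExtension [TopologicalSpace W] (τ : W → W → Prop) {G : Type*} [Group G]
    (s : W → G) : Prop :=
  ∀ U V : Set (MarkovShift τ), IsOpen U → IsOpen V → U.Nonempty → V.Nonempty → ∀ g h : G,
    ∃ n : ℕ, ∃ x ∈ U, ((skewProduct s)^[n] (x, g)).1 ∈ V ∧ ((skewProduct s)^[n] (x, g)).2 = h

end MarkovShift

/-! ### Countable sums of quotient representations -/

section Representation

variable {G ι : Type*} [Group G]

/-- The Hilbert sum `⨁ⱼ ℓ²(G/Hⱼ)`, realised as `ℓ²` of the disjoint union of the `G/Hⱼ`. -/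
abbrev QuotSum (H : ι → Subgroup G) : Type _ := lp (fun _ : (Σ j : ι, G ⧸ H j) => ℝ) 2

lemma memlp_translate (H : ι → Subgroup G) (g : G) (f : QuotSum H) :
    Memℓp (E := fun _ : (Σ j : ι, G ⧸ H j) => ℝ) (fun y => f (g⁻¹ • y)) 2 := by
  have h2 : (0 : ℝ) < (2 : ℝ≥0∞).toReal := by norm_num
  refine memℓp_gen ?_
  exact ((MulAction.toPerm (g⁻¹ : G)).summable_iff (f := fun y => ‖f y‖ ^ (2 : ℝ≥0∞).toReal)).2
    ((lp.memℓp f).summable h2)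

/-- The unitary operator `[ρ(g) f](y) = f(g⁻¹ y)`. -/
def quotRepOp (H : ι → Subgroup G) (g : G) : QuotSum H ≃ₗᵢ[ℝ] QuotSum H where
  toFun f := ⟨fun y => f (g⁻¹ • y), memlp_translate H g f⟩
  invFun f := ⟨fun y => f (g⁻¹⁻¹ • y), memlp_translate H g⁻¹ f⟩
  map_add' f₁ f₂ := by ext y; rfl
  map_smul' r f := by ext y; rfl
  left_inv f := by ext y; simp
  right_inv f := by ext y; simp
  norm_map' f := by
    have h2 : (0 : ℝ) < (2 : ℝ≥0∞).toReal := by norm_num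
    rw [lp.norm_eq_tsum_rpow h2, lp.norm_eq_tsum_rpow h2]
    congr 1
    exact (MulAction.toPerm (g⁻¹ : G)).tsum_eq (fun y => ‖f y‖ ^ (2 : ℝ≥0∞).toReal)

/-- The representation `ρ = ⨁ⱼ λ_{Hⱼ}` of `G`, a sum of quotient representations. -/
def quotRep (H : ι → Subgroup G) : G →* (QuotSum H ≃ₗᵢ[ℝ] QuotSum H) where
  toFun := quotRepOp H
  map_one' := by
    ext f y
    simp [quotRepOp]
  map_mul' g₁ g₂ := by
    ext f y
    simp [quotRepOp, mul_smul]

/-- `φ ∗_ρ f = ∑_g φ(g) ρ(g) f`. -/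
def repConv (H : ι → Subgroup G) (φ : G → ℝ) (f : QuotSum H) : QuotSum H :=
  ∑' g : G, φ g • quotRep H g f

end Representation

/-! ### Thermodynamic `G`-densities -/

/-- Slowly increasing functions. -/
def IsSlowlyIncreasing (c : ℕ → ℝ) : Prop :=
  (∀ n, 0 < c n) ∧ Monotone c ∧ Tendsto c atTop atTop ∧
    ∀ k : ℕ, Tendsto (fun n => c (n + k) / c n) atTop (𝓝 1)

namespace MarkovShift

section Density

variable {W : Type*} {τ : W → W → Prop} {G ι : Type*} [Group G]

/-- The `n`-th term `t⁻ⁿ cₙ ∑ Rₙ(wx)` over `w ∈ 𝓦ₙ^{A,a}` with `𝔰(w) = g`. -/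
def densityTerm (R : MarkovShift τ → ℝ) (s : W → G) (A a : W) (x : MarkovShift τ)
    (c : ℕ → ℝ) (t : ℝ) (g : G) (n : ℕ) : ℝ :=
  (t ^ n)⁻¹ * c n *
    ∑' w : {w : List W // IsWord τ A a n w ∧ wordProd s w = g}, birkhoffProd R n (prepend w.1 x)

/-- The partial sums `φ^{A,a}_{c;≤N}[t]`. -/
def densityPartial (R : MarkovShift τ → ℝ) (s : W → G) (A a : W) (x : MarkovShift τ)
    (c : ℕ → ℝ) (t : ℝ) (N : ℕ) (g : G) : ℝ :=
  ∑ n ∈ Finset.Icc 1 N, densityTerm R s A a x c t g n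

/-- The thermodynamic `G`-density `φ^{A,a}_c[t]`. -/
def density (R : MarkovShift τ → ℝ) (s : W → G) (A a : W) (x : MarkovShift τ)
    (c : ℕ → ℝ) (t : ℝ) (g : G) : ℝ :=
  ∑' n : ℕ, densityTerm R s A a x c t g (n + 1)

/-- The decay exponent `γ(φ ∗_ρ f)`. -/
def decayExponent (R : MarkovShift τ → ℝ) (s : W → G) (A a : W) (x : MarkovShift τ)
    (H : ι → Subgroup G) (f : QuotSum H) : ℝ :=
  sInf {t : ℝ | 0 < t ∧ BddAbove (range fun N : ℕ =>
    inner ℝ (repConv H (densityPartial R s A a x (fun _ => 1) t N) f)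
      (repConv H (densityPartial R s A a x (fun _ => 1) t N) f))}

/-- The vector `φ_c[t] ∗_ρ f`. -/
def densityVec (R : MarkovShift τ → ℝ) (s : W → G) (A a : W) (x : MarkovShift τ)
    (H : ι → Subgroup G) (f : QuotSum H) (c : ℕ → ℝ) (t : ℝ) : QuotSum H :=
  repConv H (density R s A a x c t) f

/-! ### Twisted measures -/

variable [TopologicalSpace W]

/-- With `Q = φ_c[t] ∗_ρ f`, the weighted sum of Dirac masses
`∑_v t^{-|v|} c_{|v|} R_{|v|}(vx) ⟨ρ(𝔰(v)) f, ρ(g)⁻¹ Q⟩ / ⟨Q, Q⟩ · D(vx)`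
over all admissible words `v` with last letter `a`. -/
def approxMeasure (R : MarkovShift τ → ℝ) (s : W → G) (A a : W) (x : MarkovShift τ)
    (H : ι → Subgroup G) (f : QuotSum H) (c : ℕ → ℝ) (g : G) (t : ℝ) :
    Measure (MarkovShift τ) :=
  Measure.sum fun v : {v : List W // v.IsChain τ ∧ v.getLast? = some a} =>
    ENNReal.ofReal ((t ^ v.1.length)⁻¹ * c v.1.length *
      birkhoffProd R v.1.length (prepend v.1 x) *
      (inner ℝ (quotRep H (wordProd s v.1) f)
          ((quotRep H g)⁻¹ (densityVec R s A a x H f c t)) /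
        inner ℝ (densityVec R s A a x H f c t) (densityVec R s A a x H f c t))) •
    Measure.dirac (prepend v.1 x)

/-- The measure is finite on the cylinders of nonempty words. -/
def FiniteOnCylinders (m : Measure (MarkovShift τ)) : Prop :=
  ∀ w : List W, w ≠ [] → m (cylinder τ w) < ∞

/-- Weak-∗ convergence of measures finite on cylinders: on every one-letter cylinder, integrals of
bounded continuous functions converge. -/
def WeakStarTendsto (m : ℕ → Measure (MarkovShift τ)) (m' : Measure (MarkovShift τ)) : Prop :=
  (∀ k, FiniteOnCylinders (m k)) ∧ FiniteOnCylinders m' ∧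
    ∀ b : W, ∀ F : MarkovShift τ →ᵇ ℝ,
      Tendsto (fun k => ∫ z in cylinder τ [b], F z ∂(m k)) atTop
        (𝓝 (∫ z in cylinder τ [b], F z ∂m'))

/-- `m` is the one-sided twisted measure obtained along `t_k`: the approximating measures converge
for every `g ∈ G`, and `m` is the limit for `g = e`. -/
def IsTwistedLimit (R : MarkovShift τ → ℝ) (s : W → G) (A a : W) (x : MarkovShift τ)
    (H : ι → Subgroup G) (f : QuotSum H) (c : ℕ → ℝ) (t : ℕ → ℝ)
    (m : Measure (MarkovShift τ)) : Prop :=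
  ∃ μ : G → Measure (MarkovShift τ), m = μ 1 ∧
    ∀ g : G, WeakStarTendsto (fun k => approxMeasure R s A a x H f c g (t k)) (μ g)

/-- `(τ^{(w)})_* m`, the push-forward of `m` restricted to `σⁿ[w]` under the inverse branch
`z ↦ wz`. -/
def branchPush (w : List W) (m : Measure (MarkovShift τ)) : Measure (MarkovShift τ) :=
  (m.restrict (shift^[w.length] '' cylinder τ w)).map (prepend w)

/-- `m` is twisted by a generalised multiplicative cocycle `h`, with parameter `γ`: for every
admissible `w` of length `n`, the Radon–Nikodym derivative of `(τ^{(w)})_* m` with respect to `m` on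
`[w]` is `γⁿ Rₙ(z)⁻¹ h(𝔰(w), z)`. -/
def IsTwistedByCocycle (R : MarkovShift τ → ℝ) (s : W → G) (γ : ℝ)
    (m : Measure (MarkovShift τ)) : Prop :=
  ∃ h : G → MarkovShift τ → ℝ, (∀ g, Measurable (h g)) ∧ (∀ g z, 0 ≤ h g z) ∧
    ∀ w : List W, w ≠ [] → w.IsChain τ →
      branchPush w m = (m.restrict (cylinder τ w)).withDensity fun z =>
        ENNReal.ofReal (γ ^ w.length * (birkhoffProd R w.length z)⁻¹ * h (wordProd s w) z)

end Density

end MarkovShift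

end

/-!
The construction is Patterson's. A slowly increasing, submultiplicative `c` keeps `‖φ_c[t] ∗ f‖`
finite for `t > γ` but makes it diverge as `t ↓ γ`. Bounded distortion and connecting words bound
the mass that the approximating measures give to a cylinder, uniformly in `t`. On a one-letter
cylinder they are tight: either the shift is compact, or `γ_B(SPR) < γ` for some `B`, and cutting
a word at its visits to `B` leaves first-return pieces, whose weights are summable already at `γ`.
Prokhorov's theorem and a diagonal argument then give limits `ν^g`, and `Υ(g)` is the mass
`ν^g[A]`.

Since the norms diverge, every fixed set of short words loses its mass in the limit. Together with
`c_{n+k} / c_n → 1` this shows that prepending a word `w` carries `ν^{g 𝔰(w)}` on `[b]` to `ν^g` on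
`[wb]` with density `γ^{|w|} R_{|w|}⁻¹`; for `g = e` and `b = A`, comparing total masses gives the
formula for `Υ`. If the skew product is transitive, every `g` is realised by a word from `A` to `A`,
which bounds `ν^g` by a multiple of `ν^e`, and `h(g, ·)` is the Radon–Nikodym derivative of
`ν^{g⁻¹}` with respect to `ν^e`.
-/

namespace MarkovShift

section Words

variable {W : Type*} {τ : W → W → Prop}

lemma ext_seq {y z : MarkovShift τ} (h : ∀ i, y.seq i = z.seq i) : y = z := by
  cases y; cases z; congr; exact funext h

lemma shift_iterate_seq (n : ℕ) (z : MarkovShift τ) (i : ℕ) :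
    (shift^[n] z).seq i = z.seq (i + n) := by
  induction n generalizing z with
  | zero => rfl
  | succ n ih => rw [Function.iterate_succ_apply, ih]; simp [shift, add_assoc]

lemma concat_of_lt {w : List W} {z : ℕ → W} {i : ℕ} (h : i < w.length) :
    concat w z i = w[i] := by
  simp [concat, List.getD_eq_getElem?_getD, h]

lemma concat_of_ge {w : List W} {z : ℕ → W} {i : ℕ} (h : w.length ≤ i) :
    concat w z i = z (i - w.length) := by
  simp [concat, List.getD_eq_getElem?_getD, h]

lemma concat_adm {w : List W} {z : MarkovShift τ} (h : (w ++ [z.seq 0]).IsChain τ) (i : ℕ) :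
    τ (concat w z.seq i) (concat w z.seq (i + 1)) := by
  rw [List.isChain_iff_getElem] at h
  rcases lt_trichotomy (i + 1) w.length with hi | hi | hi
  · rw [concat_of_lt hi, concat_of_lt (by omega)]
    have hrel := h i (by simp; omega)
    rwa [List.getElem_append_left (by omega), List.getElem_append_left hi] at hrel
  · rw [concat_of_lt (by omega), concat_of_ge (by omega)]
    have hrel := h i (by simp; omega)
    rw [List.getElem_append_left (by omega), List.getElem_append_right (by omega)] at hrel
    simpa [hi] using hrel
  · rw [concat_of_ge (by omega), concat_of_ge (by omega)]
    have hz := z.adm (i - w.length)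
    rwa [show i - w.length + 1 = i + 1 - w.length by omega] at hz

lemma concat_adm_congr (w : List W) {y z : MarkovShift τ} (h0 : y.seq 0 = z.seq 0)
    (h : ∀ i, τ (concat w y.seq i) (concat w y.seq (i + 1))) (i : ℕ) :
    τ (concat w z.seq i) (concat w z.seq (i + 1)) := by
  rcases lt_trichotomy (i + 1) w.length with hi | hi | hi
  · simpa only [concat_of_lt hi, concat_of_lt ((Nat.lt_succ_self i).trans hi)] using h i
  · have hy := h i
    rw [concat_of_lt (by omega), concat_of_ge hi.ge, hi, Nat.sub_self] at hy ⊢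
    rwa [← h0]
  · rw [concat_of_ge (by omega), concat_of_ge hi.le, Nat.sub_add_comm (by omega)]
    exact z.adm _

lemma prepend_seq {w : List W} {z : MarkovShift τ} (h : (w ++ [z.seq 0]).IsChain τ) (i : ℕ) :
    (prepend w z).seq i = concat w z.seq i := by
  rw [prepend, dif_pos (concat_adm h)]

lemma prepend_seq_of_lt {w : List W} {z : MarkovShift τ} (h : (w ++ [z.seq 0]).IsChain τ) {i : ℕ}
    (hi : i < w.length) : (prepend w z).seq i = w[i] := by
  rw [prepend_seq h, concat_of_lt hi]

lemma prepend_seq_length_add {w : List W} {z : MarkovShift τ} (h : (w ++ [z.seq 0]).IsChain τ)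
    (i : ℕ) : (prepend w z).seq (i + w.length) = z.seq i := by
  rw [prepend_seq h, concat_of_ge (by omega)]; simp

lemma prepend_seq_eq_getElem? {w : List W} {z : MarkovShift τ} (h : (w ++ [z.seq 0]).IsChain τ)
    {i : ℕ} (hi : i ≤ w.length) : (w ++ [z.seq 0])[i]? = some ((prepend w z).seq i) := by
  rcases hi.lt_or_eq with hi | rfl
  · rw [prepend_seq_of_lt h hi, List.getElem?_append_left hi]; simp
  · have := prepend_seq_length_add h 0
    rw [zero_add] at this
    simp [this]

lemma prepend_seq_zero {w : List W} {z : MarkovShift τ} (h : (w ++ [z.seq 0]).IsChain τ) :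
    (w ++ [z.seq 0]).head? = some ((prepend w z).seq 0) := by
  rw [← prepend_seq_eq_getElem? h (Nat.zero_le _), List.head?_eq_getElem?]

lemma shift_iterate_prepend {w : List W} {z : MarkovShift τ} (h : (w ++ [z.seq 0]).IsChain τ) :
    shift^[w.length] (prepend w z) = z :=
  ext_seq fun i => by rw [shift_iterate_seq, prepend_seq_length_add h]

lemma isChain_append_singleton_of_append {u v : List W} {b d : W}
    (h : (u ++ v ++ [d]).IsChain τ) (hb : (v ++ [d]).head? = some b) :
    (u ++ [b]).IsChain τ ∧ (v ++ [d]).IsChain τ := by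
  rw [List.append_assoc, List.isChain_append] at h
  refine ⟨?_, h.2.1⟩
  rw [List.isChain_append]
  refine ⟨h.1, List.isChain_singleton _, fun y hy z hz => h.2.2 y hy z ?_⟩
  rw [List.head?_singleton, Option.mem_some_iff] at hz
  rwa [← hz]

lemma isChain_append_append {u v : List W} {b d : W} (hb : (v ++ [d]).head? = some b)
    (hu : (u ++ [b]).IsChain τ) (hv : (v ++ [d]).IsChain τ) : (u ++ v ++ [d]).IsChain τ := by
  rw [List.isChain_append] at hu
  rw [List.append_assoc, List.isChain_append]
  refine ⟨hu.1, hv, fun y hy z hz => hu.2.2 y hy z ?_⟩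
  rw [hb] at hz; simpa using hz

lemma prepend_append {u v : List W} {z : MarkovShift τ} (h : (u ++ v ++ [z.seq 0]).IsChain τ) :
    prepend (u ++ v) z = prepend u (prepend v z) := by
  have hv : (v ++ [z.seq 0]).IsChain τ := by
    rw [List.append_assoc, List.isChain_append] at h; exact h.2.1
  have hu := (isChain_append_singleton_of_append h (prepend_seq_zero hv)).1
  refine ext_seq fun i => ?_
  rw [prepend_seq h, prepend_seq hu]
  rcases lt_or_ge i u.length with hi | hi
  · rw [concat_of_lt (by simp; omega), concat_of_lt hi, List.getElem_append_left hi]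
  · rw [concat_of_ge hi, prepend_seq hv]
    rcases lt_or_ge i (u ++ v).length with hi' | hi'
    · rw [concat_of_lt hi', concat_of_lt (by simp at hi'; omega), List.getElem_append_right hi]
    · rw [concat_of_ge hi', concat_of_ge (by simp at hi'; omega)]
      congr 1; simp; omega

lemma birkhoffProd_pos {R : MarkovShift τ → ℝ} (hR : ∀ z, 0 < R z) (n : ℕ) (z : MarkovShift τ) :
    0 < birkhoffProd R n z := Finset.prod_pos fun _ _ => hR _

lemma log_birkhoffProd {R : MarkovShift τ → ℝ} (hR : ∀ z, 0 < R z) (n : ℕ) (z : MarkovShift τ) :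
    Real.log (birkhoffProd R n z) = ∑ i ∈ Finset.range n, Real.log (R (shift^[i] z)) :=
  Real.log_prod fun _ _ => (hR _).ne'

lemma birkhoffProd_add (R : MarkovShift τ → ℝ) (m n : ℕ) (z : MarkovShift τ) :
    birkhoffProd R (m + n) z = birkhoffProd R m z * birkhoffProd R n (shift^[m] z) := by
  simp only [birkhoffProd, Finset.prod_range_add]
  congr 1
  refine Finset.prod_congr rfl fun i _ => ?_
  rw [add_comm, Function.iterate_add_apply]

lemma mem_cylinder_iff {w : List W} {z : MarkovShift τ} :
    z ∈ cylinder τ w ↔ ∀ i (h : i < w.length), z.seq i = w[i] := by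
  refine ⟨fun h i hi => h i _ (by simp [hi]), fun h i b hb => ?_⟩
  obtain ⟨hi, rfl⟩ := List.getElem?_eq_some_iff.1 hb
  exact h i hi

lemma mem_cylinder_singleton {b : W} {z : MarkovShift τ} : z ∈ cylinder τ [b] ↔ z.seq 0 = b := by
  simp [mem_cylinder_iff]

/-- The initial word `z₀ ⋯ z_{n-1}` of length `n` of a point `z`. -/
def initWord (z : MarkovShift τ) (n : ℕ) : List W := (List.range n).map z.seq

@[simp] lemma length_initWord (z : MarkovShift τ) (n : ℕ) : (initWord z n).length = n := by
  simp [initWord]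

lemma initWord_append (z : MarkovShift τ) (n : ℕ) :
    initWord z n ++ [z.seq n] = initWord z (n + 1) := by
  simp [initWord, List.range_succ]

lemma isChain_initWord (z : MarkovShift τ) (n : ℕ) : (initWord z n).IsChain τ := by
  rw [List.isChain_iff_getElem]
  intro i hi
  simpa [initWord] using z.adm i

lemma head?_initWord_succ (z : MarkovShift τ) (n : ℕ) :
    (initWord z (n + 1)).head? = some (z.seq 0) := by
  simp [initWord, List.head?_eq_getElem?]

lemma IsMixing.exists_path (hmix : IsMixing τ) (b d : W) (N : ℕ) :
    ∃ e : List W, N ≤ e.length ∧ (e ++ [d]).IsChain τ ∧ (e ++ [d]).head? = some b := by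
  obtain ⟨N₀, h⟩ := hmix b d
  obtain ⟨z, hz, hz'⟩ := h (max N N₀) (le_max_right _ _)
  refine ⟨initWord z (max N N₀), by simp, ?_⟩
  rw [← hz', initWord_append, ← hz]
  exact ⟨isChain_initWord _ _, head?_initWord_succ _ _⟩

lemma IsMixing.exists_path_avoiding (hmix : IsMixing τ) (b d : W) :
    ∃ e : List W, d ∉ e ∧ (e ++ [d]).IsChain τ ∧ (e ++ [d]).head? = some b := by
  classical
  obtain ⟨N₀, h⟩ := hmix b d
  obtain ⟨z, hz, hz'⟩ := h N₀ le_rfl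
  obtain ⟨m, hm, hmin⟩ : ∃ m, z.seq m = d ∧ ∀ i < m, z.seq i ≠ d :=
    have hex : ∃ n, z.seq n = d := ⟨_, hz'⟩
    ⟨Nat.find hex, Nat.find_spec hex, fun i hi => Nat.find_min hex hi⟩
  refine ⟨initWord z m, ?_, ?_⟩
  · intro hd
    simp only [initWord, List.mem_map, List.mem_range] at hd
    obtain ⟨i, hi, hid⟩ := hd
    exact hmin i hi hid
  · rw [← hm, initWord_append, ← hz]
    exact ⟨isChain_initWord _ _, head?_initWord_succ _ _⟩

lemma IsMixing.exists_seq_zero_eq (hmix : IsMixing τ) (b : W) : ∃ z : MarkovShift τ, z.seq 0 = b :=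
  let ⟨_, h⟩ := hmix b b
  let ⟨z, hz, _⟩ := h _ le_rfl
  ⟨z, hz⟩

lemma rel_getElem_mod_length {w : List W} {b : W} (hb : w.head? = some b)
    (hw : (w ++ [b]).IsChain τ) (hl : 0 < w.length) (i : ℕ) :
    τ (w[i % w.length]'(Nat.mod_lt _ hl)) (w[(i + 1) % w.length]'(Nat.mod_lt _ hl)) := by
  have hi := Nat.mod_lt i hl
  have hw0 : w[0] = b := by simpa [List.head?_eq_getElem?, hl] using hb
  have h := List.isChain_iff_getElem.1 hw (i % w.length) (by simpa using hi)
  rw [List.getElem_append_left hi] at h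
  rcases (Nat.succ_le_of_lt hi).lt_or_eq with hnext | hlast
  · have hmod : (i + 1) % w.length = i % w.length + 1 := by
      rw [← Nat.mod_add_mod, Nat.mod_eq_of_lt hnext]
    rw [List.getElem_append_left hnext] at h
    simpa only [hmod] using h
  · have hmod : (i + 1) % w.length = 0 := by
      rw [← Nat.mod_add_mod, ← Nat.succ_eq_add_one (i % _), hlast, Nat.mod_self]
    rw [List.getElem_append_right (by omega)] at h
    simpa only [hmod, hw0, List.getElem_singleton] using h

lemma exists_periodic {w : List W} {b : W} (hb : w.head? = some b)
    (hw : (w ++ [b]).IsChain τ) :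
    ∃ z : MarkovShift τ, shift^[w.length] z = z ∧ z.seq 0 = b ∧
      ∀ i, i ≤ w.length → (w ++ [b])[i]? = some (z.seq i) := by
  have hne : w ≠ [] := by rintro rfl; simp at hb
  have hl : 0 < w.length := List.length_pos_iff.2 hne
  have hw0 : w[0] = b := by simpa [List.head?_eq_getElem?, hl] using hb
  refine ⟨⟨fun i => w[i % w.length]'(Nat.mod_lt _ hl), rel_getElem_mod_length hb hw hl⟩,
    ext_seq fun i => ?_, ?_, fun i hi => ?_⟩
  · rw [shift_iterate_seq]
    simp
  · simpa using hw0
  · rcases hi.lt_or_eq with hi | rfl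
    · rw [List.getElem?_append_left hi]
      simp [Nat.mod_eq_of_lt hi]
    · simp [hw0]

end Words

section Distortion

variable {W : Type*} {τ : W → W → Prop} {R : MarkovShift τ → ℝ} {K : ℝ}

/-- Bounded distortion: the Birkhoff products of length `n` at two points with the same first
`n + 1` letters differ by a factor of at most `K`. -/
def BoundedDistortion (R : MarkovShift τ → ℝ) (K : ℝ) : Prop :=
  ∀ (n : ℕ) (y z : MarkovShift τ), (∀ i ≤ n, y.seq i = z.seq i) →
    birkhoffProd R n y ≤ K * birkhoffProd R n z

lemma BoundedDistortion.one_le (hK : BoundedDistortion R K) (z : MarkovShift τ) : 1 ≤ K := by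
  simpa [birkhoffProd] using hK 0 z z fun _ _ => rfl

lemma BoundedDistortion.nonneg (hK : BoundedDistortion R K) (z : MarkovShift τ) : 0 ≤ K :=
  zero_le_one.trans (hK.one_le z)

lemma IsLocallyHolder.exists_boundedDistortion (hR : IsLocallyHolder R) (hpos : ∀ z, 0 < R z) :
    ∃ K, BoundedDistortion R K := by
  obtain ⟨C, θ, hθ0, hθ1, hC⟩ := hR
  refine ⟨Real.exp (C * θ ^ 2 * (1 - θ)⁻¹), fun n y z hyz => ?_⟩
  have hCθ : 0 ≤ C * θ ^ 2 := by simpa using hC 2 le_rfl y y fun _ _ => rfl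
  have hshift : ∀ i ∈ Finset.range n, Real.log (R (shift^[i] y)) - Real.log (R (shift^[i] z)) ≤
      C * θ ^ 2 * θ ^ (n - 1 - i) := by
    intro i hi
    rw [Finset.mem_range] at hi
    rw [mul_assoc, ← pow_add]
    refine (le_abs_self _).trans (hC _ (by omega) _ _ fun j hj => ?_)
    rw [shift_iterate_seq, shift_iterate_seq]
    exact hyz _ (by omega)
  have hlog : Real.log (birkhoffProd R n y) - Real.log (birkhoffProd R n z) ≤
      C * θ ^ 2 * (1 - θ)⁻¹ := calc
    _ = ∑ i ∈ Finset.range n, (Real.log (R (shift^[i] y)) - Real.log (R (shift^[i] z))) := by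
      rw [log_birkhoffProd hpos, log_birkhoffProd hpos, Finset.sum_sub_distrib]
    _ ≤ ∑ i ∈ Finset.range n, C * θ ^ 2 * θ ^ (n - 1 - i) := Finset.sum_le_sum hshift
    _ = C * θ ^ 2 * ∑ i ∈ Finset.range n, θ ^ i := by
      rw [← Finset.mul_sum, Finset.sum_range_reflect]
    _ ≤ C * θ ^ 2 * (1 - θ)⁻¹ := by
      gcongr
      rw [← tsum_geometric_of_lt_one hθ0.le hθ1]
      exact (summable_geometric_of_lt_one hθ0.le hθ1).sum_le_tsum _ fun i _ => by positivity
  rw [← Real.log_le_log_iff (birkhoffProd_pos hpos _ _)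
      (mul_pos (Real.exp_pos _) (birkhoffProd_pos hpos _ _)),
    Real.log_mul (Real.exp_ne_zero _) (birkhoffProd_pos hpos _ _).ne', Real.log_exp]
  linarith

open Classical in
/-- The weight `R_{|v|}(vz)` of a word `v`, zero if `vz` is not admissible. -/
noncomputable def wordWeight (R : MarkovShift τ → ℝ) (z : MarkovShift τ) (v : List W) : ℝ≥0∞ :=
  if (v ++ [z.seq 0]).IsChain τ then ENNReal.ofReal (birkhoffProd R v.length (prepend v z)) else 0

lemma wordWeight_of_isChain {z : MarkovShift τ} {v : List W} (h : (v ++ [z.seq 0]).IsChain τ) :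
    wordWeight R z v = ENNReal.ofReal (birkhoffProd R v.length (prepend v z)) := if_pos h

lemma wordWeight_of_not_isChain {z : MarkovShift τ} {v : List W}
    (h : ¬ (v ++ [z.seq 0]).IsChain τ) : wordWeight R z v = 0 := if_neg h

lemma wordWeight_ne_top (z : MarkovShift τ) (v : List W) : wordWeight R z v ≠ ∞ := by
  unfold wordWeight; split_ifs <;> simp

lemma wordWeight_pos (hpos : ∀ z, 0 < R z) {z : MarkovShift τ} {v : List W}
    (h : (v ++ [z.seq 0]).IsChain τ) : 0 < wordWeight R z v := by
  rw [wordWeight_of_isChain h]; simpa using birkhoffProd_pos hpos _ _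

lemma prepend_seq_congr {u : List W} {y z : MarkovShift τ} (hu : (u ++ [y.seq 0]).IsChain τ)
    (h : y.seq 0 = z.seq 0) {i : ℕ} (hi : i ≤ u.length) :
    (prepend u y).seq i = (prepend u z).seq i := by
  have hy := prepend_seq_eq_getElem? hu hi
  have hz := prepend_seq_eq_getElem? (z := z) (h ▸ hu) hi
  rw [h, hz] at hy
  simpa using hy.symm

lemma wordWeight_append (hpos : ∀ z, 0 < R z) {z : MarkovShift τ} {v : List W}
    (hv : (v ++ [z.seq 0]).IsChain τ) (u : List W) :
    wordWeight R z (u ++ v) = wordWeight R (prepend v z) u * wordWeight R z v := by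
  by_cases hu : (u ++ [(prepend v z).seq 0]).IsChain τ
  · have huv := isChain_append_append (prepend_seq_zero hv) hu hv
    rw [wordWeight_of_isChain huv, wordWeight_of_isChain hu, wordWeight_of_isChain hv,
      ← ENNReal.ofReal_mul (birkhoffProd_pos hpos _ _).le, List.length_append, birkhoffProd_add,
      prepend_append huv, shift_iterate_prepend hu]
  · rw [wordWeight_of_not_isChain hu, zero_mul, wordWeight_of_not_isChain fun huv =>
      hu (isChain_append_singleton_of_append huv (prepend_seq_zero hv)).1]

lemma BoundedDistortion.wordWeight_le_of_seq_zero (hK : BoundedDistortion R K)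
    {y z : MarkovShift τ} (h : y.seq 0 = z.seq 0) (u : List W) :
    wordWeight R y u ≤ ENNReal.ofReal K * wordWeight R z u := by
  by_cases hu : (u ++ [y.seq 0]).IsChain τ
  · rw [wordWeight_of_isChain hu, wordWeight_of_isChain (h ▸ hu),
      ← ENNReal.ofReal_mul (hK.nonneg y)]
    exact ENNReal.ofReal_le_ofReal (hK _ _ _ fun i => prepend_seq_congr hu h)
  · rw [wordWeight_of_not_isChain hu]
    exact zero_le

lemma seq_zero_eq_prepend {v : List W} {y z : MarkovShift τ} (hv : (v ++ [z.seq 0]).IsChain τ)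
    (h : (v ++ [z.seq 0]).head? = some (y.seq 0)) : y.seq 0 = (prepend v z).seq 0 :=
  Option.some.inj (h.symm.trans (prepend_seq_zero hv))

lemma BoundedDistortion.wordWeight_append_le (hK : BoundedDistortion R K)
    (hpos : ∀ z, 0 < R z) {y z : MarkovShift τ} {u v : List W}
    (h : (v ++ [z.seq 0]).head? = some (y.seq 0)) :
    wordWeight R z (u ++ v) ≤ ENNReal.ofReal K * (wordWeight R y u * wordWeight R z v) := by
  by_cases hv : (v ++ [z.seq 0]).IsChain τ
  · rw [wordWeight_append hpos hv, ← mul_assoc]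
    gcongr
    exact hK.wordWeight_le_of_seq_zero (seq_zero_eq_prepend hv h).symm u
  · rw [wordWeight_of_not_isChain fun huv => hv (isChain_append_singleton_of_append huv h).2]
    exact zero_le

lemma BoundedDistortion.wordWeight_mul_le (hK : BoundedDistortion R K)
    (hpos : ∀ z, 0 < R z) {y z : MarkovShift τ} {u v : List W}
    (h : (v ++ [z.seq 0]).head? = some (y.seq 0)) :
    wordWeight R y u * wordWeight R z v ≤ ENNReal.ofReal K * wordWeight R z (u ++ v) := by
  by_cases hv : (v ++ [z.seq 0]).IsChain τ
  · rw [wordWeight_append hpos hv, ← mul_assoc]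
    gcongr
    exact hK.wordWeight_le_of_seq_zero (seq_zero_eq_prepend hv h) u
  · rw [wordWeight_of_not_isChain hv, mul_zero]
    exact zero_le

lemma BoundedDistortion.exists_periodic_wordWeight_le (hK : BoundedDistortion R K)
    {z : MarkovShift τ} {w : List W} (hb : w.head? = some (z.seq 0))
    (hw : (w ++ [z.seq 0]).IsChain τ) :
    ∃ p : MarkovShift τ, shift^[w.length] p = p ∧ p.seq 0 = z.seq 0 ∧
      (∀ i (h : i < w.length), p.seq i = w[i]) ∧
      wordWeight R z w ≤ ENNReal.ofReal K * ENNReal.ofReal (birkhoffProd R w.length p) := by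
  obtain ⟨p, hper, hp0, hp⟩ := exists_periodic hb hw
  refine ⟨p, hper, hp0, fun i hi => ?_, ?_⟩
  · have hpi := hp i hi.le
    rw [List.getElem?_append_left hi] at hpi
    simpa [hi] using hpi.symm
  · rw [wordWeight_of_isChain hw, ← ENNReal.ofReal_mul (hK.nonneg z)]
    refine ENNReal.ofReal_le_ofReal (hK _ _ _ fun i hi => ?_)
    have hwi := prepend_seq_eq_getElem? hw hi
    rw [hp i hi] at hwi
    simpa using hwi.symm

end Distortion

end MarkovShift

section TsumComparison

lemma summable_of_tsum_ofReal_ne_top {α : Type*} {f : α → ℝ} (hf : ∀ a, 0 ≤ f a)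
    (h : ∑' a, ENNReal.ofReal (f a) ≠ ∞) : Summable f := by
  simpa only [ENNReal.toReal_ofReal (hf _)] using ENNReal.summable_toReal h

lemma tsum_subtype_le_mul_tsum_of_rel {α β : Type*} {S : Set α} {f : α → ℝ≥0∞} {g : β → ℝ≥0∞}
    {C : ℝ≥0∞} (rel : α → β → Prop)
    (hrel : ∀ v ∈ S, f v ≠ 0 → ∃ p, rel v p ∧ f v ≤ C * g p)
    (hinj : ∀ v ∈ S, ∀ v' ∈ S, ∀ p, rel v p → rel v' p → v = v') :
    ∑' v : S, f v ≤ C * ∑' p, g p := by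
  have hex : ∀ v : {v : S // f v ≠ 0}, ∃ p, rel v.1 p ∧ f v.1 ≤ C * g p :=
    fun v => hrel v.1.1 v.1.2 v.2
  choose φ hφ hle using hex
  have hφinj : Function.Injective φ := fun v v' hv =>
    Subtype.ext (Subtype.ext (hinj _ v.1.2 _ v'.1.2 (φ v) (hφ v) (hv ▸ hφ v')))
  calc ∑' v : S, f v = ∑' v : {v : S // f v ≠ 0}, f v.1 :=
        (tsum_subtype_eq_of_support_subset (f := fun v : S => f v) (s := {v : S | f v ≠ 0})
          (fun v hv => hv)).symm
    _ ≤ ∑' v, C * g (φ v) := ENNReal.tsum_le_tsum hle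
    _ = C * ∑' v, g (φ v) := ENNReal.tsum_mul_left
    _ ≤ C * ∑' p, g p := by gcongr; exact ENNReal.tsum_comp_le_tsum_of_injective hφinj g

lemma tsum_subtype_le_mul_tsum_of_injOn {α β : Type*} {S : Set α} {T : Set β} {f : α → ℝ≥0∞}
    {g : β → ℝ≥0∞} {C : ℝ≥0∞} (φ : α → β) (hφ : InjOn φ S)
    (h : ∀ v ∈ S, f v ≠ 0 → φ v ∈ T ∧ f v ≤ C * g (φ v)) :
    ∑' v : S, f v ≤ C * ∑' p : T, g p :=
  tsum_subtype_le_mul_tsum_of_rel (g := fun p : T => g p) (fun v p => φ v = p)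
    (fun v hv hf => ⟨⟨φ v, (h v hv hf).1⟩, rfl, (h v hv hf).2⟩)
    fun _ hv _ hv' _ hp hp' => hφ hv hv' (hp.trans hp'.symm)

end TsumComparison

namespace MarkovShift

section WordSums

variable {W : Type*} {τ : W → W → Prop} {R : MarkovShift τ → ℝ} {K : ℝ}

/-- The words of length `n` with first letter `b`. -/
def wordsFrom (b : W) (n : ℕ) : Set (List W) := {v | v.head? = some b ∧ v.length = n}

/-- The words whose only occurrence of `B` is the first letter. These are the loops of first return
to `B`, with the final `B` omitted. -/
def returnWords (B : W) : Set (List W) := {v | v.head? = some B ∧ B ∉ v.tail}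

/-- For every letter `B` the sums of `Rₙ` over the points of `[B]` with `σⁿ x = x` are bounded for
large `n`. This is the upper half of positive recurrence. -/
def HasBoundedPeriodicSums (R : MarkovShift τ → ℝ) : Prop :=
  ∀ B : W, ∃ M : ℝ≥0∞, M ≠ ∞ ∧ ∀ᶠ n : ℕ in atTop, periodicSum R B n ≤ M

lemma IsPositiveRecurrent.hasBoundedPeriodicSums (h : IsPositiveRecurrent R) :
    HasBoundedPeriodicSums R := fun B =>
  let ⟨M, _, hM⟩ := h B
  ⟨ENNReal.ofReal M, ENNReal.ofReal_ne_top, hM.mono fun _ hn => hn.2⟩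

lemma BoundedDistortion.tsum_wordWeight_le_tsum_periodic (hK : BoundedDistortion R K)
    {z : MarkovShift τ} {n : ℕ} {S : Set (List W)} {P : MarkovShift τ → Prop}
    (hS : S ⊆ wordsFrom (z.seq 0) n)
    (hP : ∀ v ∈ S, ∀ p : MarkovShift τ, shift^[n] p = p → p.seq 0 = z.seq 0 →
      (∀ i (h : i < v.length), p.seq i = v[i]) → P p) :
    ∑' v : S, wordWeight R z v ≤
      ENNReal.ofReal K * ∑' p : {p // P p}, ENNReal.ofReal (birkhoffProd R n p.1) := by
  refine tsum_subtype_le_mul_tsum_of_rel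
    (fun v p => ∀ i (h : i < v.length), p.1.seq i = v[i]) ?_ ?_
  · intro v hv hne
    have hchain : (v ++ [z.seq 0]).IsChain τ := by
      by_contra h
      exact hne (wordWeight_of_not_isChain h)
    obtain ⟨hhead, rfl⟩ := hS hv
    obtain ⟨p, hper, hp0, hp, hle⟩ := hK.exists_periodic_wordWeight_le hhead hchain
    exact ⟨⟨p, hP v hv p hper hp0 hp⟩, hp, hle⟩
  · intro v hv v' hv' p hp hp'
    exact List.ext_getElem ((hS hv).2.trans (hS hv').2.symm) fun i hi hi' =>
      (hp i hi).symm.trans (hp' i hi')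

lemma BoundedDistortion.tsum_wordsFrom_le_periodicSum (hK : BoundedDistortion R K)
    (z : MarkovShift τ) (n : ℕ) :
    ∑' v : wordsFrom (z.seq 0) n, wordWeight R z v ≤
      ENNReal.ofReal K * periodicSum R (z.seq 0) n :=
  hK.tsum_wordWeight_le_tsum_periodic subset_rfl fun _ _ _ hper hp0 _ => ⟨hper, hp0⟩

lemma BoundedDistortion.tsum_returnWords_le_firstReturnSum (hK : BoundedDistortion R K)
    (z : MarkovShift τ) (n : ℕ) :
    ∑' v : {v | v ∈ returnWords (z.seq 0) ∧ v.length = n}, wordWeight R z v ≤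
      ENNReal.ofReal K * firstReturnSum R (z.seq 0) n := by
  refine hK.tsum_wordWeight_le_tsum_periodic (fun v hv => ⟨hv.1.1, hv.2⟩) ?_
  rintro v ⟨⟨-, hfirst⟩, rfl⟩ p hper hp0 hp
  refine ⟨hper, hp0, fun i hi0 hi hpi => hfirst ?_⟩
  rw [← hpi, hp i hi, List.mem_iff_getElem]
  refine ⟨i - 1, by simp only [List.length_tail]; omega, ?_⟩
  simp only [List.getElem_tail, Nat.sub_add_cancel hi0]

lemma BoundedDistortion.wordWeight_le_append (hK : BoundedDistortion R K)
    (hpos : ∀ z, 0 < R z) {y z : MarkovShift τ} {e : List W}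
    (he : (e ++ [y.seq 0]).IsChain τ) (hz : (e ++ [y.seq 0]).head? = some (z.seq 0))
    (v : List W) :
    wordWeight R z v ≤ (ENNReal.ofReal K / wordWeight R y e) * wordWeight R y (v ++ e) := by
  rw [← ENNReal.mul_div_right_comm, ENNReal.le_div_iff_mul_le
    (Or.inl (wordWeight_pos hpos he).ne') (Or.inl (wordWeight_ne_top _ _))]
  exact hK.wordWeight_mul_le hpos hz

lemma BoundedDistortion.wordWeight_le_prepend (hK : BoundedDistortion R K)
    (hpos : ∀ z, 0 < R z) {y z : MarkovShift τ} {p v : List W}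
    (hp : (p ++ [y.seq 0]).IsChain τ) (hv : (v ++ [z.seq 0]).head? = some (y.seq 0)) :
    wordWeight R z v ≤ (ENNReal.ofReal K / wordWeight R y p) * wordWeight R z (p ++ v) := by
  rw [← ENNReal.mul_div_right_comm, ENNReal.le_div_iff_mul_le
    (Or.inl (wordWeight_pos hpos hp).ne') (Or.inl (wordWeight_ne_top _ _)), mul_comm]
  exact hK.wordWeight_mul_le hpos hv

lemma div_wordWeight_ne_top (hpos : ∀ z, 0 < R z) {y : MarkovShift τ} {e : List W}
    (he : (e ++ [y.seq 0]).IsChain τ) (K : ℝ) : ENNReal.ofReal K / wordWeight R y e ≠ ∞ :=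
  ENNReal.div_ne_top ENNReal.ofReal_ne_top (wordWeight_pos hpos he).ne'

lemma head?_append_of_head? {v e : List W} {b : W} (h : v.head? = some b) :
    (v ++ e).head? = some b := by
  rw [List.head?_append, h, Option.some_or]

/-- The sums of `R_{|v|}(vz)` over the words `v` with first letter `b` and of a given length are
bounded, uniformly in the length. -/
def HasBoundedWordSums (R : MarkovShift τ → ℝ) (b : W) (z : MarkovShift τ) : Prop :=
  ∃ M : ℝ≥0∞, M ≠ ∞ ∧ ∀ n, ∑' v : wordsFrom b n, wordWeight R z v ≤ M

lemma HasBoundedPeriodicSums.hasBoundedWordSums (hper : HasBoundedPeriodicSums R)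
    (hmix : IsMixing τ) (hpos : ∀ z, 0 < R z) (hK : BoundedDistortion R K)
    (b : W) (z : MarkovShift τ) : HasBoundedWordSums R b z := by
  obtain ⟨M, hM, hev⟩ := hper b
  obtain ⟨N, hN⟩ := eventually_atTop.1 hev
  obtain ⟨y, rfl⟩ := hmix.exists_seq_zero_eq b
  obtain ⟨e, heN, he, hez⟩ := hmix.exists_path (z.seq 0) (y.seq 0) N
  refine ⟨(ENNReal.ofReal K / wordWeight R y e) * (ENNReal.ofReal K * M),
    ENNReal.mul_ne_top (div_wordWeight_ne_top hpos he K)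
      (ENNReal.mul_ne_top ENNReal.ofReal_ne_top hM), fun n => ?_⟩
  calc ∑' v : wordsFrom (y.seq 0) n, wordWeight R z v
      ≤ (ENNReal.ofReal K / wordWeight R y e) *
          ∑' v : wordsFrom (y.seq 0) (n + e.length), wordWeight R y v := by
        refine tsum_subtype_le_mul_tsum_of_injOn (fun v => v ++ e)
          (fun v _ v' _ h => List.append_cancel_right h) ?_
        rintro v ⟨hv, rfl⟩ -
        exact ⟨⟨head?_append_of_head? hv, by simp⟩, hK.wordWeight_le_append hpos he hez v⟩
    _ ≤ (ENNReal.ofReal K / wordWeight R y e) *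
          (ENNReal.ofReal K * periodicSum R (y.seq 0) (n + e.length)) := by
        gcongr
        exact hK.tsum_wordsFrom_le_periodicSum y _
    _ ≤ (ENNReal.ofReal K / wordWeight R y e) * (ENNReal.ofReal K * M) := by
        gcongr
        exact hN _ (by omega)

end WordSums

end MarkovShift

section Energy

variable {Y : Type*} {q q' : Y → ℝ≥0∞}

/-- The square of the `ℓ²` norm of a non-negative function. -/
noncomputable def energy (q : Y → ℝ≥0∞) : ℝ≥0∞ := ∑' y, q y ^ 2

lemma energy_mono (h : ∀ y, q y ≤ q' y) : energy q ≤ energy q' :=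
  ENNReal.tsum_le_tsum fun y => by gcongr; exact h y

lemma energy_const_mul (C : ℝ≥0∞) (q : Y → ℝ≥0∞) :
    energy (fun y => C * q y) = C ^ 2 * energy q := by
  simp only [energy, mul_pow, ENNReal.tsum_mul_left]

lemma energy_iSup {q : ℕ → Y → ℝ≥0∞} (hq : Monotone q) :
    energy (fun y => ⨆ n, q n y) = ⨆ n, energy (q n) := by
  have hsq : ∀ y, (⨆ n, q n y) ^ 2 = ⨆ n, q n y ^ 2 := fun y => by
    have hmap := (ENNReal.orderIsoRpow 2 (by norm_num)).map_iSup (fun n => q n y)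
    simp only [ENNReal.orderIsoRpow_apply] at hmap
    simpa only [← ENNReal.rpow_natCast, Nat.cast_ofNat] using hmap
  simp only [energy, hsq]
  refine le_antisymm ?_ (iSup_le fun n => ENNReal.tsum_le_tsum fun y =>
    le_iSup (fun n => q n y ^ 2) n)
  rw [ENNReal.tsum_eq_iSup_sum]
  refine iSup_le fun S => ?_
  rw [ENNReal.finsetSum_iSup_of_monotone]
  · exact iSup_mono fun n => ENNReal.sum_le_tsum _
  · intro y m n hmn
    dsimp only
    gcongr
    exact hq hmn y

lemma apply_ne_top_of_energy_ne_top (h : energy q ≠ ∞) (y : Y) : q y ≠ ∞ := fun hy =>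
  ENNReal.ne_top_of_tsum_ne_top h y (by simp only [hy, ne_eq, OfNat.ofNat_ne_zero,
    not_false_eq_true, ENNReal.top_pow])

lemma memℓp_toReal_of_energy_ne_top (h : energy q ≠ ∞) :
    Memℓp (E := fun _ : Y => ℝ) (fun y => (q y).toReal) 2 :=
  memℓp_gen (by simpa using ENNReal.summable_toReal h)

lemma norm_sq_eq_tsum_sq (f : lp (fun _ : Y => ℝ) 2) : ‖f‖ ^ 2 = ∑' y, f y ^ 2 := by
  simpa using lp.norm_rpow_eq_tsum (p := 2) (by norm_num) f

lemma hasSum_of_hasSum_apply {α : Type*} {F : α → lp (fun _ : Y => ℝ) 2}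
    {Q : lp (fun _ : Y => ℝ) 2} (hF : ∀ a y, 0 ≤ F a y)
    (hsum : ∀ y, HasSum (fun a => F a y) (Q y)) : HasSum F Q := by
  have hsq : Summable fun y => Q y ^ 2 := by simpa using (lp.memℓp Q).summable (by norm_num)
  have hlim : Tendsto (fun S : Finset α => ∑' y, (∑ a ∈ S, F a y - Q y) ^ 2) atTop
      (𝓝 (∑' _ : Y, 0)) := by
    refine tendsto_tsum_of_dominated_convergence hsq (fun y => ?_)
      (Eventually.of_forall fun S y => ?_)
    · simpa using ((hsum y).sub_const (Q y)).pow 2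
    · have hle := sum_le_hasSum S (fun a _ => hF a y) (hsum y)
      have hnonneg := Finset.sum_nonneg fun a (_ : a ∈ S) => hF a y
      rw [Real.norm_of_nonneg (sq_nonneg _)]
      nlinarith
  have hnorm : ∀ S : Finset α, ‖∑ a ∈ S, F a - Q‖ = √(∑' y, (∑ a ∈ S, F a y - Q y) ^ 2) := by
    intro S
    rw [← Real.sqrt_sq (norm_nonneg (∑ a ∈ S, F a - Q)), norm_sq_eq_tsum_sq]
    simp only [lp.coeFn_sub, Pi.sub_apply, lp.coeFn_sum, Finset.sum_apply]
  rw [HasSum, tendsto_iff_norm_sub_tendsto_zero]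
  simp only [hnorm]
  simpa [Function.comp_def] using (Real.continuous_sqrt.tendsto _).comp hlim

end Energy

section PositiveVectors

variable {G ι : Type*} [Group G] {H : ι → Subgroup G}

@[simp] lemma quotRep_apply_apply (g : G) (f : QuotSum H) (y : Σ j : ι, G ⧸ H j) :
    quotRep H g f y = f (g⁻¹ • y) := rfl

lemma quotRep_mul_apply (g h : G) (f : QuotSum H) :
    quotRep H (g * h) f = quotRep H g (quotRep H h f) := by rw [map_mul]; rfl

lemma quotRep_inv_apply (g : G) (f : QuotSum H) : (quotRep H g)⁻¹ f = quotRep H g⁻¹ f := by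
  rw [map_inv]

lemma inner_quotRep_left (g : G) (f₁ f₂ : QuotSum H) :
    inner ℝ (quotRep H g f₁) f₂ = inner ℝ f₁ (quotRep H g⁻¹ f₂) := by
  rw [← (quotRep H g⁻¹).inner_map_map, ← quotRep_mul_apply]
  simp

lemma ofReal_inner_eq_tsum {f₁ f₂ : QuotSum H} (h₁ : ∀ y, 0 ≤ f₁ y) (h₂ : ∀ y, 0 ≤ f₂ y) :
    ENNReal.ofReal (inner ℝ f₁ f₂) = ∑' y, ENNReal.ofReal (f₁ y) * ENNReal.ofReal (f₂ y) := by
  rw [lp.inner_eq_tsum, ENNReal.ofReal_tsum_of_nonneg]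
  · refine tsum_congr fun y => ?_
    rw [← ENNReal.ofReal_mul (h₁ y)]
    simp [mul_comm]
  · intro y; simpa using mul_nonneg (h₂ y) (h₁ y)
  · exact lp.summable_inner f₁ f₂

lemma inner_nonneg_of_nonneg {f₁ f₂ : QuotSum H} (h₁ : ∀ y, 0 ≤ f₁ y) (h₂ : ∀ y, 0 ≤ f₂ y) :
    0 ≤ inner ℝ f₁ f₂ := by
  rw [lp.inner_eq_tsum]
  exact tsum_nonneg fun y => by simpa using mul_nonneg (h₂ y) (h₁ y)

lemma inner_quotRep_quotRep_le (g h : G) (f : QuotSum H) :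
    inner ℝ (quotRep H g f) (quotRep H h f) ≤ inner ℝ f f := by
  refine (real_inner_le_norm _ _).trans ?_
  rw [LinearIsometryEquiv.norm_map, LinearIsometryEquiv.norm_map, real_inner_self_eq_norm_mul_norm]

lemma ofReal_inner_self_eq_energy {f : QuotSum H} (h : ∀ y, 0 ≤ f y) :
    ENNReal.ofReal (inner ℝ f f) = energy fun y => ENNReal.ofReal (f y) := by
  simp only [ofReal_inner_eq_tsum h h, energy, sq]

variable {V : Type*} {p : V → G} {f : QuotSum H}

/-- The function `∑ ω(v) ρ(p v) f`, with values in `[0, ∞]`. -/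
noncomputable def weightedSum (p : V → G) (f : QuotSum H) (ω : V → ℝ≥0∞)
    (y : Σ j : ι, G ⧸ H j) : ℝ≥0∞ :=
  ∑' v, ω v * ENNReal.ofReal (quotRep H (p v) f y)

lemma weightedSum_mono {ω ω' : V → ℝ≥0∞} (h : ∀ v, ω v ≤ ω' v) (y : Σ j : ι, G ⧸ H j) :
    weightedSum p f ω y ≤ weightedSum p f ω' y :=
  ENNReal.tsum_le_tsum fun v => by gcongr; exact h v

lemma weightedSum_const_mul (C : ℝ≥0∞) (ω : V → ℝ≥0∞) (y : Σ j : ι, G ⧸ H j) :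
    weightedSum p f (fun v => C * ω v) y = C * weightedSum p f ω y := by
  simp only [weightedSum, mul_assoc, ENNReal.tsum_mul_left]

open Classical in
/-- The function `φ` on `G` is the image of the weights `ω` under `p`. -/
def IsPushWeight {G : Type*} (p : V → G) (ω : V → ℝ≥0∞) (φ : G → ℝ) : Prop :=
  ∀ g, 0 ≤ φ g ∧ ENNReal.ofReal (φ g) = ∑' v, if p v = g then ω v else 0

namespace IsPushWeight

lemma tsum_mul {G : Type*} {p : V → G} {ω : V → ℝ≥0∞} {φ : G → ℝ} (h : IsPushWeight p ω φ)
    (F : G → ℝ≥0∞) : ∑' g, ENNReal.ofReal (φ g) * F g = ∑' v, ω v * F (p v) := by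
  classical
  calc ∑' g, ENNReal.ofReal (φ g) * F g = ∑' g, ∑' v, (if p v = g then ω v * F g else 0) := by
        refine tsum_congr fun g => ?_
        rw [(h g).2, ← ENNReal.tsum_mul_right]
        refine tsum_congr fun v => ?_
        split_ifs with hv
        · convert rfl
        · simp
    _ = ∑' v, ∑' g, (if p v = g then ω v * F g else 0) := ENNReal.tsum_comm
    _ = _ := by
        refine tsum_congr fun v => ?_
        rw [tsum_eq_single (p v) (fun g hg => if_neg hg.symm), if_pos rfl]

variable {ω : V → ℝ≥0∞} {φ : G → ℝ}

lemma summable_of_tsum_ne_top (h : IsPushWeight p ω φ) (hω : ∑' v, ω v ≠ ∞) :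
    Summable fun g => φ g • quotRep H g f := by
  have htsum : ∑' g, ENNReal.ofReal (φ g) = ∑' v, ω v := by simpa using h.tsum_mul 1
  have hφ : Summable φ := summable_of_tsum_ofReal_ne_top (fun g => (h g).1) (htsum ▸ hω)
  refine Summable.of_norm ?_
  simp only [norm_smul, LinearIsometryEquiv.norm_map, Real.norm_of_nonneg (h _).1]
  exact hφ.mul_right _

lemma mul_apply_nonneg (h : IsPushWeight p ω φ) (hf : ∀ y, 0 ≤ f y) (g : G)
    (y : Σ j : ι, G ⧸ H j) : 0 ≤ φ g * f (g⁻¹ • y) := mul_nonneg (h g).1 (hf _)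

lemma tsum_ofReal_mul_apply (h : IsPushWeight p ω φ) (f : QuotSum H) (y : Σ j : ι, G ⧸ H j) :
    ∑' g, ENNReal.ofReal (φ g * f (g⁻¹ • y)) = weightedSum p f ω y := by
  simp only [ENNReal.ofReal_mul (h _).1]
  exact h.tsum_mul fun g => ENNReal.ofReal (f (g⁻¹ • y))

lemma repConv_apply (h : IsPushWeight p ω φ) (hf : ∀ y, 0 ≤ f y)
    (hs : Summable fun g => φ g • quotRep H g f) (y : Σ j : ι, G ⧸ H j) :
    0 ≤ repConv H φ f y ∧ ENNReal.ofReal (repConv H φ f y) = weightedSum p f ω y := by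
  have hy : HasSum (fun g => φ g * f (g⁻¹ • y)) (repConv H φ f y) :=
    (lp.evalCLM ℝ (fun _ : (Σ j : ι, G ⧸ H j) => ℝ) 2 y).hasSum hs.hasSum
  rw [← hy.tsum_eq, ← h.tsum_ofReal_mul_apply]
  exact ⟨tsum_nonneg fun g => h.mul_apply_nonneg hf g y,
    ENNReal.ofReal_tsum_of_nonneg (fun g => h.mul_apply_nonneg hf g y) hy.summable⟩

lemma summable_of_energy_ne_top (h : IsPushWeight p ω φ) (hf : ∀ y, 0 ≤ f y)
    (hE : energy (weightedSum p f ω) ≠ ∞) :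
    Summable fun g => φ g • quotRep H g f := by
  refine (hasSum_of_hasSum_apply (Q := ⟨_, memℓp_toReal_of_energy_ne_top hE⟩)
    (h.mul_apply_nonneg hf) fun y => ?_).summable
  have hfin := apply_ne_top_of_energy_ne_top hE y
  rw [← h.tsum_ofReal_mul_apply] at hfin
  have hy := ENNReal.hasSum_toReal hfin
  rw [← ENNReal.tsum_toReal_eq fun g => ENNReal.ofReal_ne_top, h.tsum_ofReal_mul_apply] at hy
  simp only [ENNReal.toReal_ofReal (h.mul_apply_nonneg hf _ y)] at hy
  exact hy

lemma ofReal_inner_self (h : IsPushWeight p ω φ) (hf : ∀ y, 0 ≤ f y)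
    (hs : Summable fun g => φ g • quotRep H g f) :
    ENNReal.ofReal (inner ℝ (repConv H φ f) (repConv H φ f)) = energy (weightedSum p f ω) := by
  rw [ofReal_inner_self_eq_energy fun y => (h.repConv_apply hf hs y).1]
  congr 1
  exact funext fun y => (h.repConv_apply hf hs y).2

lemma tsum_inner (h : IsPushWeight p ω φ) (hf : ∀ y, 0 ≤ f y)
    (hs : Summable fun g => φ g • quotRep H g f) {P : QuotSum H} (hP : ∀ y, 0 ≤ P y) :
    ∑' v, ω v * ENNReal.ofReal (inner ℝ (quotRep H (p v) f) P) =
      ENNReal.ofReal (inner ℝ (repConv H φ f) P) := by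
  rw [ofReal_inner_eq_tsum (fun y => (h.repConv_apply hf hs y).1) hP]
  simp only [(h.repConv_apply hf hs _).2, weightedSum, ← ENNReal.tsum_mul_right]
  rw [ENNReal.tsum_comm]
  refine tsum_congr fun v => ?_
  rw [ofReal_inner_eq_tsum (f₁ := quotRep H (p v) f) (fun y => hf _) hP, ← ENNReal.tsum_mul_left]
  simp only [mul_assoc]

end IsPushWeight

end PositiveVectors

namespace MarkovShift

section PathWeights

variable {W : Type*} {τ : W → W → Prop} {R : MarkovShift τ → ℝ}

/-- The words with first letter `A` and last letter `a`. -/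
def pathWords (A a : W) : Set (List W) := {v | v.head? = some A ∧ v.getLast? = some a}

open Classical in
/-- The weight `κ(|v|) R_{|v|}(vx)` on the words from `A` to `a`. -/
noncomputable def pathWeight (R : MarkovShift τ → ℝ) (A a : W) (x : MarkovShift τ)
    (κ : ℕ → ℝ≥0∞) (v : List W) : ℝ≥0∞ :=
  if v ∈ pathWords A a then κ v.length * wordWeight R x v else 0

variable {A a : W} {x : MarkovShift τ}

lemma pathWeight_of_mem {κ : ℕ → ℝ≥0∞} {v : List W} (h : v ∈ pathWords A a) :
    pathWeight R A a x κ v = κ v.length * wordWeight R x v := if_pos h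

lemma pathWeight_of_notMem {κ : ℕ → ℝ≥0∞} {v : List W} (h : v ∉ pathWords A a) :
    pathWeight R A a x κ v = 0 := if_neg h

lemma pathWeight_mono {κ κ' : ℕ → ℝ≥0∞} (h : ∀ n, κ n ≤ κ' n) (v : List W) :
    pathWeight R A a x κ v ≤ pathWeight R A a x κ' v := by
  unfold pathWeight; split_ifs
  · gcongr; exact h _
  · exact le_rfl

lemma pathWeight_const_mul (C : ℝ≥0∞) (κ : ℕ → ℝ≥0∞) (v : List W) :
    pathWeight R A a x (fun n => C * κ n) v = C * pathWeight R A a x κ v := by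
  unfold pathWeight; split_ifs
  · rw [mul_assoc]
  · simp

lemma length_pos_of_mem_pathWords {v : List W} (h : v ∈ pathWords A a) : 0 < v.length := by
  rcases v with _ | ⟨b, v⟩
  · simp [pathWords] at h
  · simp

/-- The coefficients `κ` cut off after `N`. -/
noncomputable def truncate (κ : ℕ → ℝ≥0∞) (N : ℕ) (n : ℕ) : ℝ≥0∞ := if n ≤ N then κ n else 0

lemma truncate_le (κ : ℕ → ℝ≥0∞) (N n : ℕ) : truncate κ N n ≤ κ n := by
  unfold truncate; split_ifs <;> simp

lemma truncate_mono (κ : ℕ → ℝ≥0∞) {N N' : ℕ} (h : N ≤ N') (n : ℕ) :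
    truncate κ N n ≤ truncate κ N' n := by
  unfold truncate; split_ifs <;> first | omega | simp

lemma iSup_truncate_mul (κ : ℕ → ℝ≥0∞) (n : ℕ) (r : ℝ≥0∞) :
    ⨆ N, truncate κ N n * r = κ n * r := by
  refine le_antisymm (iSup_le fun N => by gcongr; exact truncate_le _ _ _) ?_
  refine le_trans (le_of_eq ?_) (le_iSup _ n)
  simp [truncate]

lemma pathWeight_eq_iSup (κ : ℕ → ℝ≥0∞) (v : List W) :
    pathWeight R A a x κ v = ⨆ N, pathWeight R A a x (truncate κ N) v := by
  unfold pathWeight; split_ifs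
  · rw [iSup_truncate_mul]
  · simp

lemma tsum_pathWeight_mul (κ : ℕ → ℝ≥0∞) (F : List W → ℝ≥0∞) :
    ∑' v, pathWeight R A a x κ v * F v =
      ∑' n, κ n * ∑' v, pathWeight R A a x (Pi.single n 1) v * F v := by
  simp_rw [← ENNReal.tsum_mul_left]
  rw [ENNReal.tsum_comm]
  refine tsum_congr fun v => ?_
  rw [tsum_eq_single v.length]
  · unfold pathWeight; split_ifs <;> simp [mul_assoc]
  · intro n hn
    unfold pathWeight; split_ifs <;> simp [hn.symm]

lemma tsum_pathWeight_single_le (n : ℕ) :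
    ∑' v, pathWeight R A a x (Pi.single n 1) v ≤ ∑' v : wordsFrom A n, wordWeight R x v := by
  rw [tsum_subtype]
  refine ENNReal.tsum_le_tsum fun v => ?_
  unfold pathWeight
  split_ifs with h
  · by_cases hn : v.length = n
    · rw [indicator_of_mem (show v ∈ wordsFrom A n from ⟨h.1, hn⟩)]; simp [hn]
    · simp [hn]
  · exact zero_le

variable {G ι : Type*} [Group G] {s : W → G} {H : ι → Subgroup G} {f : QuotSum H}

/-- `‖∑ κ(|v|) R_{|v|}(vx) ρ(𝔰(v)) f‖²`. -/
noncomputable def pathEnergy (R : MarkovShift τ → ℝ) (s : W → G) (A a : W) (x : MarkovShift τ)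
    (f : QuotSum H) (κ : ℕ → ℝ≥0∞) : ℝ≥0∞ :=
  energy (weightedSum (wordProd s) f (pathWeight R A a x κ))

lemma pathEnergy_mono {κ κ' : ℕ → ℝ≥0∞} (h : ∀ n, κ n ≤ κ' n) :
    pathEnergy R s A a x f κ ≤ pathEnergy R s A a x f κ' :=
  energy_mono fun _ => weightedSum_mono (pathWeight_mono h) _

lemma pathEnergy_const_mul (C : ℝ≥0∞) (κ : ℕ → ℝ≥0∞) :
    pathEnergy R s A a x f (fun n => C * κ n) = C ^ 2 * pathEnergy R s A a x f κ := by
  rw [pathEnergy, pathEnergy, ← energy_const_mul]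
  congr 1; funext y
  rw [← weightedSum_const_mul]
  congr 1; funext v
  exact pathWeight_const_mul _ _ _

lemma pathEnergy_eq_iSup (κ : ℕ → ℝ≥0∞) :
    pathEnergy R s A a x f κ = ⨆ N, pathEnergy R s A a x f (truncate κ N) := by
  unfold pathEnergy
  rw [← energy_iSup fun N N' h y => weightedSum_mono (pathWeight_mono (truncate_mono κ h)) y]
  congr 1; funext y
  refine le_antisymm ?_
    (iSup_le fun N => weightedSum_mono (pathWeight_mono (truncate_le κ N)) y)
  rw [weightedSum, ENNReal.tsum_eq_iSup_sum]
  refine iSup_le fun S => ?_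
  simp only [pathWeight_eq_iSup κ, ENNReal.iSup_mul]
  rw [ENNReal.finsetSum_iSup_of_monotone]
  · exact iSup_mono fun N => ENNReal.sum_le_tsum _
  · intro v N N' h
    dsimp only
    gcongr
    exact pathWeight_mono (truncate_mono κ h) v

lemma energy_ne_top_of_tsum_ne_top {V : Type*} {p : V → G} {ω : V → ℝ≥0∞} (hf : ∀ y, 0 ≤ f y)
    (h : ∑' v, ω v ≠ ∞) : energy (weightedSum p f ω) ≠ ∞ := by
  classical
  have hφ : IsPushWeight p ω fun g => (∑' v, if p v = g then ω v else 0).toReal := by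
    intro g
    refine ⟨ENNReal.toReal_nonneg, ?_⟩
    rw [ENNReal.ofReal_toReal]
    refine ne_top_of_le_ne_top h (ENNReal.tsum_le_tsum fun v => ?_)
    split_ifs <;> simp
  rw [← hφ.ofReal_inner_self hf (hφ.summable_of_tsum_ne_top h)]
  exact ENNReal.ofReal_ne_top

lemma HasBoundedWordSums.tsum_pathWeight_single_ne_top (hsum : HasBoundedWordSums R A x)
    (n : ℕ) : ∑' v, pathWeight R A a x (Pi.single n 1) v ≠ ∞ :=
  let ⟨_, hM, hle⟩ := hsum
  ne_top_of_le_ne_top hM ((tsum_pathWeight_single_le n).trans (hle n))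

lemma HasBoundedWordSums.tsum_pathWeight_ne_top (hsum : HasBoundedWordSums R A x)
    {κ : ℕ → ℝ≥0∞} (hκ : ∑' n, κ n ≠ ∞) : ∑' v, pathWeight R A a x κ v ≠ ∞ := by
  obtain ⟨M, hM, hle⟩ := hsum
  have hlength := tsum_pathWeight_mul (R := R) (A := A) (a := a) (x := x) κ fun _ => 1
  simp only [mul_one] at hlength
  rw [hlength]
  refine ne_top_of_le_ne_top (ENNReal.mul_ne_top hκ hM) ?_
  rw [← ENNReal.tsum_mul_right]
  refine ENNReal.tsum_le_tsum fun n => ?_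
  gcongr
  exact (tsum_pathWeight_single_le n).trans (hle n)

lemma tsum_truncate_ne_top {κ : ℕ → ℝ≥0∞} (hκ : ∀ n, κ n ≠ ∞) (N : ℕ) :
    ∑' n, truncate κ N n ≠ ∞ := by
  rw [tsum_eq_sum (s := Finset.range (N + 1))]
  · refine (ENNReal.sum_lt_top.2 fun n _ => ?_).ne
    exact ((truncate_le κ N n).trans_lt (hκ n).lt_top)
  · intro n hn
    simp only [Finset.mem_range, not_lt] at hn
    simp [truncate]; omega

end PathWeights

section Densities

variable {W : Type*} {τ : W → W → Prop} {R : MarkovShift τ → ℝ} {A a : W} {x : MarkovShift τ}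
  {G ι : Type*} [Group G] {s : W → G} {H : ι → Subgroup G} {f : QuotSum H}

lemma isChain_append_of_getLast? (hax : τ a (x.seq 0)) {v : List W} (hv : v.IsChain τ)
    (hl : v.getLast? = some a) : (v ++ [x.seq 0]).IsChain τ := by
  rw [List.isChain_append]
  refine ⟨hv, List.isChain_singleton _, fun y hy z hz => ?_⟩
  simp only [hl, List.head?_cons, Option.mem_def, Option.some.injEq] at hy hz
  rwa [← hy, ← hz]

lemma pathWeight_single (hax : τ a (x.seq 0)) (n : ℕ) :
    pathWeight R A a x (Pi.single n 1) = {w : List W | IsWord τ A a n w}.indicator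
      fun v => ENNReal.ofReal (birkhoffProd R n (prepend v x)) := by
  ext v
  by_cases hv : IsWord τ A a n v
  · rw [indicator_of_mem (by exact hv)]
    obtain ⟨rfl, hchain, hA, ha⟩ := hv
    rw [pathWeight_of_mem ⟨hA, ha⟩,
      wordWeight_of_isChain (isChain_append_of_getLast? hax hchain ha), Pi.single_eq_same, one_mul]
  · rw [indicator_of_notMem (by exact hv)]
    by_contra hne
    have hmem : v ∈ pathWords A a := by
      by_contra h
      exact hne (pathWeight_of_notMem h)
    rw [pathWeight_of_mem hmem, mul_eq_zero, not_or] at hne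
    have hlength : v.length = n := by
      by_contra h
      exact hne.1 (Pi.single_eq_of_ne h 1)
    have hchain : (v ++ [x.seq 0]).IsChain τ := by
      by_contra h
      exact hne.2 (wordWeight_of_not_isChain h)
    exact hv ⟨hlength, (List.isChain_append.1 hchain).1, hmem.1, hmem.2⟩

lemma tsum_isWord_eq_tsum_pathWeight (hax : τ a (x.seq 0)) (n : ℕ) (P : List W → Prop)
    [DecidablePred P] :
    ∑' w : {w : List W // IsWord τ A a n w ∧ P w},
        ENNReal.ofReal (birkhoffProd R n (prepend w.1 x)) =
      ∑' v, pathWeight R A a x (Pi.single n 1) v * (if P v then 1 else 0) := by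
  refine (tsum_subtype {w : List W | IsWord τ A a n w ∧ P w}
    fun v => ENNReal.ofReal (birkhoffProd R n (prepend v x))).trans (tsum_congr fun v => ?_)
  rw [pathWeight_single hax]
  by_cases hP : P v <;> by_cases hv : IsWord τ A a n v <;> simp [hP, hv]

open Classical in
lemma ofReal_tsum_isWord (hpos : ∀ z, 0 < R z) (hax : τ a (x.seq 0)) (n : ℕ) (g : G)
    (hfin : ∑' v, pathWeight R A a x (Pi.single n 1) v ≠ ∞) :
    ENNReal.ofReal (∑' w : {w : List W // IsWord τ A a n w ∧ wordProd s w = g},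
        birkhoffProd R n (prepend w.1 x)) =
      ∑' v, pathWeight R A a x (Pi.single n 1) v * (if wordProd s v = g then 1 else 0) := by
  have hsum := tsum_isWord_eq_tsum_pathWeight (R := R) (A := A) hax n (wordProd s · = g)
  have hnonneg : ∀ w : {w : List W // IsWord τ A a n w ∧ wordProd s w = g},
      0 ≤ birkhoffProd R n (prepend w.1 x) := fun _ => (birkhoffProd_pos hpos _ _).le
  rw [← hsum, ENNReal.ofReal_tsum_of_nonneg hnonneg]
  refine summable_of_tsum_ofReal_ne_top hnonneg (hsum ▸ ne_top_of_le_ne_top hfin ?_)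
  refine ENNReal.tsum_le_tsum fun v => ?_
  split_ifs <;> simp

/-- The coefficients `t⁻ⁿ cₙ`. -/
noncomputable def coeff (c : ℕ → ℝ) (t : ℝ) (n : ℕ) : ℝ≥0∞ := ENNReal.ofReal ((t ^ n)⁻¹ * c n)

lemma coeff_ne_top (c : ℕ → ℝ) (t : ℝ) (n : ℕ) : coeff c t n ≠ ∞ := ENNReal.ofReal_ne_top

lemma densityTerm_nonneg (hpos : ∀ z, 0 < R z) {c : ℕ → ℝ} (hc : ∀ n, 0 ≤ c n) {t : ℝ}
    (ht : 0 < t) (g : G) (n : ℕ) : 0 ≤ densityTerm R s A a x c t g n :=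
  mul_nonneg (mul_nonneg (by positivity) (hc n))
    (tsum_nonneg fun _ => (birkhoffProd_pos hpos _ _).le)

open Classical in
lemma ofReal_densityTerm (hpos : ∀ z, 0 < R z) (hax : τ a (x.seq 0)) {c : ℕ → ℝ}
    (hc : ∀ n, 0 ≤ c n) {t : ℝ} (ht : 0 < t) (g : G) (n : ℕ)
    (hfin : ∑' v, pathWeight R A a x (Pi.single n 1) v ≠ ∞) :
    ENNReal.ofReal (densityTerm R s A a x c t g n) =
      coeff c t n *
        ∑' v, pathWeight R A a x (Pi.single n 1) v * (if wordProd s v = g then 1 else 0) := by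
  rw [densityTerm, ENNReal.ofReal_mul (mul_nonneg (by positivity) (hc n)),
    ofReal_tsum_isWord hpos hax n g hfin, coeff]

lemma pathWeight_single_zero (v : List W) : pathWeight R A a x (Pi.single 0 1) v = 0 := by
  by_cases h : v ∈ pathWords A a
  · rw [pathWeight_of_mem h, Pi.single_eq_of_ne (length_pos_of_mem_pathWords h).ne', zero_mul]
  · exact pathWeight_of_notMem h

lemma isPushWeight_densityPartial (hpos : ∀ z, 0 < R z) (hax : τ a (x.seq 0)) {c : ℕ → ℝ}
    (hc : ∀ n, 0 ≤ c n) {t : ℝ} (ht : 0 < t)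
    (hfin : ∀ n, ∑' v, pathWeight R A a x (Pi.single n 1) v ≠ ∞) (N : ℕ) :
    IsPushWeight (wordProd s) (pathWeight R A a x (truncate (coeff c t) N))
      (densityPartial R s A a x c t N) := by
  classical
  intro g
  refine ⟨Finset.sum_nonneg fun n _ => densityTerm_nonneg hpos hc ht g n, ?_⟩
  rw [densityPartial, ENNReal.ofReal_sum_of_nonneg fun n _ => densityTerm_nonneg hpos hc ht g n]
  have hlength := tsum_pathWeight_mul (R := R) (A := A) (a := a) (x := x) (truncate (coeff c t) N)
    fun v => if wordProd s v = g then 1 else 0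
  simp only [mul_ite, mul_one, mul_zero] at hlength
  refine Eq.trans ?_ (hlength.symm.trans (by congr!))
  rw [tsum_eq_sum (s := Finset.Icc 1 N)]
  · refine Finset.sum_congr rfl fun n hn => ?_
    rw [ofReal_densityTerm hpos hax hc ht g n (hfin n), truncate, if_pos (Finset.mem_Icc.1 hn).2]
    simp only [mul_ite, mul_one, mul_zero]
  · intro n hn
    rcases Nat.eq_zero_or_pos n with rfl | hn0
    · simp [pathWeight_single_zero]
    · have hnN : ¬ n ≤ N := fun h => hn (Finset.mem_Icc.2 ⟨hn0, h⟩)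
      simp [truncate, hnN]

lemma exists_pos_of_ne_zero (hf : ∀ y, 0 ≤ f y) (hf0 : f ≠ 0) : ∃ y, 0 < f y := by
  by_contra! h
  exact hf0 (lp.ext (funext fun y => le_antisymm (h y) (hf y)))

lemma tsum_fiber_ne_top (hf : ∀ y, 0 ≤ f y) (hf0 : f ≠ 0) {V : Type*} {p : V → G}
    {ω : V → ℝ≥0∞} (hE : energy (weightedSum p f ω) ≠ ∞) (g : G) (S : V → Prop)
    [DecidablePred S] (hS : ∀ v, S v → p v = g) : ∑' v, (if S v then ω v else 0) ≠ ∞ := by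
  obtain ⟨y, hy⟩ := exists_pos_of_ne_zero hf hf0
  intro h
  refine apply_ne_top_of_energy_ne_top hE (g • y) ?_
  have hle : ∑' v, (if S v then ω v else 0) * ENNReal.ofReal (f y) ≤ weightedSum p f ω (g • y) := by
    refine ENNReal.tsum_le_tsum fun v => ?_
    split_ifs with hv
    · rw [quotRep_apply_apply, hS v hv, inv_smul_smul]
    · simp
  rw [ENNReal.tsum_mul_right, h, ENNReal.top_mul (by simpa using hy)] at hle
  exact top_le_iff.1 hle

lemma isPushWeight_density (hpos : ∀ z, 0 < R z) (hax : τ a (x.seq 0)) {c : ℕ → ℝ}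
    (hc : ∀ n, 0 ≤ c n) {t : ℝ} (ht : 0 < t) (hf : ∀ y, 0 ≤ f y) (hf0 : f ≠ 0)
    (hfin : ∀ n, ∑' v, pathWeight R A a x (Pi.single n 1) v ≠ ∞)
    (hE : pathEnergy R s A a x f (coeff c t) ≠ ∞) :
    (∀ g, Summable fun n : ℕ => densityTerm R s A a x c t g (n + 1)) ∧
    IsPushWeight (wordProd s) (pathWeight R A a x (coeff c t)) (density R s A a x c t) := by
  classical
  have htsum : ∀ g, ∑' n, ENNReal.ofReal (densityTerm R s A a x c t g (n + 1)) =
      ∑' v, if wordProd s v = g then pathWeight R A a x (coeff c t) v else 0 := by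
    intro g
    have hlength := tsum_pathWeight_mul (R := R) (A := A) (a := a) (x := x) (coeff c t)
      fun v => if wordProd s v = g then 1 else 0
    simp only [mul_ite, mul_one, mul_zero] at hlength
    symm
    rw [hlength, tsum_eq_zero_add' ENNReal.summable]
    simp only [ofReal_densityTerm hpos hax hc ht g _ (hfin _), pathWeight_single_zero, mul_ite,
      mul_one, mul_zero, ite_self, tsum_zero, zero_add]
  have hsum : ∀ g, Summable fun n : ℕ => densityTerm R s A a x c t g (n + 1) := fun g =>
    summable_of_tsum_ofReal_ne_top (fun n => densityTerm_nonneg hpos hc ht g _)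
      (htsum g ▸ tsum_fiber_ne_top hf hf0 hE g _ fun v hv => hv)
  refine ⟨hsum, fun g => ⟨tsum_nonneg fun n => densityTerm_nonneg hpos hc ht g _, ?_⟩⟩
  rw [density, ENNReal.ofReal_tsum_of_nonneg (fun n => densityTerm_nonneg hpos hc ht g _) (hsum g),
    htsum g]

end Densities

end MarkovShift

section SlowlyIncreasing

lemma exists_antitone_tendsto_zero_of_strictMono {N : ℕ → ℕ} (hN : StrictMono N) :
    ∃ d : ℕ → ℝ, Antitone d ∧ (∀ i, 0 ≤ d i) ∧ Tendsto d atTop (𝓝 0) ∧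
      ∀ j i, i < N (j + 1) → 1 / ((j : ℝ) + 1) ≤ d i := by
  let J : ℕ → ℕ := fun i => Nat.findGreatest (fun j => N j ≤ i) i
  have hJmono : Monotone J := fun i k hik =>
    Nat.findGreatest_mono (fun j (h : N j ≤ i) => h.trans hik) hik
  have hJle : ∀ j i, i < N (j + 1) → J i ≤ j := by
    intro j i hi
    by_contra! h
    refine hi.not_ge ?_
    calc N (j + 1) ≤ N (J i) := hN.monotone h
      _ ≤ i := Nat.findGreatest_of_ne_zero (P := fun j => N j ≤ i) rfl (by omega)
  have hJtop : Tendsto J atTop atTop := tendsto_atTop_atTop_of_monotone hJmono fun j =>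
    ⟨N j, Nat.le_findGreatest hN.le_apply le_rfl⟩
  refine ⟨fun i => 1 / ((J i : ℝ) + 1), fun i k hik => ?_, fun i => by positivity,
    tendsto_one_div_add_atTop_nhds_zero_nat.comp hJtop, fun j i hi => ?_⟩
  · have hJik : (J i : ℝ) ≤ J k := by exact_mod_cast hJmono hik
    dsimp only
    gcongr
  · have hJij : (J i : ℝ) ≤ j := by exact_mod_cast hJle j i hi
    dsimp only
    gcongr

lemma isSlowlyIncreasing_exp_sum_range {d : ℕ → ℝ} (hd0 : ∀ i, 0 ≤ d i)
    (hdt : Tendsto d atTop (𝓝 0))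
    (hunb : Tendsto (fun n => ∑ i ∈ Finset.range n, d i) atTop atTop) :
    IsSlowlyIncreasing fun n => Real.exp (∑ i ∈ Finset.range n, d i) := by
  refine ⟨fun _ => Real.exp_pos _, ?_, Real.tendsto_exp_atTop.comp hunb, fun k => ?_⟩
  · refine monotone_nat_of_le_succ fun n => ?_
    rw [Real.exp_le_exp, Finset.sum_range_succ]
    linarith [hd0 n]
  · have hblock : Tendsto (fun n => ∑ i ∈ Finset.range k, d (n + i)) atTop (𝓝 0) := by
      rw [show (0 : ℝ) = ∑ _i ∈ Finset.range k, (0 : ℝ) by simp]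
      exact tendsto_finsetSum _ fun i _ => hdt.comp (tendsto_add_atTop_nat i)
    have hexp := (Real.continuous_exp.tendsto 0).comp hblock
    rw [Real.exp_zero] at hexp
    refine hexp.congr fun n => ?_
    simp only [Function.comp_apply]
    rw [Finset.sum_range_add, Real.exp_add, mul_div_cancel_left₀ _ (Real.exp_pos _).ne']

lemma exp_sum_range_add_le {d : ℕ → ℝ} (hd : Antitone d) (m n : ℕ) :
    Real.exp (∑ i ∈ Finset.range (m + n), d i) ≤
      Real.exp (∑ i ∈ Finset.range m, d i) * Real.exp (∑ i ∈ Finset.range n, d i) := by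
  rw [← Real.exp_add, Real.exp_le_exp, Finset.sum_range_add]
  gcongr
  exact hd (by omega)

lemma exists_isSlowlyIncreasing_exp_le {N : ℕ → ℕ} (hN : StrictMono N)
    (hsq : ∀ j, (j + 1) ^ 2 ≤ N (j + 1)) :
    ∃ c : ℕ → ℝ, IsSlowlyIncreasing c ∧ (∀ m n, c (m + n) ≤ c m * c n) ∧
      ∀ j n, n ≤ N (j + 1) → Real.exp (n * (1 / ((j : ℝ) + 1))) ≤ c n := by
  obtain ⟨d, hd, hd0, hdt, hdN⟩ := exists_antitone_tendsto_zero_of_strictMono hN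
  have hsum : ∀ j n, n ≤ N (j + 1) → n * (1 / ((j : ℝ) + 1)) ≤ ∑ i ∈ Finset.range n, d i := by
    intro j n hn
    have hcard := Finset.card_nsmul_le_sum (Finset.range n) d (1 / ((j : ℝ) + 1)) fun i hi =>
      hdN j i ((Finset.mem_range.1 hi).trans_le hn)
    rwa [Finset.card_range, nsmul_eq_mul] at hcard
  have hmono : Monotone fun n => ∑ i ∈ Finset.range n, d i := by
    refine monotone_nat_of_le_succ fun n => ?_
    rw [Finset.sum_range_succ]
    linarith [hd0 n]
  have hunb : Tendsto (fun n => ∑ i ∈ Finset.range n, d i) atTop atTop := by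
    refine tendsto_atTop_atTop_of_monotone hmono fun b => ?_
    obtain ⟨j, hj⟩ := exists_nat_ge b
    refine ⟨N (j + 1), le_trans ?_ (hsum j _ le_rfl)⟩
    have hsq' : ((j : ℝ) + 1) ^ 2 ≤ N (j + 1) := by exact_mod_cast hsq j
    have hj0 : (0 : ℝ) < (j : ℝ) + 1 := by positivity
    rw [mul_one_div, le_div_iff₀ hj0]
    nlinarith
  exact ⟨_, isSlowlyIncreasing_exp_sum_range hd0 hdt hunb, exp_sum_range_add_le hd,
    fun j n hn => Real.exp_le_exp.2 (hsum j n hn)⟩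

lemma IsSlowlyIncreasing.exists_le_mul_pow {c : ℕ → ℝ} (hc : IsSlowlyIncreasing c) {r : ℝ}
    (hr : 1 < r) : ∃ C, 0 < C ∧ ∀ n, c n ≤ C * r ^ n := by
  obtain ⟨hpos, hmono, -, hratio⟩ := hc
  obtain ⟨N, hN⟩ := eventually_atTop.1 ((hratio 1).eventually (gt_mem_nhds hr))
  refine ⟨c N, hpos N, fun n => ?_⟩
  have hgeom : ∀ k, c (N + k) ≤ c N * r ^ k := by
    intro k
    induction k with
    | zero => simp
    | succ k ih =>
      calc c (N + (k + 1)) ≤ r * c (N + k) :=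
            ((div_lt_iff₀ (hpos _)).1 (hN (N + k) (by omega))).le
        _ ≤ r * (c N * r ^ k) := by gcongr
        _ = _ := by ring
  rcases le_total n N with h | h
  · calc c n ≤ c N := hmono h
      _ ≤ c N * r ^ n := le_mul_of_one_le_right (hpos N).le (one_le_pow₀ hr.le)
  · obtain ⟨k, rfl⟩ := Nat.exists_eq_add_of_le h
    refine (hgeom k).trans ?_
    have hcN := hpos N
    gcongr
    · exact hr.le
    · omega

end SlowlyIncreasing

namespace MarkovShift

section DecayExponent

variable {W : Type*} {τ : W → W → Prop} {R : MarkovShift τ → ℝ} {A a : W} {x : MarkovShift τ}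
  {G ι : Type*} [Group G] {s : W → G} {H : ι → Subgroup G} {f : QuotSum H}

lemma bddAbove_inner_iff (hpos : ∀ z, 0 < R z) (hax : τ a (x.seq 0))
    (hsum : HasBoundedWordSums R A x) (hf : ∀ y, 0 ≤ f y) {t : ℝ}
    (ht : 0 < t) :
    BddAbove (range fun N : ℕ =>
      inner ℝ (repConv H (densityPartial R s A a x (fun _ => 1) t N) f)
        (repConv H (densityPartial R s A a x (fun _ => 1) t N) f)) ↔
      pathEnergy R s A a x f (coeff (fun _ => 1) t) ≠ ∞ := by
  set q : ℕ → ℝ := fun N => inner ℝ (repConv H (densityPartial R s A a x (fun _ => 1) t N) f)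
    (repConv H (densityPartial R s A a x (fun _ => 1) t N) f)
  have hq : ∀ N, ENNReal.ofReal (q N) =
      pathEnergy R s A a x f (truncate (coeff (fun _ => 1) t) N) := by
    intro N
    have h := isPushWeight_densityPartial (s := s) hpos hax (c := fun _ => 1)
      (fun _ => zero_le_one) ht (hsum.tsum_pathWeight_single_ne_top (a := a)) N
    exact h.ofReal_inner_self hf (h.summable_of_tsum_ne_top
      (hsum.tsum_pathWeight_ne_top (tsum_truncate_ne_top (coeff_ne_top _ _) N)))
  rw [pathEnergy_eq_iSup]
  simp only [← hq]
  constructor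
  · rintro ⟨B, hB⟩
    exact ne_top_of_le_ne_top ENNReal.ofReal_ne_top
      (iSup_le fun N => ENNReal.ofReal_le_ofReal (hB ⟨N, rfl⟩))
  · intro h
    exact ⟨_, forall_mem_range.2 fun N => (ENNReal.ofReal_le_iff_le_toReal h).1
      (le_iSup (fun N => ENNReal.ofReal (q N)) N)⟩

lemma decayExponent_eq (hpos : ∀ z, 0 < R z) (hax : τ a (x.seq 0)) (hsum : HasBoundedWordSums R A x)
    (hf : ∀ y, 0 ≤ f y) :
    decayExponent R s A a x H f =
      sInf {t : ℝ | 0 < t ∧ pathEnergy R s A a x f (coeff (fun _ => 1) t) ≠ ∞} := by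
  rw [decayExponent]
  congr 1
  ext t
  exact and_congr_right fun ht => bddAbove_inner_iff hpos hax hsum hf ht

lemma pathEnergy_coeff_one_two_ne_top (hsum : HasBoundedWordSums R A x)
    (hf : ∀ y, 0 ≤ f y) :
    pathEnergy R s A a x f (coeff (fun _ => 1) 2) ≠ ∞ := by
  refine energy_ne_top_of_tsum_ne_top hf (hsum.tsum_pathWeight_ne_top ?_)
  have hgeom : Summable fun n : ℕ => (((2 : ℝ) ^ n)⁻¹ * 1) := by
    simpa using! summable_geometric_two
  exact hgeom.tsum_ofReal_ne_top

lemma pathEnergy_ne_top_of_decayExponent_lt (hpos : ∀ z, 0 < R z) (hax : τ a (x.seq 0))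
    (hsum : HasBoundedWordSums R A x) (hf : ∀ y, 0 ≤ f y)
    {c : ℕ → ℝ} (hc : IsSlowlyIncreasing c) {t : ℝ} (ht : decayExponent R s A a x H f < t) :
    pathEnergy R s A a x f (coeff c t) ≠ ∞ := by
  rw [decayExponent_eq hpos hax hsum hf] at ht
  have hne : {t : ℝ | 0 < t ∧ pathEnergy R s A a x f (coeff (fun _ => 1) t) ≠ ∞}.Nonempty :=
    ⟨2, two_pos, pathEnergy_coeff_one_two_ne_top hsum hf⟩
  obtain ⟨t', ⟨ht0, hE⟩, htt⟩ := exists_lt_of_csInf_lt hne ht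
  obtain ⟨C, hC0, hC⟩ := hc.exists_le_mul_pow ((one_lt_div ht0).2 htt)
  have ht1 : 0 < t := ht0.trans htt
  have hcoeff : ∀ n, coeff c t n ≤ ENNReal.ofReal C * coeff (fun _ => 1) t' n := by
    intro n
    rw [coeff, coeff, ← ENNReal.ofReal_mul hC0.le]
    refine ENNReal.ofReal_le_ofReal ?_
    calc (t ^ n)⁻¹ * c n ≤ (t ^ n)⁻¹ * (C * (t / t') ^ n) := by gcongr; exact hC n
      _ = C * ((t' ^ n)⁻¹ * 1) := by
        have htn : t ^ n ≠ 0 := by positivity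
        rw [div_pow]; field_simp
  refine ne_top_of_le_ne_top ?_ (pathEnergy_mono hcoeff)
  rw [pathEnergy_const_mul]
  exact ENNReal.mul_ne_top (by simp) hE

lemma pathEnergy_eq_top_of_lt_decayExponent (hpos : ∀ z, 0 < R z) (hax : τ a (x.seq 0))
    (hsum : HasBoundedWordSums R A x) (hf : ∀ y, 0 ≤ f y)
    {t : ℝ} (ht0 : 0 < t) (ht : t < decayExponent R s A a x H f) :
    pathEnergy R s A a x f (coeff (fun _ => 1) t) = ∞ := by
  rw [decayExponent_eq hpos hax hsum hf] at ht
  by_contra h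
  exact notMem_of_lt_csInf ht ⟨0, fun t ht => ht.1.le⟩ ⟨ht0, h⟩

lemma pathWeight_sq_mul_le_pathEnergy (κ : ℕ → ℝ≥0∞) (v : List W)
    (y : Σ j : ι, G ⧸ H j) :
    (pathWeight R A a x κ v * ENNReal.ofReal (f y)) ^ 2 ≤ pathEnergy R s A a x f κ := by
  refine le_trans ?_ (ENNReal.le_tsum (wordProd s v • y))
  gcongr
  refine le_trans (le_of_eq ?_) (ENNReal.le_tsum v)
  rw [quotRep_apply_apply, inv_smul_smul]

lemma pow_le_birkhoffProd {r : ℝ} (hr : 0 ≤ r) (hrR : ∀ z, r ≤ R z) (n : ℕ)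
    (z : MarkovShift τ) : r ^ n ≤ birkhoffProd R n z := by
  calc r ^ n = ∏ _i ∈ Finset.range n, r := by rw [Finset.prod_const, Finset.card_range]
    _ ≤ birkhoffProd R n z := Finset.prod_le_prod (fun _ _ => hr) fun _ _ => hrR _

lemma ofReal_div_pow_le_pathWeight (hax : τ a (x.seq 0)) {r : ℝ} (hr : 0 ≤ r)
    (hrR : ∀ z, r ≤ R z) {t : ℝ} (ht : 0 < t) {v : List W} (hchain : v.IsChain τ)
    (hv : v ∈ pathWords A a) :
    ENNReal.ofReal ((r / t) ^ v.length) ≤ pathWeight R A a x (coeff (fun _ => 1) t) v := by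
  rw [pathWeight_of_mem hv, wordWeight_of_isChain (isChain_append_of_getLast? hax hchain hv.2),
    coeff, ← ENNReal.ofReal_mul (by positivity)]
  refine ENNReal.ofReal_le_ofReal ?_
  calc (r / t) ^ v.length = (t ^ v.length)⁻¹ * 1 * r ^ v.length := by
        rw [div_pow]; field_simp
    _ ≤ _ := by gcongr; exact pow_le_birkhoffProd hr hrR _ _

lemma decayExponent_pos_of_le (hpos : ∀ z, 0 < R z) (hax : τ a (x.seq 0)) (hmix : IsMixing τ)
    (hsum : HasBoundedWordSums R A x) (hf : ∀ y, 0 ≤ f y) (hf0 : f ≠ 0) {r : ℝ} (hr : 0 < r)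
    (hrR : ∀ z, r ≤ R z) : 0 < decayExponent R s A a x H f := by
  refine hr.trans_le ?_
  rw [decayExponent_eq hpos hax hsum hf]
  refine le_csInf ⟨2, two_pos, pathEnergy_coeff_one_two_ne_top hsum hf⟩ ?_
  rintro t ⟨ht0, hE⟩
  by_contra! htr
  obtain ⟨y, hy⟩ := exists_pos_of_ne_zero hf hf0
  have hrt : 1 < r / t := (one_lt_div ht0).2 htr
  have hlower : ∀ N : ℕ, ENNReal.ofReal (((r / t) ^ N * f y) ^ 2) ≤
      pathEnergy R s A a x f (coeff (fun _ => 1) t) := by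
    intro N
    obtain ⟨e, heN, he, heA⟩ := hmix.exists_path A a N
    refine le_trans ?_ (pathWeight_sq_mul_le_pathEnergy _ (e ++ [a]) y)
    rw [ENNReal.ofReal_pow (by positivity), ENNReal.ofReal_mul (by positivity)]
    gcongr
    refine le_trans ?_ (ofReal_div_pow_le_pathWeight hax hr.le hrR ht0 he ⟨heA, by simp⟩)
    refine ENNReal.ofReal_le_ofReal (pow_le_pow_right₀ hrt.le ?_)
    simp only [List.length_append, List.length_singleton]
    omega
  have hgrowth : Tendsto (fun N : ℕ => ENNReal.ofReal (((r / t) ^ N * f y) ^ 2)) atTop (𝓝 ∞) :=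
    ENNReal.tendsto_ofReal_atTop.comp ((tendsto_pow_atTop two_ne_zero).comp
      ((tendsto_pow_atTop_atTop_of_one_lt hrt).atTop_mul_const hy))
  exact hE (top_le_iff.1 (le_of_tendsto' hgrowth hlower))

lemma exists_le_pathEnergy_truncate {κ : ℕ → ℝ≥0∞} (hκ : pathEnergy R s A a x f κ = ∞)
    (j L : ℕ) : ∃ N, L ≤ N ∧ (j : ℝ≥0∞) ≤ pathEnergy R s A a x f (truncate κ N) := by
  rw [pathEnergy_eq_iSup] at hκ
  obtain ⟨N, hN⟩ := lt_iSup_iff.1 (hκ ▸ ENNReal.natCast_lt_top j)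
  exact ⟨max L N, le_max_left _ _,
    hN.le.trans (pathEnergy_mono (truncate_mono κ (le_max_right L N)))⟩

lemma coeff_one_mul_exp_le {γ δ : ℝ} (hγ : 0 < γ) {c : ℕ → ℝ} {n : ℕ}
    (hn : Real.exp (n * δ) ≤ c n) :
    coeff (fun _ => 1) (γ * Real.exp (-δ)) n ≤ coeff c γ n := by
  refine ENNReal.ofReal_le_ofReal ?_
  calc ((γ * Real.exp (-δ)) ^ n)⁻¹ * 1 = (γ ^ n)⁻¹ * Real.exp (n * δ) := by
        rw [mul_one, mul_pow, mul_inv, ← Real.exp_nat_mul, ← Real.exp_neg, mul_neg, neg_neg]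
    _ ≤ (γ ^ n)⁻¹ * c n := by gcongr

/-- At `γ e^{-1/(j+1)}` the first `N_{j+1}` terms already have energy above `j`,
and the factor `e^{n/(j+1)}` separating them from the terms at `γ` is absorbed by `c`. -/
lemma exists_isSlowlyIncreasing_pathEnergy_eq_top {γ : ℝ} (hγ : 0 < γ)
    (htop : ∀ t, 0 < t → t < γ → pathEnergy R s A a x f (coeff (fun _ => 1) t) = ∞) :
    ∃ c : ℕ → ℝ, IsSlowlyIncreasing c ∧ (∀ m n, c (m + n) ≤ c m * c n) ∧
      pathEnergy R s A a x f (coeff c γ) = ∞ := by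
  let κ : ℕ → ℕ → ℝ≥0∞ := fun j => coeff (fun _ => 1) (γ * Real.exp (-(1 / ((j : ℝ) + 1))))
  have hκ : ∀ j, pathEnergy R s A a x f (κ j) = ∞ := fun j =>
    htop _ (by positivity) (mul_lt_of_lt_one_right hγ (Real.exp_lt_one_iff.2
      (neg_lt_zero.2 (by positivity))))
  choose Φ hΦ hΦE using fun j L => exists_le_pathEnergy_truncate (hκ j) j L
  obtain ⟨N, hN⟩ : ∃ N : ℕ → ℕ, ∀ j, N (j + 1) = Φ j (max (N j + 1) ((j + 1) ^ 2)) :=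
    ⟨fun j => Nat.rec 0 (fun j n => Φ j (max (n + 1) ((j + 1) ^ 2))) j, fun _ => rfl⟩
  have hlarge : ∀ j, max (N j + 1) ((j + 1) ^ 2) ≤ N (j + 1) := fun j => hN j ▸ hΦ j _
  obtain ⟨c, hc, hsub, hcN⟩ := exists_isSlowlyIncreasing_exp_le
    (strictMono_nat_of_lt_succ fun j => (le_max_left _ _).trans (hlarge j))
    fun j => (le_max_right _ _).trans (hlarge j)
  refine ⟨c, hc, hsub, ENNReal.eq_top_of_forall_nnreal_le fun r => ?_⟩
  obtain ⟨j, hj⟩ := exists_nat_ge r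
  calc (r : ℝ≥0∞) ≤ j := by exact_mod_cast hj
    _ ≤ pathEnergy R s A a x f (truncate (κ j) (N (j + 1))) := hN j ▸ hΦE j _
    _ ≤ pathEnergy R s A a x f (coeff c γ) := pathEnergy_mono fun n => by
        unfold truncate
        split_ifs with hn
        · exact coeff_one_mul_exp_le hγ (hcN j n hn)
        · exact zero_le

end DecayExponent

section Topology

variable {W : Type*} [TopologicalSpace W] {τ : W → W → Prop}

lemma isInducing_seq : IsInducing (seq : MarkovShift τ → ℕ → W) := ⟨rfl⟩

lemma continuous_seq : Continuous (seq : MarkovShift τ → ℕ → W) := isInducing_seq.continuous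

lemma continuous_seq_apply (i : ℕ) : Continuous fun z : MarkovShift τ => z.seq i :=
  (continuous_apply i).comp continuous_seq

lemma continuous_shift : Continuous (shift : MarkovShift τ → MarkovShift τ) :=
  isInducing_seq.continuous_iff.2 (continuous_pi fun i => continuous_seq_apply (i + 1))

lemma continuous_birkhoffProd {R : MarkovShift τ → ℝ} (hR : Continuous R) (n : ℕ) :
    Continuous (birkhoffProd R n) :=
  continuous_finsetProd _ fun i _ => hR.comp (continuous_shift.iterate i)

lemma continuous_concat_seq (w : List W) :
    Continuous fun z : MarkovShift τ => concat w z.seq := by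
  refine continuous_pi fun i => ?_
  rcases lt_or_ge i w.length with hi | hi
  · simp only [concat_of_lt hi]; exact continuous_const
  · simp only [concat_of_ge hi]; exact continuous_seq_apply _

variable [DiscreteTopology W]

lemma isClosedEmbedding_seq : IsClosedEmbedding (seq : MarkovShift τ → ℕ → W) := by
  refine ⟨⟨isInducing_seq, fun y z h => ext_seq (congrFun h)⟩, ?_⟩
  have hrange : range (seq : MarkovShift τ → ℕ → W) = ⋂ i, {z | τ (z i) (z (i + 1))} := by
    ext z
    simp only [mem_range, mem_iInter, mem_ofPred_eq]
    exact ⟨fun ⟨y, hy⟩ i => hy ▸ y.adm i, fun h => ⟨⟨z, h⟩, rfl⟩⟩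
  rw [hrange]
  refine isClosed_iInter fun i => ?_
  have hpair : Continuous fun z : ℕ → W => (z i, z (i + 1)) := by fun_prop
  exact (isClosed_discrete {p : W × W | τ p.1 p.2}).preimage hpair

instance [Countable W] : PolishSpace (MarkovShift τ) :=
  haveI : PolishSpace W := inferInstance
  isClosedEmbedding_seq.polishSpace

lemma isClopen_setOf_seq (i : ℕ) (P : W → Prop) : IsClopen {z : MarkovShift τ | P (z.seq i)} :=
  (isClopen_discrete {b | P b}).preimage (continuous_seq_apply i)

lemma isClopen_cylinder (w : List W) : IsClopen (cylinder τ w) := by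
  have hinter : cylinder τ w = ⋂ i ∈ Finset.range w.length,
      {z : MarkovShift τ | ∀ b, w[i]? = some b → z.seq i = b} := by
    ext z
    simp only [cylinder, mem_ofPred_eq, mem_iInter, Finset.mem_range]
    refine ⟨fun h i _ => h i, fun h i b hb => h i ?_ b hb⟩
    exact (List.getElem?_eq_some_iff.1 hb).1
  rw [hinter]
  exact isClopen_biInter_finset fun i _ =>
    isClopen_setOf_seq i fun d => ∀ b, w[i]? = some b → d = b

lemma measurableSet_cylinder (w : List W) : MeasurableSet (cylinder τ w) :=
  (isClopen_cylinder w).isOpen.measurableSet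

lemma isCompact_setOf_forall_mem {F : ℕ → Set W} (hF : ∀ i, (F i).Finite) :
    IsCompact {z : MarkovShift τ | ∀ i, z.seq i ∈ F i} := by
  convert (isClosedEmbedding_seq (τ := τ)).isCompact_preimage
    (isCompact_univ_pi fun i => (hF i).isCompact) using 1
  ext z; simp

lemma continuous_prepend (w : List W) : Continuous (prepend w : MarkovShift τ → MarkovShift τ) := by
  refine continuous_iff_continuousAt.2 fun z => ?_
  have hev : ∀ᶠ y : MarkovShift τ in 𝓝 z, y.seq 0 = z.seq 0 :=
    (isClopen_setOf_seq 0 fun b => b = z.seq 0).isOpen.mem_nhds rfl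
  by_cases hz : ∀ i, τ (concat w z.seq i) (concat w z.seq (i + 1))
  · rw [isInducing_seq.continuousAt_iff]
    refine (continuous_concat_seq w).continuousAt.congr ?_
    filter_upwards [hev] with y hy
    rw [Function.comp_apply, prepend, dif_pos (concat_adm_congr w hy.symm hz)]
  · refine continuousAt_id.congr ?_
    filter_upwards [hev] with y hy
    rw [prepend, dif_neg fun h => hz (concat_adm_congr w hy h), id]

lemma IsLocallyHolder.continuous {R : MarkovShift τ → ℝ} (hR : IsLocallyHolder R)
    (hpos : ∀ z, 0 < R z) : Continuous R := by
  obtain ⟨C, θ, hθ0, hθ1, hC⟩ := hR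
  have hlog : Continuous fun z => Real.log (R z) := by
    refine continuous_iff_continuousAt.2 fun z => ?_
    rw [ContinuousAt, Metric.tendsto_nhds]
    intro ε hε
    have hdecay : Tendsto (fun n : ℕ => C * θ ^ n) atTop (𝓝 0) := by
      simpa using (tendsto_pow_atTop_nhds_zero_of_lt_one hθ0.le hθ1).const_mul C
    obtain ⟨n, hn, hn2⟩ := ((hdecay.eventually (gt_mem_nhds hε)).and (eventually_ge_atTop 2)).exists
    have hev : ∀ᶠ y : MarkovShift τ in 𝓝 z, y ∈ cylinder τ (initWord z n) :=
      (isClopen_cylinder _).isOpen.mem_nhds (mem_cylinder_iff.2 fun i hi => by simp [initWord])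
    filter_upwards [hev] with y hy
    rw [Real.dist_eq]
    refine (hC n hn2 y z fun i hi => ?_).trans_lt hn
    simpa [initWord] using mem_cylinder_iff.1 hy i (by simpa using hi)
  exact (Real.continuous_exp.comp hlog).congr fun z => Real.exp_log (hpos z)

end Topology

section Branches

variable {W : Type*} {τ : W → W → Prop}

lemma initWord_length_of_mem_cylinder {w : List W} {z : MarkovShift τ} (hz : z ∈ cylinder τ w) :
    initWord z w.length = w := by
  refine List.ext_getElem (by simp) fun i _ hi => ?_
  rw [← mem_cylinder_iff.1 hz i hi]
  simp [initWord]

lemma shift_iterate_image_cylinder {w : List W} :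
    shift^[w.length] '' cylinder τ w = {z : MarkovShift τ | (w ++ [z.seq 0]).IsChain τ} := by
  ext z
  constructor
  · rintro ⟨y, hy, rfl⟩
    have hchain := isChain_initWord y (w.length + 1)
    rw [← initWord_append, initWord_length_of_mem_cylinder hy] at hchain
    rwa [mem_ofPred_eq, shift_iterate_seq, zero_add]
  · intro h
    exact ⟨prepend w z, mem_cylinder_iff.2 fun i hi => prepend_seq_of_lt h hi,
      shift_iterate_prepend h⟩

lemma mem_cylinder_append_singleton {w : List W} {b : W} {z : MarkovShift τ}
    (h : (w ++ [z.seq 0]).IsChain τ) :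
    prepend w z ∈ cylinder τ (w ++ [b]) ↔ z.seq 0 = b := by
  rw [mem_cylinder_iff]
  constructor
  · intro hmem
    have hz := prepend_seq_length_add h 0
    rw [zero_add] at hz
    rw [← hz, hmem w.length (by simp)]; simp
  · rintro rfl i hi
    have hget := prepend_seq_eq_getElem? h (i := i) (Nat.lt_succ_iff.1 (by simpa using hi))
    rw [List.getElem?_eq_getElem hi] at hget
    exact (Option.some.inj hget).symm

end Branches

end MarkovShift

section Prokhorov

variable {X : Type*} [MeasurableSpace X]

/-- A finite measure of mass at most `C`, rescaled by `C⁻¹` on `X × {true}` and completed to a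
probability measure on `X × Bool` by an atom at `(p, false)`. -/
noncomputable def completeMeasure (p : X) (C : ℝ≥0∞) (m : Measure X) : Measure (X × Bool) :=
  C⁻¹ • m.map (fun z => (z, true)) + (1 - C⁻¹ * m univ) • Measure.dirac (p, false)

lemma isProbabilityMeasure_completeMeasure (p : X) {C : ℝ≥0∞} (hC0 : C ≠ 0) (hC : C ≠ ∞)
    {m : Measure X} (hm : m univ ≤ C) : IsProbabilityMeasure (completeMeasure p C m) := by
  constructor
  have hle : C⁻¹ * m univ ≤ 1 := by
    calc C⁻¹ * m univ ≤ C⁻¹ * C := by gcongr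
      _ = 1 := ENNReal.inv_mul_cancel hC0 hC
  rw [completeMeasure, Measure.add_apply, Measure.smul_apply, Measure.smul_apply,
    Measure.map_apply (by fun_prop) MeasurableSet.univ]
  simp [add_tsub_cancel_of_le hle]

/-- The inverse of `completeMeasure`: the trace on `X × {true}`, rescaled by `C`. -/
noncomputable def uncompleteMeasure (C : ℝ≥0∞) (Q : Measure (X × Bool)) : Measure X :=
  C • (Q.restrict (Prod.snd ⁻¹' {true})).map Prod.fst

lemma isFiniteMeasure_uncompleteMeasure {C : ℝ≥0∞} (hC : C ≠ ∞) (Q : Measure (X × Bool))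
    [IsFiniteMeasure Q] : IsFiniteMeasure (uncompleteMeasure C Q) := by
  have := Measure.isFiniteMeasure_map (Q.restrict (Prod.snd ⁻¹' {true})) Prod.fst
  exact Measure.smul_finite _ hC

variable [TopologicalSpace X]

/-- The extension of `F` to `X × Bool` by zero on `X × {false}`. -/
noncomputable def extendTest (F : X →ᵇ ℝ) : X × Bool →ᵇ ℝ :=
  BoundedContinuousFunction.ofNormedAddCommGroup (fun q => F q.1 * (bif q.2 then 1 else 0))
    ((F.continuous.comp continuous_fst).mul
      ((continuous_of_discreteTopology (f := fun b : Bool => (bif b then (1 : ℝ) else 0))).comp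
        continuous_snd)) ‖F‖ (fun q => by
      rcases q with ⟨z, _ | _⟩
      · simp
      · simpa using F.norm_coe_le_norm z)

variable [BorelSpace X]

lemma toReal_mul_integral_extendTest (C : ℝ≥0∞) (Q : Measure (X × Bool)) (F : X →ᵇ ℝ) :
    C.toReal * ∫ q, extendTest F q ∂Q = ∫ z, F z ∂(uncompleteMeasure C Q) := by
  have htrue : MeasurableSet (Prod.snd ⁻¹' {true} : Set (X × Bool)) :=
    measurable_snd (measurableSet_singleton true)
  rw [uncompleteMeasure, integral_smul_measure, integral_map measurable_fst.aemeasurable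
    F.continuous.aestronglyMeasurable, ← integral_indicator htrue, smul_eq_mul]
  congr 1
  refine integral_congr_ae (Eventually.of_forall fun q => ?_)
  rcases q with ⟨z, _ | _⟩ <;> simp [extendTest, indicator]

variable [PolishSpace X]

lemma toReal_mul_integral_extendTest_completeMeasure (p : X) {C : ℝ≥0∞} (hC0 : C ≠ 0)
    (hC : C ≠ ∞) (m : Measure X) [IsFiniteMeasure m] (F : X →ᵇ ℝ) :
    C.toReal * ∫ q, extendTest F q ∂(completeMeasure p C m) = ∫ z, F z ∂m := by
  have htrue : Measurable fun z : X => (z, true) := by fun_prop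
  have hfin : IsFiniteMeasure (C⁻¹ • m.map fun z => (z, true)) := by
    have := Measure.isFiniteMeasure_map m fun z : X => (z, true)
    exact Measure.smul_finite _ (ENNReal.inv_ne_top.2 hC0)
  have hfin' : IsFiniteMeasure ((1 - C⁻¹ * m univ) • Measure.dirac (p, false)) :=
    Measure.smul_finite _ (ne_top_of_le_ne_top ENNReal.one_ne_top tsub_le_self)
  rw [completeMeasure, integral_add_measure ((extendTest F).integrable _)
    ((extendTest F).integrable _), integral_smul_measure, integral_smul_measure,
    integral_map htrue.aemeasurable (extendTest F).continuous.aestronglyMeasurable, integral_dirac]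
  have hne : C.toReal ≠ 0 := ENNReal.toReal_ne_zero.2 ⟨hC0, hC⟩
  simp [extendTest, ENNReal.toReal_inv, mul_inv_cancel_left₀ hne]

lemma isTightMeasureSet_completeMeasure (p : X) {C : ℝ≥0∞} (hC : 1 ≤ C) {S : Set (Measure X)}
    (hS : IsTightMeasureSet S) : IsTightMeasureSet (completeMeasure p C '' S) := by
  rw [isTightMeasureSet_iff_exists_isCompact_measure_compl_le] at hS ⊢
  intro ε hε
  obtain ⟨K, hK, hKS⟩ := hS ε hε
  have hcompact : IsCompact (K ×ˢ {true} ∪ {(p, false)} : Set (X × Bool)) :=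
    (hK.prod isCompact_singleton).union isCompact_singleton
  refine ⟨_, hcompact, ?_⟩
  rintro _ ⟨m, hm, rfl⟩
  have hmeas := hcompact.measurableSet.compl
  have hpre : (fun z : X => (z, true)) ⁻¹' (K ×ˢ {true} ∪ {(p, false)})ᶜ = Kᶜ := by
    ext z; simp
  rw [completeMeasure, Measure.add_apply, Measure.smul_apply, Measure.smul_apply,
    Measure.map_apply (by fun_prop) hmeas, Measure.dirac_apply' _ hmeas, hpre]
  simp only [mem_compl_iff, mem_union, mem_singleton_iff, or_true, not_true_eq_false,
    not_false_eq_true, indicator_of_notMem, smul_eq_mul, mul_zero, add_zero]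
  calc C⁻¹ * m Kᶜ ≤ 1 * m Kᶜ := by gcongr; exact ENNReal.inv_le_one.2 hC
    _ ≤ ε := by rw [one_mul]; exact hKS m hm

lemma exists_subseq_tendsto_integral {I : Type*} [Countable I] [Nonempty X]
    (m : I → ℕ → Measure X) {C : I → ℝ≥0∞} (hC : ∀ i, C i ≠ ∞) (hm : ∀ i k, m i k univ ≤ C i)
    (ht : ∀ i, IsTightMeasureSet (range (m i))) :
    ∃ φ : ℕ → ℕ, StrictMono φ ∧ ∃ L : I → Measure X, (∀ i, IsFiniteMeasure (L i)) ∧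
      ∀ i (F : X →ᵇ ℝ), Tendsto (fun k => ∫ z, F z ∂(m i (φ k))) atTop (𝓝 (∫ z, F z ∂(L i))) := by
  obtain ⟨p⟩ := ‹Nonempty X›
  let D : I → ℝ≥0∞ := fun i => C i + 1
  have hD1 : ∀ i, 1 ≤ D i := fun i => le_add_self
  have hD0 : ∀ i, D i ≠ 0 := fun i => (zero_lt_one.trans_le (hD1 i)).ne'
  have hDtop : ∀ i, D i ≠ ∞ := fun i => ENNReal.add_ne_top.2 ⟨hC i, ENNReal.one_ne_top⟩
  have hfin : ∀ i k, IsFiniteMeasure (m i k) := fun i k => ⟨(hm i k).trans_lt (hC i).lt_top⟩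
  let P : I → ℕ → ProbabilityMeasure (X × Bool) := fun i k =>
    ⟨completeMeasure p (D i) (m i k), isProbabilityMeasure_completeMeasure p (hD0 i) (hDtop i)
      ((hm i k).trans le_self_add)⟩
  have hcompact : ∀ i, IsCompact (closure (range (P i))) := by
    intro i
    refine isCompact_closure_of_isTightMeasureSet ?_
    refine (isTightMeasureSet_completeMeasure p (hD1 i) (ht i)).subset ?_
    rintro _ ⟨_, ⟨k, rfl⟩, rfl⟩
    exact ⟨m i k, ⟨k, rfl⟩, rfl⟩
  obtain ⟨Q, -, φ, hφ, hQ⟩ := (isCompact_univ_pi hcompact).tendsto_subseq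
    (x := fun k i => P i k) fun k i _ => subset_closure ⟨k, rfl⟩
  refine ⟨φ, hφ, fun i => uncompleteMeasure (D i) (Q i),
    fun i => isFiniteMeasure_uncompleteMeasure (hDtop i) _, fun i F => ?_⟩
  have hlim := (ProbabilityMeasure.tendsto_iff_forall_integral_tendsto.1
    (tendsto_pi_nhds.1 hQ i)) (extendTest F)
  rw [← toReal_mul_integral_extendTest]
  exact (hlim.const_mul (D i).toReal).congr fun k =>
    toReal_mul_integral_extendTest_completeMeasure p (hD0 i) (hDtop i) _ F

end Prokhorov

namespace MarkovShift

section MassWeights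

variable {W : Type*} {τ : W → W → Prop} {R : MarkovShift τ → ℝ} {A a : W} {x : MarkovShift τ}
  {c : ℕ → ℝ} {t : ℝ}

/-- The words with first letter `b`. -/
def headSet (b : W) : Set (List W) := {v | v.head? = some b}

open Classical in
/-- The weight `κ(|v|) R_{|v|}(vx)` on the words ending in `a`. -/
noncomputable def endWeight (R : MarkovShift τ → ℝ) (a : W) (x : MarkovShift τ)
    (κ : ℕ → ℝ≥0∞) (v : List W) : ℝ≥0∞ :=
  if v.getLast? = some a then κ v.length * wordWeight R x v else 0

lemma endWeight_of_mem_headSet {κ : ℕ → ℝ≥0∞} {v : List W} (hv : v ∈ headSet A) :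
    endWeight R a x κ v = pathWeight R A a x κ v := by
  unfold endWeight pathWeight
  by_cases h : v.getLast? = some a
  · rw [if_pos h, if_pos ⟨hv, h⟩]
  · rw [if_neg h, if_neg fun h' => h h'.2]

lemma endWeight_mono {κ κ' : ℕ → ℝ≥0∞} (h : ∀ n, κ n ≤ κ' n) (v : List W) :
    endWeight R a x κ v ≤ endWeight R a x κ' v := by
  unfold endWeight
  split_ifs
  · gcongr; exact h _
  · exact le_rfl

lemma getLast?_and_isChain_of_endWeight_ne_zero {κ : ℕ → ℝ≥0∞} {v : List W}
    (h : endWeight R a x κ v ≠ 0) : v.getLast? = some a ∧ (v ++ [x.seq 0]).IsChain τ := by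
  unfold endWeight at h
  split_ifs at h with hlast
  · exact ⟨hlast, by_contra fun hv => h (by rw [wordWeight_of_not_isChain hv, mul_zero])⟩
  · exact absurd rfl h

lemma coeff_add_le (hc0 : ∀ n, 0 < c n) (hsub : ∀ m n, c (m + n) ≤ c m * c n) (ht : 0 < t)
    (m n : ℕ) : coeff c t (m + n) ≤ coeff c t m * coeff c t n := by
  have hcm := hc0 m
  rw [coeff, coeff, coeff, ← ENNReal.ofReal_mul (by positivity)]
  refine ENNReal.ofReal_le_ofReal ?_
  calc (t ^ (m + n))⁻¹ * c (m + n) ≤ (t ^ (m + n))⁻¹ * (c m * c n) := by gcongr; exact hsub m n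
    _ = (t ^ m)⁻¹ * c m * ((t ^ n)⁻¹ * c n) := by rw [pow_add, mul_inv]; ring

lemma coeff_anti (hc0 : ∀ n, 0 < c n) {γ : ℝ} (hγ : 0 < γ) (h : γ ≤ t) (n : ℕ) :
    coeff c t n ≤ coeff c γ n := by
  have hcn := hc0 n
  exact ENNReal.ofReal_le_ofReal (by gcongr)

lemma coeff_le_mul_coeff_add (hmono : Monotone c) (ht : 0 < t) (m n : ℕ) :
    coeff c t n ≤ ENNReal.ofReal (t ^ m) * coeff c t (m + n) := by
  rw [coeff, coeff, ← ENNReal.ofReal_mul (by positivity)]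
  refine ENNReal.ofReal_le_ofReal ?_
  calc (t ^ n)⁻¹ * c n ≤ (t ^ n)⁻¹ * c (m + n) := by gcongr; exact hmono (by omega)
    _ = t ^ m * ((t ^ (m + n))⁻¹ * c (m + n)) := by
      rw [pow_add]
      have htm : t ^ m ≠ 0 := by positivity
      field_simp

lemma getLast?_append_of_head? {u v : List W} {b : W} (h : v.head? = some b) :
    (u ++ v).getLast? = v.getLast? := by
  cases v with
  | nil => simp at h
  | cons d v => rw [List.getLast?_append_of_ne_nil _ (by simp)]

lemma append_mem_headSet {p v : List W} {b d : W} (hp : (p ++ [b]).head? = some d)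
    (hv : v ∈ headSet b) : p ++ v ∈ headSet d := by
  cases p with
  | nil => exact (show v.head? = some b from hv).trans hp
  | cons e p => exact hp

lemma endWeight_le_prepend {K : ℝ} (hK : BoundedDistortion R K) (hpos : ∀ z, 0 < R z)
    (hmono : Monotone c) (ht : 0 < t) {y : MarkovShift τ} {p v : List W}
    (hp : (p ++ [y.seq 0]).IsChain τ) (hv : v ∈ headSet (y.seq 0)) :
    endWeight R a x (coeff c t) v ≤
      (ENNReal.ofReal (t ^ p.length) * (ENNReal.ofReal K / wordWeight R y p)) *
        endWeight R a x (coeff c t) (p ++ v) := by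
  unfold endWeight
  rw [getLast?_append_of_head? hv]
  split_ifs
  · calc coeff c t v.length * wordWeight R x v
        ≤ (ENNReal.ofReal (t ^ p.length) * coeff c t (p.length + v.length)) *
          ((ENNReal.ofReal K / wordWeight R y p) * wordWeight R x (p ++ v)) := by
          gcongr
          · exact coeff_le_mul_coeff_add hmono ht _ _
          · exact hK.wordWeight_le_prepend hpos hp (head?_append_of_head? hv)
      _ = _ := by rw [List.length_append]; ring
  · exact zero_le

lemma endWeight_append_le {K : ℝ} (hK : BoundedDistortion R K) (hpos : ∀ z, 0 < R z)
    (hc0 : ∀ n, 0 < c n) (hsub : ∀ m n, c (m + n) ≤ c m * c n) (ht : 0 < t)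
    {y : MarkovShift τ} {u v : List W} (hv : v ∈ headSet (y.seq 0)) :
    endWeight R a x (coeff c t) (u ++ v) ≤
      (ENNReal.ofReal K * (coeff c t u.length * wordWeight R y u)) *
        endWeight R a x (coeff c t) v := by
  unfold endWeight
  rw [getLast?_append_of_head? hv]
  split_ifs
  · calc coeff c t (u ++ v).length * wordWeight R x (u ++ v)
        ≤ (coeff c t u.length * coeff c t v.length) *
          (ENNReal.ofReal K * (wordWeight R y u * wordWeight R x v)) := by
          gcongr
          · rw [List.length_append]; exact coeff_add_le hc0 hsub ht _ _
          · exact hK.wordWeight_append_le hpos (head?_append_of_head? hv)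
      _ = _ := by ring
  · exact zero_le

variable {G ι : Type*} [Group G] {s : W → G} {H : ι → Subgroup G} {f : QuotSum H}

lemma wordProd_append (u v : List W) : wordProd s (u ++ v) = wordProd s u * wordProd s v := by
  simp [wordProd]

lemma inner_quotRep_wordProd_append (u v : List W) (g : G) (P : QuotSum H) :
    inner ℝ (quotRep H (wordProd s (u ++ v)) f) (quotRep H g P) =
      inner ℝ (quotRep H (wordProd s v) f) (quotRep H ((wordProd s u)⁻¹ * g) P) := by
  rw [wordProd_append, quotRep_mul_apply, inner_quotRep_left, quotRep_mul_apply]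

/-- The mass of `vx` in the approximating measure. -/
noncomputable def massWeight (R : MarkovShift τ → ℝ) (s : W → G) (A a : W) (x : MarkovShift τ)
    (f : QuotSum H) (c : ℕ → ℝ) (g : G) (t : ℝ) (v : List W) : ℝ≥0∞ :=
  endWeight R a x (coeff c t) v *
    ENNReal.ofReal (inner ℝ (quotRep H (wordProd s v) f)
      (quotRep H g⁻¹ (densityVec R s A a x H f c t)) /
        inner ℝ (densityVec R s A a x H f c t) (densityVec R s A a x H f c t))

/-- The parameter `t` is regular if `φ_c[t] ∗ f` is a well-defined non-zero vector. -/
structure IsRegular (R : MarkovShift τ → ℝ) (s : W → G) (A a : W) (x : MarkovShift τ)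
    (f : QuotSum H) (c : ℕ → ℝ) (t : ℝ) : Prop where
  pos : 0 < t
  summable_term : ∀ g, Summable fun n : ℕ => densityTerm R s A a x c t g (n + 1)
  push : IsPushWeight (wordProd s) (pathWeight R A a x (coeff c t)) (density R s A a x c t)
  summable : Summable fun g : G => density R s A a x c t g • quotRep H g f
  inner_pos : 0 < inner ℝ (densityVec R s A a x H f c t) (densityVec R s A a x H f c t)

lemma IsRegular.densityVec_nonneg (h : IsRegular R s A a x f c t) (hf : ∀ y, 0 ≤ f y)
    (y : Σ j : ι, G ⧸ H j) : 0 ≤ densityVec R s A a x H f c t y :=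
  (h.push.repConv_apply hf h.summable y).1

lemma IsRegular.densityVec_ne_zero (h : IsRegular R s A a x f c t) :
    densityVec R s A a x H f c t ≠ 0 := fun hzero => by
  simpa only [hzero, inner_zero_left, lt_irrefl] using h.inner_pos

-- A fixed path from `A` to `b` turns words from `b` into words from `A`, and the sum over all
-- words from `A` is an inner product of `φ_c[t] ∗ f` with a translate of itself.
lemma exists_tsum_endWeight_le {K : ℝ} (hK : BoundedDistortion R K) (hpos : ∀ z, 0 < R z)
    (hmix : IsMixing τ) (hf : ∀ y, 0 ≤ f y) (hmono : Monotone c) (T : ℝ) (b : W) :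
    ∃ M : ℝ≥0∞, M ≠ ∞ ∧ ∀ t ≤ T, IsRegular R s A a x f c t → ∀ g : G,
      ∑' v : headSet b, endWeight R a x (coeff c t) v *
          ENNReal.ofReal (inner ℝ (quotRep H (wordProd s v) f)
            (quotRep H g (densityVec R s A a x H f c t))) ≤
        M * ENNReal.ofReal
          (inner ℝ (densityVec R s A a x H f c t) (densityVec R s A a x H f c t)) := by
  obtain ⟨y, rfl⟩ := hmix.exists_seq_zero_eq b
  obtain ⟨p, -, hp, hpA⟩ := hmix.exists_path A (y.seq 0) 0
  refine ⟨ENNReal.ofReal (T ^ p.length) * (ENNReal.ofReal K / wordWeight R y p),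
    ENNReal.mul_ne_top ENNReal.ofReal_ne_top (div_wordWeight_ne_top hpos hp K),
    fun t htT hreg g => ?_⟩
  have ht := hreg.pos
  have hQ0 := hreg.densityVec_nonneg hf
  set Q := densityVec R s A a x H f c t
  set C := ENNReal.ofReal (T ^ p.length) * (ENNReal.ofReal K / wordWeight R y p) with hC
  set P := quotRep H (wordProd s p * g) Q with hP
  have hprefix : ∀ v ∈ headSet (y.seq 0),
      endWeight R a x (coeff c t) v *
          ENNReal.ofReal (inner ℝ (quotRep H (wordProd s v) f) (quotRep H g Q)) ≤
        C * (pathWeight R A a x (coeff c t) (p ++ v) *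
          ENNReal.ofReal (inner ℝ (quotRep H (wordProd s (p ++ v)) f) P)) := by
    intro v hv
    rw [← endWeight_of_mem_headSet (append_mem_headSet hpA hv), hP,
      inner_quotRep_wordProd_append, inv_mul_cancel_left, ← mul_assoc]
    gcongr
    refine (endWeight_le_prepend hK hpos hmono ht hp hv).trans ?_
    rw [hC]
    gcongr
  calc _ ≤ C * ∑' u : (univ : Set (List W)), pathWeight R A a x (coeff c t) u.1 *
          ENNReal.ofReal (inner ℝ (quotRep H (wordProd s u.1) f) P) :=
        tsum_subtype_le_mul_tsum_of_injOn
          (f := fun v => endWeight R a x (coeff c t) v *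
            ENNReal.ofReal (inner ℝ (quotRep H (wordProd s v) f) (quotRep H g Q)))
          (g := fun u => pathWeight R A a x (coeff c t) u *
            ENNReal.ofReal (inner ℝ (quotRep H (wordProd s u) f) P))
          (p ++ ·) (List.append_right_injective p).injOn
          fun v hv _ => ⟨mem_univ _, hprefix v hv⟩
    _ = C * ENNReal.ofReal (inner ℝ Q P) := by
        rw [tsum_univ (fun u => pathWeight R A a x (coeff c t) u *
          ENNReal.ofReal (inner ℝ (quotRep H (wordProd s u) f) P)),
          hreg.push.tsum_inner hf hreg.summable (P := P) fun y => hQ0 _]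
        rfl
    _ ≤ C * ENNReal.ofReal (inner ℝ Q Q) := by
        gcongr
        have hle := inner_quotRep_quotRep_le 1 (wordProd s p * g) Q
        rwa [map_one] at hle

lemma massWeight_eq_mul_inv (h : IsRegular R s A a x f c t) (g : G) (v : List W) :
    massWeight R s A a x f c g t v = endWeight R a x (coeff c t) v *
      ENNReal.ofReal (inner ℝ (quotRep H (wordProd s v) f)
        (quotRep H g⁻¹ (densityVec R s A a x H f c t))) *
      (ENNReal.ofReal
        (inner ℝ (densityVec R s A a x H f c t) (densityVec R s A a x H f c t)))⁻¹ := by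
  rw [massWeight, ENNReal.ofReal_div_of_pos h.inner_pos, div_eq_mul_inv, mul_assoc]

lemma exists_tsum_massWeight_append_le {K : ℝ} (hK : BoundedDistortion R K)
    (hpos : ∀ z, 0 < R z) (hmix : IsMixing τ) (hf : ∀ y, 0 ≤ f y) (hc0 : ∀ n, 0 < c n)
    (hmono : Monotone c) (hsub : ∀ m n, c (m + n) ≤ c m * c n) (T : ℝ) (y : MarkovShift τ) :
    ∃ M : ℝ≥0∞, M ≠ ∞ ∧ ∀ t ≤ T, IsRegular R s A a x f c t → ∀ (g : G) (u : List W),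
      ∑' v : headSet (y.seq 0), massWeight R s A a x f c g t (u ++ v) ≤
        M * (coeff c t u.length * wordWeight R y u) := by
  obtain ⟨M, hM, hle⟩ := exists_tsum_endWeight_le (A := A) (a := a) (x := x) (s := s) hK hpos
    hmix hf hmono T (y.seq 0)
  refine ⟨ENNReal.ofReal K * M, ENNReal.mul_ne_top ENNReal.ofReal_ne_top hM,
    fun t htT hreg g u => ?_⟩
  have hD0 := (ENNReal.ofReal_pos.2 hreg.inner_pos).ne'
  set Q := densityVec R s A a x H f c t with hQ
  set D := ENNReal.ofReal (inner ℝ Q Q)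
  set B := coeff c t u.length * wordWeight R y u with hB
  calc ∑' v : headSet (y.seq 0), massWeight R s A a x f c g t (u ++ v)
      ≤ ∑' v : headSet (y.seq 0), (ENNReal.ofReal K * B * D⁻¹) *
          (endWeight R a x (coeff c t) v * ENNReal.ofReal (inner ℝ (quotRep H (wordProd s v) f)
            (quotRep H ((wordProd s u)⁻¹ * g⁻¹) Q))) := by
        refine ENNReal.tsum_le_tsum fun v => ?_
        rw [massWeight_eq_mul_inv hreg, inner_quotRep_wordProd_append, ← hQ]
        calc _ ≤ (ENNReal.ofReal K * B) * endWeight R a x (coeff c t) v * _ * _ := by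
                rw [hB]
                gcongr
                exact endWeight_append_le hK hpos hc0 hsub hreg.pos v.2
          _ = _ := by ring
    _ ≤ (ENNReal.ofReal K * B * D⁻¹) * (M * D) := by
        rw [ENNReal.tsum_mul_left]
        gcongr
        exact hle t htT hreg _
    _ = ENNReal.ofReal K * M * B * (D⁻¹ * D) := by ring
    _ = ENNReal.ofReal K * M * B := by
        rw [ENNReal.inv_mul_cancel hD0 ENNReal.ofReal_ne_top, mul_one]

lemma massWeight_le (h : IsRegular R s A a x f c t) (hc0 : ∀ n, 0 < c n) {γ : ℝ} (hγ : 0 < γ)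
    (hγt : γ ≤ t) (g : G) (v : List W) :
    massWeight R s A a x f c g t v ≤ endWeight R a x (coeff c γ) v *
      ENNReal.ofReal (‖f‖ / ‖densityVec R s A a x H f c t‖) := by
  have hpos := h.inner_pos
  rw [massWeight]
  set Q := densityVec R s A a x H f c t
  refine mul_le_mul' (endWeight_mono (coeff_anti hc0 hγ hγt) v) (ENNReal.ofReal_le_ofReal ?_)
  have hQ0 : 0 < ‖Q‖ := norm_pos_iff.2 (inner_self_ne_zero.1 hpos.ne')
  calc inner ℝ (quotRep H (wordProd s v) f) (quotRep H g⁻¹ Q) / inner ℝ Q Q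
      ≤ ‖f‖ * ‖Q‖ / (‖Q‖ * ‖Q‖) := by
        rw [real_inner_self_eq_norm_mul_norm]
        gcongr
        simpa only [LinearIsometryEquiv.norm_map] using
          real_inner_le_norm (quotRep H (wordProd s v) f) (quotRep H g⁻¹ Q)
    _ = ‖f‖ / ‖Q‖ := mul_div_mul_right _ _ hQ0.ne'

lemma getLast?_and_isChain_of_massWeight_ne_zero {g : G} {v : List W}
    (h : massWeight R s A a x f c g t v ≠ 0) :
    v.getLast? = some a ∧ (v ++ [x.seq 0]).IsChain τ :=
  getLast?_and_isChain_of_endWeight_ne_zero (left_ne_zero_of_mul h)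

end MassWeights

section ApproxMeasure

variable {W : Type*} [Countable W] [TopologicalSpace W] [DiscreteTopology W] {τ : W → W → Prop}
  {R : MarkovShift τ → ℝ} {A a : W} {x : MarkovShift τ}
  {G ι : Type*} [Group G] {s : W → G} {H : ι → Subgroup G} {f : QuotSum H} {c : ℕ → ℝ} {t : ℝ}

lemma lintegral_approxMeasure (hax : τ a (x.seq 0)) (hpos : ∀ z, 0 < R z) (hc0 : ∀ n, 0 < c n)
    (ht : 0 < t) (g : G) (F : MarkovShift τ → ℝ≥0∞) :
    ∫⁻ z, F z ∂(approxMeasure R s A a x H f c g t) =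
      ∑' v, massWeight R s A a x f c g t v * F (prepend v x) := by
  rw [approxMeasure, lintegral_sum_measure,
    ← tsum_subtype_eq_of_support_subset (s := {v : List W | v.IsChain τ ∧ v.getLast? = some a})
      fun v hv => ?_]
  · refine tsum_congr fun v => ?_
    rw [lintegral_smul_measure, lintegral_dirac, smul_eq_mul, massWeight, endWeight, if_pos v.2.2,
      wordWeight_of_isChain (isChain_append_of_getLast? hax v.2.1 v.2.2), coeff]
    have hcv := hc0 v.1.length
    have hRv := birkhoffProd_pos hpos v.1.length (prepend v.1 x)
    rw [← ENNReal.ofReal_mul (by positivity), ← ENNReal.ofReal_mul (by positivity),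
      quotRep_inv_apply]
  · obtain ⟨hlast, hchain⟩ := getLast?_and_isChain_of_massWeight_ne_zero (left_ne_zero_of_mul hv)
    exact ⟨(List.isChain_append.1 hchain).1, hlast⟩

lemma setLIntegral_approxMeasure (hax : τ a (x.seq 0)) (hpos : ∀ z, 0 < R z)
    (hc0 : ∀ n, 0 < c n) (ht : 0 < t) (g : G) (b : W) (F : MarkovShift τ → ℝ≥0∞) :
    ∫⁻ z in cylinder τ [b], F z ∂(approxMeasure R s A a x H f c g t) =
      ∑' v : headSet b, massWeight R s A a x f c g t v * F (prepend v x) := by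
  classical
  rw [← lintegral_indicator (measurableSet_cylinder _),
    lintegral_approxMeasure hax hpos hc0 ht,
    tsum_subtype (headSet b) fun v => massWeight R s A a x f c g t v * F (prepend v x)]
  refine tsum_congr fun v => ?_
  by_cases hmass : massWeight R s A a x f c g t v = 0
  · rw [hmass, zero_mul, indicator_apply, hmass, zero_mul, ite_self]
  obtain ⟨hlast, hchain⟩ := getLast?_and_isChain_of_massWeight_ne_zero hmass
  have hmem : prepend v x ∈ cylinder τ [b] ↔ v ∈ headSet b := by
    rw [mem_cylinder_singleton, headSet, mem_ofPred_eq, ← Option.some_inj,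
      ← prepend_seq_zero hchain]
    cases v with
    | nil => simp at hlast
    | cons d v => simp
  by_cases hb : v ∈ headSet b
  · rw [indicator_of_mem (hmem.2 hb), indicator_of_mem hb]
  · rw [indicator_of_notMem fun h => hb (hmem.1 h), indicator_of_notMem hb, mul_zero]

lemma approxMeasure_cylinder (hax : τ a (x.seq 0)) (hpos : ∀ z, 0 < R z)
    (hc0 : ∀ n, 0 < c n) (ht : 0 < t) (g : G) (b : W) :
    approxMeasure R s A a x H f c g t (cylinder τ [b]) =
      ∑' v : headSet b, massWeight R s A a x f c g t v := by
  simpa using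
    setLIntegral_approxMeasure (s := s) (f := f) (A := A) hax hpos hc0 ht g b fun _ => 1

end ApproxMeasure

end MarkovShift

section TsumEstimates

lemma tsum_ne_top_of_eventually_le_geometric {α : ℕ → ℝ≥0∞} (h : ∀ n, α n ≠ ∞) {C q : ℝ}
    (hq0 : 0 ≤ q) (hq1 : q < 1) (hle : ∀ᶠ n in atTop, α n ≤ ENNReal.ofReal (C * q ^ n)) :
    ∑' n, α n ≠ ∞ := by
  obtain ⟨N, hN⟩ := eventually_atTop.1 hle
  have hgeom : ∑' n, ENNReal.ofReal (C * q ^ n) ≠ ∞ :=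
    ((summable_geometric_of_lt_one hq0 hq1).mul_left C).tsum_ofReal_ne_top
  rw [← ENNReal.summable.sum_add_tsum_nat_add' (f := α) (k := N)]
  refine ENNReal.add_ne_top.2 ⟨(ENNReal.sum_lt_top.2 fun n _ => (h n).lt_top).ne,
    ne_top_of_le_ne_top hgeom ?_⟩
  calc ∑' n, α (n + N) ≤ ∑' n, ENNReal.ofReal (C * q ^ (n + N)) :=
        ENNReal.tsum_le_tsum fun n => hN (n + N) (by omega)
    _ ≤ ∑' n, ENNReal.ofReal (C * q ^ n) :=
        ENNReal.tsum_comp_le_tsum_of_injective (add_left_injective N)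
          fun n => ENNReal.ofReal (C * q ^ n)

open Classical in
lemma exists_finset_tsum_le {α : Type*} {F : α → ℝ≥0∞} {S : Set α} (h : ∑' v : S, F v ≠ ∞)
    {ε : ℝ≥0∞} (hε : 0 < ε) : ∃ T : Finset α, ∑' v : {v | v ∈ S ∧ v ∉ T}, F v ≤ ε := by
  obtain ⟨T, hT⟩ := ((ENNReal.tendsto_tsum_compl_atTop_zero h).eventually
    (ge_mem_nhds hε)).exists
  refine ⟨T.image Subtype.val, le_trans ?_ hT⟩
  rw [← one_mul (∑' b : {x : S // x ∉ T}, F b)]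
  refine tsum_subtype_le_mul_tsum_of_rel (fun v p => v = p.1.1) ?_
    fun _ _ _ _ _ h h' => h.trans h'.symm
  rintro v ⟨hv, hvT⟩ -
  exact ⟨⟨⟨v, hv⟩, fun hmem => hvT (Finset.mem_image_of_mem _ hmem)⟩, rfl, by rw [one_mul]⟩

lemma tsum_le_tsum_tsum_length {W : Type*} (S : Set (List W)) (F : List W → ℝ≥0∞) :
    ∑' u : S, F u ≤ ∑' n : ℕ, ∑' u : {u : List W | u ∈ S ∧ u.length = n}, F u :=
  calc ∑' u : S, F u ≤ ∑' u : ⋃ n : ℕ, {u : List W | u ∈ S ∧ u.length = n}, F u :=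
        ENNReal.tsum_mono_subtype F fun u hu => mem_iUnion.2 ⟨u.length, hu, rfl⟩
    _ ≤ _ := ENNReal.tsum_iUnion_le_tsum F _

lemma tsum_length_eq_mul {W : Type*} (S : Set (List W)) (κ : ℕ → ℝ≥0∞) (F : List W → ℝ≥0∞)
    (n : ℕ) :
    ∑' u : {u : List W | u ∈ S ∧ u.length = n}, κ u.1.length * F u =
      κ n * ∑' u : {u : List W | u ∈ S ∧ u.length = n}, F u := by
  rw [← ENNReal.tsum_mul_left]
  exact tsum_congr fun u => by rw [u.2.2]

lemma tsum_le_tsum_tsum_append {W : Type*} {S T X : Set (List W)}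
    (h : ∀ w ∈ X, ∃ u ∈ S, ∃ v ∈ T, w = u ++ v) (F : List W → ℝ≥0∞) :
    ∑' w : X, F w ≤ ∑' u : S, ∑' v : T, F (u ++ v) := by
  rw [← ENNReal.tsum_prod (f := fun (u : S) (v : T) => F (u ++ v)), ← one_mul (∑' p : S × T, _)]
  refine tsum_subtype_le_mul_tsum_of_rel (fun w p => w = p.1.1 ++ p.2.1) ?_
    fun _ _ _ _ _ h h' => h.trans h'.symm
  rintro w hw -
  obtain ⟨u, hu, v, hv, rfl⟩ := h w hw
  exact ⟨⟨⟨u, hu⟩, ⟨v, hv⟩⟩, rfl, by rw [one_mul]⟩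

end TsumEstimates

namespace MarkovShift

section ReturnSums

variable {W : Type*} {τ : W → W → Prop} {R : MarkovShift τ → ℝ} {c : ℕ → ℝ} {K γ : ℝ}

lemma eventually_firstReturnSum_le_pow {B : W} {r : ℝ} (hr0 : 0 ≤ r)
    (hr : gammaSPR R B < ENNReal.ofReal r) :
    ∀ᶠ n in atTop, firstReturnSum R B n ≤ ENNReal.ofReal (r ^ n) := by
  filter_upwards [eventually_lt_of_limsup_lt hr, eventually_gt_atTop 0] with n hn hn0
  have hroot := (ENNReal.rpow_inv_le_iff (Nat.cast_pos.2 hn0 : (0 : ℝ) < n)).1 hn.le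
  rwa [ENNReal.rpow_natCast, ← ENNReal.ofReal_pow hr0] at hroot

lemma tsum_returnWords_ne_top (hK : BoundedDistortion R K) (hc : IsSlowlyIncreasing c)
    (hγ : 0 < γ) {y : MarkovShift τ} (hspr : gammaSPR R (y.seq 0) < ENNReal.ofReal γ)
    (hsum : HasBoundedWordSums R (y.seq 0) y) :
    ∑' u : returnWords (y.seq 0), coeff c γ u.1.length * wordWeight R y u ≠ ∞ := by
  obtain ⟨r, hr0, hsprr, hrγ⟩ := ENNReal.lt_iff_exists_real_btwn.1 hspr
  replace hrγ : r < γ := (ENNReal.ofReal_lt_ofReal_iff hγ).1 hrγ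
  have hr : 0 < r := ENNReal.ofReal_pos.1 (zero_le.trans_lt hsprr)
  have hK0 := hK.nonneg y
  obtain ⟨q, hq1, hqγ⟩ := exists_between ((one_lt_div hr).2 hrγ)
  obtain ⟨C, hC0, hC⟩ := hc.exists_le_mul_pow hq1
  obtain ⟨M, hM, hle⟩ := hsum
  refine ne_top_of_le_ne_top ?_ (tsum_le_tsum_tsum_length _
    fun u => coeff c γ u.length * wordWeight R y u)
  simp only [tsum_length_eq_mul]
  refine tsum_ne_top_of_eventually_le_geometric (C := C * K) (q := q * r / γ) (fun n => ?_)
    (by positivity) ((div_lt_one hγ).2 ((lt_div_iff₀ hr).1 hqγ)) ?_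
  · refine ENNReal.mul_ne_top (coeff_ne_top _ _ _) (ne_top_of_le_ne_top hM (le_trans ?_ (hle n)))
    exact ENNReal.tsum_mono_subtype _ fun u hu => ⟨hu.1.1, hu.2⟩
  · filter_upwards [eventually_firstReturnSum_le_pow hr0 hsprr] with n hn
    calc _ ≤ ENNReal.ofReal ((γ ^ n)⁻¹ * (C * q ^ n)) *
          (ENNReal.ofReal K * ENNReal.ofReal (r ^ n)) := by
          rw [coeff]
          gcongr
          · exact hC n
          · exact (hK.tsum_returnWords_le_firstReturnSum y n).trans (by gcongr)
      _ = ENNReal.ofReal (C * K * (q * r / γ) ^ n) := by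
          rw [← ENNReal.ofReal_mul hK0, ← ENNReal.ofReal_mul (by positivity), div_pow, mul_pow]
          ring_nf

/-- The words from `b` that avoid the letter `B` after position `i`. -/
def avoidingWords (b B : W) (i : ℕ) : Set (List W) :=
  {u | u.head? = some b ∧ ∀ j, i < j → u[j]? ≠ some B}

lemma tsum_length_le_ne_top {y : MarkovShift τ} (hsum : HasBoundedWordSums R (y.seq 0) y)
    {κ : ℕ → ℝ≥0∞} (hκ : ∀ n, κ n ≠ ∞) (i : ℕ) :
    ∑' u : {u : List W | u.length ≤ i ∧ (u = [] ∨ u.head? = some (y.seq 0))},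
      κ u.1.length * wordWeight R y u ≠ ∞ := by
  obtain ⟨M, hM, hle⟩ := hsum
  let F : List W → ℝ≥0∞ := fun u => κ u.length * wordWeight R y u
  have hsub : {u : List W | u.length ≤ i ∧ (u = [] ∨ u.head? = some (y.seq 0))} ⊆
      {[]} ∪ ⋃ j ∈ Finset.range (i + 1), wordsFrom (y.seq 0) j := by
    rintro u ⟨hu, rfl | hhead⟩
    · exact Or.inl rfl
    · exact Or.inr (mem_biUnion (Finset.mem_coe.2 (Finset.mem_range.2 (by omega))) ⟨hhead, rfl⟩)
  refine ne_top_of_le_ne_top ?_ ((ENNReal.tsum_mono_subtype F hsub).trans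
    ((ENNReal.tsum_union_le F _ _).trans (add_le_add_right (ENNReal.tsum_biUnion_le F _ _) _)))
  refine ENNReal.add_ne_top.2 ⟨?_, (ENNReal.sum_lt_top.2 fun j _ => ?_).ne⟩
  · rw [tsum_singleton]
    exact ENNReal.mul_ne_top (hκ _) (wordWeight_ne_top _ _)
  · calc ∑' u : wordsFrom (y.seq 0) j, F u
        = κ j * ∑' u : wordsFrom (y.seq 0) j, wordWeight R y u :=
          tsum_length_eq_mul {u | u.head? = some (y.seq 0)} κ (wordWeight R y) j
      _ < ∞ := ENNReal.mul_lt_top (hκ j).lt_top ((hle j).trans_lt hM.lt_top)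

lemma exists_split_at_last {u : List W} {B : W} {i : ℕ} (hu : u ∈ avoidingWords B B i) :
    ∃ u₁ ∈ {u : List W | u.length ≤ i ∧ (u = [] ∨ u.head? = some B)}, ∃ u₂ ∈ returnWords B,
      u = u₁ ++ u₂ := by
  classical
  obtain ⟨hhead, havoid⟩ := hu
  have hj : u[Nat.findGreatest (fun j => u[j]? = some B) i]? = some B :=
    Nat.findGreatest_spec (P := fun j => u[j]? = some B) (Nat.zero_le i)
      (by rwa [← List.head?_eq_getElem?])
  have hji := Nat.findGreatest_le (P := fun j => u[j]? = some B) i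
  have hlast := fun k => Nat.findGreatest_is_greatest (P := fun j => u[j]? = some B) (k := k)
    (n := i)
  set j := Nat.findGreatest (fun j => u[j]? = some B) i
  refine ⟨u.take j, ⟨by simp only [List.length_take]; omega, ?_⟩, u.drop j,
    ⟨by rw [List.head?_drop, hj], fun hmem => ?_⟩, (List.take_append_drop j u).symm⟩
  · rcases Nat.eq_zero_or_pos j with hj0 | hj0
    · exact Or.inl (by rw [hj0, List.take_zero])
    · exact Or.inr (by rw [List.head?_take, if_neg hj0.ne', hhead])
  · rw [List.tail_drop, List.mem_iff_getElem?] at hmem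
    obtain ⟨k, hk⟩ := hmem
    rw [List.getElem?_drop] at hk
    rcases le_or_gt (j + 1 + k) i with hki | hki
    · exact hlast _ (by omega) hki hk
    · exact havoid _ hki hk

lemma tsum_avoidingWords_self_ne_top (hK : BoundedDistortion R K)
    (hpos : ∀ z, 0 < R z) (hc : IsSlowlyIncreasing c) (hsub : ∀ m n, c (m + n) ≤ c m * c n)
    (hγ : 0 < γ) {y : MarkovShift τ} (hspr : gammaSPR R (y.seq 0) < ENNReal.ofReal γ)
    (hsum : HasBoundedWordSums R (y.seq 0) y) (i : ℕ) :
    ∑' u : avoidingWords (y.seq 0) (y.seq 0) i, coeff c γ u.1.length * wordWeight R y u ≠ ∞ := by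
  set V : Set (List W) := {u | u.length ≤ i ∧ (u = [] ∨ u.head? = some (y.seq 0))}
  let F : List W → ℝ≥0∞ := fun u => coeff c γ u.length * wordWeight R y u
  have hF : ∀ u₁, ∀ u₂ ∈ returnWords (y.seq 0),
      F (u₁ ++ u₂) ≤ ENNReal.ofReal K * (F u₁ * F u₂) := fun u₁ u₂ hu₂ =>
    calc F (u₁ ++ u₂) ≤ (coeff c γ u₁.length * coeff c γ u₂.length) *
          (ENNReal.ofReal K * (wordWeight R y u₁ * wordWeight R y u₂)) := by
          refine mul_le_mul' ?_ (hK.wordWeight_append_le hpos (head?_append_of_head? hu₂.1))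
          rw [List.length_append]
          exact coeff_add_le hc.1 hsub hγ _ _
      _ = ENNReal.ofReal K * (F u₁ * F u₂) := by simp only [F]; ring
  have hsplit : ∑' u : avoidingWords (y.seq 0) (y.seq 0) i, F u ≤
      ENNReal.ofReal K * ((∑' u : V, F u) * ∑' u : returnWords (y.seq 0), F u) :=
    calc _ ≤ ∑' u₁ : V, ∑' u₂ : returnWords (y.seq 0), F (u₁ ++ u₂) :=
          tsum_le_tsum_tsum_append (fun u hu => exists_split_at_last hu) F
      _ ≤ ∑' u₁ : V, ∑' u₂ : returnWords (y.seq 0), ENNReal.ofReal K * (F u₁ * F u₂) :=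
          ENNReal.tsum_le_tsum fun u₁ => ENNReal.tsum_le_tsum fun u₂ => hF u₁ u₂ u₂.2
      _ = _ := by simp only [ENNReal.tsum_mul_left, ENNReal.tsum_mul_right]
  exact ne_top_of_le_ne_top (ENNReal.mul_ne_top ENNReal.ofReal_ne_top (ENNReal.mul_ne_top
    (tsum_length_le_ne_top hsum (coeff_ne_top _ _) i)
    (tsum_returnWords_ne_top hK hc hγ hspr hsum))) hsplit

lemma tsum_avoidingWords_ne_top (hK : BoundedDistortion R K)
    (hpos : ∀ z, 0 < R z) (hmix : IsMixing τ) (hc : IsSlowlyIncreasing c)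
    (hsub : ∀ m n, c (m + n) ≤ c m * c n) (hγ : 0 < γ) {y : MarkovShift τ}
    (hspr : gammaSPR R (y.seq 0) < ENNReal.ofReal γ)
    (hsum : HasBoundedWordSums R (y.seq 0) y) (b : W) (i : ℕ) :
    ∑' u : avoidingWords b (y.seq 0) i, coeff c γ u.1.length * wordWeight R y u ≠ ∞ := by
  obtain ⟨z, rfl⟩ := hmix.exists_seq_zero_eq b
  obtain ⟨p, -, hp, hpB⟩ := hmix.exists_path (y.seq 0) (z.seq 0) 0
  let F : List W → ℝ≥0∞ := fun u => coeff c γ u.length * wordWeight R y u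
  have hprefix : ∑' u : avoidingWords (z.seq 0) (y.seq 0) i, F u ≤
      (ENNReal.ofReal (γ ^ p.length) * (ENNReal.ofReal K / wordWeight R z p)) *
        ∑' u : avoidingWords (y.seq 0) (y.seq 0) (i + p.length), F u := by
    refine tsum_subtype_le_mul_tsum_of_injOn (p ++ ·) (List.append_right_injective p).injOn ?_
    rintro u ⟨hu, hav⟩ -
    refine ⟨⟨append_mem_headSet hpB hu, fun j hj => ?_⟩, ?_⟩
    · rw [List.getElem?_append_right (by omega)]
      exact hav _ (by omega)
    · calc F u ≤ (ENNReal.ofReal (γ ^ p.length) * coeff c γ (p.length + u.length)) *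
            ((ENNReal.ofReal K / wordWeight R z p) * wordWeight R y (p ++ u)) :=
            mul_le_mul' (coeff_le_mul_coeff_add hc.2.1 hγ _ _)
              (hK.wordWeight_le_prepend hpos hp (head?_append_of_head? hu))
        _ = _ := by simp only [F]; rw [List.length_append]; ring
  exact ne_top_of_le_ne_top (ENNReal.mul_ne_top (ENNReal.mul_ne_top ENNReal.ofReal_ne_top
    (div_wordWeight_ne_top hpos hp K))
    (tsum_avoidingWords_self_ne_top hK hpos hc hsub hγ hspr hsum _)) hprefix

lemma tsum_endWeight_avoidingWords_ne_top (hK : BoundedDistortion R K)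
    (hpos : ∀ z, 0 < R z) (hmix : IsMixing τ) (hc : IsSlowlyIncreasing c)
    (hsub : ∀ m n, c (m + n) ≤ c m * c n) (hγ : 0 < γ) {y : MarkovShift τ}
    (hspr : gammaSPR R (y.seq 0) < ENNReal.ofReal γ)
    (hsum : HasBoundedWordSums R (y.seq 0) y) (a : W) (x : MarkovShift τ) (b : W) (i : ℕ) :
    ∑' v : avoidingWords b (y.seq 0) i, endWeight R a x (coeff c γ) v ≠ ∞ := by
  obtain ⟨e, heB, he, hex⟩ := hmix.exists_path_avoiding (x.seq 0) (y.seq 0)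
  let F : List W → ℝ≥0∞ := fun u => coeff c γ u.length * wordWeight R y u
  have hsuffix : ∑' v : avoidingWords b (y.seq 0) i, endWeight R a x (coeff c γ) v ≤
      (ENNReal.ofReal (γ ^ e.length) * (ENNReal.ofReal K / wordWeight R y e)) *
        ∑' u : avoidingWords b (y.seq 0) i, F u := by
    refine tsum_subtype_le_mul_tsum_of_injOn (· ++ e) (List.append_left_injective e).injOn ?_
    rintro v ⟨hv, hav⟩ -
    refine ⟨⟨head?_append_of_head? hv, fun j hj => ?_⟩, ?_⟩
    · rw [List.getElem?_append]
      split_ifs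
      · exact hav j hj
      · exact fun hB => heB (List.mem_iff_getElem?.2 ⟨_, hB⟩)
    · calc endWeight R a x (coeff c γ) v ≤ coeff c γ v.length * wordWeight R x v := by
            unfold endWeight
            split_ifs
            · exact le_rfl
            · exact zero_le
        _ ≤ (ENNReal.ofReal (γ ^ e.length) * coeff c γ (e.length + v.length)) *
            ((ENNReal.ofReal K / wordWeight R y e) * wordWeight R y (v ++ e)) :=
            mul_le_mul' (coeff_le_mul_coeff_add hc.2.1 hγ _ _)
              (hK.wordWeight_le_append hpos he hex v)
        _ = _ := by simp only [F]; rw [List.length_append, add_comm v.length]; ring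
  exact ne_top_of_le_ne_top (ENNReal.mul_ne_top (ENNReal.mul_ne_top ENNReal.ofReal_ne_top
    (div_wordWeight_ne_top hpos he K))
    (tsum_avoidingWords_ne_top hK hpos hmix hc hsub hγ hspr hsum b i)) hsuffix

lemma exists_split_at_next {v : List W} {b B : W} {i : ℕ} (hv : v ∈ headSet b)
    (havoid : v ∉ avoidingWords b B i) :
    ∃ u v', v = u ++ v' ∧ i < u.length ∧ u ∈ avoidingWords b B i ∧ v' ∈ headSet B := by
  classical
  have hex : ∃ j, i < j ∧ v[j]? = some B := by
    by_contra! hne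
    exact havoid ⟨hv, hne⟩
  obtain ⟨hij, hjB⟩ := Nat.find_spec hex
  have hfirst := fun k => Nat.find_min hex (m := k)
  set j := Nat.find hex
  have hjl : j < v.length := (List.getElem?_eq_some_iff.1 hjB).1
  refine ⟨v.take j, v.drop j, (List.take_append_drop j v).symm,
    by simp only [List.length_take]; omega, ⟨?_, fun k hk => ?_⟩, ?_⟩
  · rw [List.head?_take, if_neg (by omega)]; exact hv
  · rw [List.getElem?_take]
    split_ifs with hkj
    · exact fun hB => hfirst k hkj ⟨hk, hB⟩
    · exact Option.some_ne_none B |>.symm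
  · rw [headSet, mem_ofPred_eq, List.head?_drop, hjB]

end ReturnSums

section Tightness

/-- Bounded distortion, mixing, bounded word sums, and a submultiplicative slowly increasing
function. -/
structure IsWeightSetting {W : Type*} {τ : W → W → Prop} (R : MarkovShift τ → ℝ) (K : ℝ)
    (c : ℕ → ℝ) : Prop where
  pos : ∀ z, 0 < R z
  mixing : IsMixing τ
  distortion : BoundedDistortion R K
  sums : ∀ (b : W) (z : MarkovShift τ), HasBoundedWordSums R b z
  slow : IsSlowlyIncreasing c
  submul : ∀ m n, c (m + n) ≤ c m * c n

/-- A sequence of parameters converging to `γ` from above along which `‖φ_c[t] ∗ f‖ → ∞`. -/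
structure IsApproxSeq {W : Type*} {τ : W → W → Prop} {G ι : Type*} [Group G]
    {H : ι → Subgroup G} (R : MarkovShift τ → ℝ) (s : W → G) (A a : W) (x : MarkovShift τ)
    (f : QuotSum H) (c : ℕ → ℝ) (γ : ℝ) (t : ℕ → ℝ) : Prop where
  adm : τ a (x.seq 0)
  nonneg : ∀ y, 0 ≤ f y
  pos : 0 < γ
  lt : ∀ k, γ < t k
  le : ∀ k, t k ≤ γ + 1
  tendsto : Tendsto t atTop (𝓝 γ)
  regular : ∀ k, IsRegular R s A a x f c (t k)
  norm_tendsto : Tendsto (fun k => ‖densityVec R s A a x H f c (t k)‖) atTop atTop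

variable {W : Type*} {τ : W → W → Prop}
  {R : MarkovShift τ → ℝ} {A a : W} {x : MarkovShift τ}
  {G ι : Type*} [Group G] {s : W → G} {H : ι → Subgroup G} {f : QuotSum H} {c : ℕ → ℝ}
  {t : ℕ → ℝ} {K γ : ℝ}

lemma IsApproxSeq.comp (h : IsApproxSeq R s A a x f c γ t) {φ : ℕ → ℕ} (hφ : StrictMono φ) :
    IsApproxSeq R s A a x f c γ (t ∘ φ) where
  adm := h.adm
  nonneg := h.nonneg
  pos := h.pos
  lt _ := h.lt _
  le _ := h.le _
  tendsto := h.tendsto.comp hφ.tendsto_atTop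
  regular _ := h.regular _
  norm_tendsto := h.norm_tendsto.comp hφ.tendsto_atTop

lemma IsApproxSeq.tendsto_ofReal_div (h : IsApproxSeq R s A a x f c γ t) :
    Tendsto (fun k => ENNReal.ofReal (‖f‖ / ‖densityVec R s A a x H f c (t k)‖)) atTop
      (𝓝 0) := by
  rw [← ENNReal.ofReal_zero]
  exact ENNReal.tendsto_ofReal (h.norm_tendsto.const_div_atTop _)

lemma IsApproxSeq.tendsto_tsum_massWeight (h : IsApproxSeq R s A a x f c γ t)
    (hc0 : ∀ n, 0 < c n) {S : Set (List W)}
    (hS : ∑' v : S, endWeight R a x (coeff c γ) v ≠ ∞) (g : G) :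
    Tendsto (fun k => ∑' v : S, massWeight R s A a x f c g (t k) v) atTop (𝓝 0) := by
  have hbound := ENNReal.Tendsto.const_mul h.tendsto_ofReal_div (Or.inr hS)
  rw [mul_zero] at hbound
  refine tendsto_of_tendsto_of_tendsto_of_le_of_le tendsto_const_nhds hbound
    (fun _ => zero_le) fun k => ?_
  dsimp only
  rw [← ENNReal.tsum_mul_right]
  exact ENNReal.tsum_le_tsum fun v => massWeight_le (h.regular k) hc0 h.pos (h.lt k).le g v

lemma IsWeightSetting.exists_tsum_massWeight_le (hw : IsWeightSetting R K c)
    (h : IsApproxSeq R s A a x f c γ t) (b : W) :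
    ∃ M : ℝ≥0∞, M ≠ ∞ ∧ ∀ k (g : G),
      ∑' v : headSet b, massWeight R s A a x f c g (t k) v ≤ M := by
  obtain ⟨M, hM, hle⟩ := exists_tsum_endWeight_le (A := A) (a := a) (x := x) (s := s)
    hw.distortion hw.pos hw.mixing h.nonneg hw.slow.2.1 (γ + 1) b
  refine ⟨M, hM, fun k g => ?_⟩
  have hD0 := (ENNReal.ofReal_pos.2 (h.regular k).inner_pos).ne'
  simp only [massWeight_eq_mul_inv (h.regular k), ENNReal.tsum_mul_right]
  rw [← div_eq_mul_inv, ENNReal.div_le_iff hD0 ENNReal.ofReal_ne_top]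
  exact hle _ (h.le k) (h.regular k) g⁻¹

lemma IsWeightSetting.exists_tsum_massWeight_le_of_append (hw : IsWeightSetting R K c)
    (h : IsApproxSeq R s A a x f c γ t) (y : MarkovShift τ) :
    ∃ M : ℝ≥0∞, M ≠ ∞ ∧ ∀ S X : Set (List W),
      (∀ w ∈ X, ∃ u ∈ S, ∃ v ∈ headSet (y.seq 0), w = u ++ v) → ∀ (g : G) (k : ℕ),
      ∑' w : X, massWeight R s A a x f c g (t k) w ≤
        M * ∑' u : S, coeff c γ u.1.length * wordWeight R y u := by
  obtain ⟨M, hM, hle⟩ := exists_tsum_massWeight_append_le (A := A) (a := a) (x := x) (s := s)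
    hw.distortion hw.pos hw.mixing h.nonneg hw.slow.1 hw.slow.2.1 hw.submul (γ + 1) y
  refine ⟨M, hM, fun S X hX g k => ?_⟩
  calc _ ≤ ∑' u : S, ∑' v : headSet (y.seq 0), massWeight R s A a x f c g (t k) (u ++ v) :=
        tsum_le_tsum_tsum_append hX _
    _ ≤ ∑' u : S, M * (coeff c γ u.1.length * wordWeight R y u) := by
        refine ENNReal.tsum_le_tsum fun u => (hle _ (h.le k) (h.regular k) g u.1).trans ?_
        gcongr
        exact coeff_anti hw.slow.1 h.pos (h.lt k).le _
    _ = _ := ENNReal.tsum_mul_left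

-- Words avoiding `B` after time `i` have summable weights, so their mass disappears in the limit.
-- Any other word splits at its next visit to `B`, and its mass is controlled by the weight of the
-- initial piece, which is summable and determines the letter at time `i`.
lemma IsWeightSetting.exists_finite_eventually_le (hw : IsWeightSetting R K c)
    (h : IsApproxSeq R s A a x f c γ t) {B : W} (hB : gammaSPR R B < ENNReal.ofReal γ)
    (g : G) (b : W) (i : ℕ) {ε : ℝ≥0∞} (hε : 0 < ε) :
    ∃ F : Set W, F.Finite ∧ ∀ᶠ k in atTop,
      ∑' v : {v | v ∈ headSet b ∧ (v ++ [x.seq 0]).IsChain τ ∧ (prepend v x).seq i ∉ F},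
        massWeight R s A a x f c g (t k) v ≤ ε := by
  obtain ⟨y, rfl⟩ := hw.mixing.exists_seq_zero_eq B
  obtain ⟨M, hM, hle⟩ := hw.exists_tsum_massWeight_le_of_append h y
  have hε2 : 0 < ε / 2 := ENNReal.half_pos hε.ne'
  have hεM : 0 < ε / 2 / (M + 1) :=
    ENNReal.div_pos hε2.ne' (ENNReal.add_ne_top.2 ⟨hM, ENNReal.one_ne_top⟩)
  obtain ⟨T, hT⟩ := exists_finset_tsum_le
    (F := fun u => coeff c γ u.length * wordWeight R y u) (tsum_avoidingWords_ne_top hw.distortion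
      hw.pos hw.mixing hw.slow hw.submul h.pos hB (hw.sums _ y) b i) hεM
  refine ⟨some ⁻¹' ((fun u : List W => u[i]?) '' T),
    (T.finite_toSet.image _).preimage (Option.some_injective _).injOn, ?_⟩
  have hvanish := h.tendsto_tsum_massWeight hw.slow.1 (tsum_endWeight_avoidingWords_ne_top
    hw.distortion hw.pos hw.mixing hw.slow hw.submul h.pos hB (hw.sums _ y) a x b i) g
  filter_upwards [hvanish.eventually (ge_mem_nhds hε2)] with k hk
  set F : Set W := some ⁻¹' ((fun u : List W => u[i]?) '' T)
  set X : Set (List W) := {v | v ∈ headSet b ∧ v ∉ avoidingWords b (y.seq 0) i ∧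
    (v ++ [x.seq 0]).IsChain τ ∧ (prepend v x).seq i ∉ F}
  have hsplit : ∀ w ∈ X, ∃ u ∈ {u | u ∈ avoidingWords b (y.seq 0) i ∧ u ∉ T},
      ∃ v ∈ headSet (y.seq 0), w = u ++ v := by
    rintro w ⟨hw, hav, hch, hwF⟩
    obtain ⟨u, v, rfl, hiu, hu, hv⟩ := exists_split_at_next hw hav
    refine ⟨u, ⟨hu, fun huT => hwF ⟨u, huT, ?_⟩⟩, v, hv, rfl⟩
    rw [← prepend_seq_eq_getElem? hch (by simp only [List.length_append]; omega),
      List.append_assoc, List.getElem?_append_left hiu]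
  calc _ ≤ ∑' v : (X ∪ avoidingWords b (y.seq 0) i : Set (List W)),
        massWeight R s A a x f c g (t k) v :=
        ENNReal.tsum_mono_subtype _ fun v hv =>
          (em (v ∈ avoidingWords b (y.seq 0) i)).elim Or.inr fun hav => Or.inl ⟨hv.1, hav, hv.2⟩
    _ ≤ _ := ENNReal.tsum_union_le _ _ _
    _ ≤ (M + 1) * (ε / 2 / (M + 1)) + ε / 2 := by
        refine add_le_add ((hle _ _ hsplit g k).trans ?_) hk
        gcongr
        exact le_self_add
    _ ≤ ε / 2 + ε / 2 := by gcongr; exact ENNReal.mul_div_le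
    _ = ε := ENNReal.add_halves ε

lemma IsWeightSetting.exists_finite_forall_le (hw : IsWeightSetting R K c)
    (h : IsApproxSeq R s A a x f c γ t) {B : W} (hB : gammaSPR R B < ENNReal.ofReal γ)
    (g : G) (b : W) (i : ℕ) {ε : ℝ≥0∞} (hε : 0 < ε) :
    ∃ F : Set W, F.Finite ∧ ∀ k,
      ∑' v : {v | v ∈ headSet b ∧ (v ++ [x.seq 0]).IsChain τ ∧ (prepend v x).seq i ∉ F},
        massWeight R s A a x f c g (t k) v ≤ ε := by
  obtain ⟨F, hF, hev⟩ := hw.exists_finite_eventually_le h hB g b i hε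
  obtain ⟨N, hN⟩ := eventually_atTop.1 hev
  obtain ⟨M, hM, hle⟩ := hw.exists_tsum_massWeight_le h b
  have hsingle : ∀ k, ∃ F' : Set W, F'.Finite ∧
      ∑' v : {v | v ∈ headSet b ∧ (v ++ [x.seq 0]).IsChain τ ∧ (prepend v x).seq i ∉ F'},
        massWeight R s A a x f c g (t k) v ≤ ε := by
    intro k
    obtain ⟨T, hT⟩ := exists_finset_tsum_le (ne_top_of_le_ne_top hM (hle k g)) hε
    refine ⟨(fun v => (prepend v x).seq i) '' T, T.finite_toSet.image _, le_trans ?_ hT⟩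
    exact ENNReal.tsum_mono_subtype _ fun v hv => ⟨hv.1, fun hvT => hv.2.2 ⟨v, hvT, rfl⟩⟩
  choose F' hF' hle' using hsingle
  have hanti : ∀ k {F₁ F₂ : Set W}, F₁ ⊆ F₂ →
      ∑' v : {v | v ∈ headSet b ∧ (v ++ [x.seq 0]).IsChain τ ∧ (prepend v x).seq i ∉ F₂},
        massWeight R s A a x f c g (t k) v ≤
      ∑' v : {v | v ∈ headSet b ∧ (v ++ [x.seq 0]).IsChain τ ∧ (prepend v x).seq i ∉ F₁},
        massWeight R s A a x f c g (t k) v := fun k _ _ hsub =>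
    ENNReal.tsum_mono_subtype _ fun _ hv => ⟨hv.1, hv.2.1, fun hi => hv.2.2 (hsub hi)⟩
  refine ⟨F ∪ ⋃ k ∈ Finset.range N, F' k,
    hF.union ((Finset.range N).finite_toSet.biUnion fun k _ => hF' k), fun k => ?_⟩
  rcases le_or_gt N k with hkN | hkN
  · exact (hanti k subset_union_left).trans (hN k hkN)
  · exact (hanti k ((subset_biUnion_of_mem (Finset.mem_coe.2 (Finset.mem_range.2 hkN))).trans
      subset_union_right)).trans (hle' k)

variable [Countable W] [TopologicalSpace W] [DiscreteTopology W]

lemma approxMeasure_setOf_seq_notMem_le (hax : τ a (x.seq 0)) (hpos : ∀ z, 0 < R z)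
    (hc0 : ∀ n, 0 < c n) {t : ℝ} (ht : 0 < t) (g : G) (b : W) (i : ℕ) (F : Set W) :
    (approxMeasure R s A a x H f c g t).restrict (cylinder τ [b]) {z | z.seq i ∉ F} ≤
      ∑' v : {v | v ∈ headSet b ∧ (v ++ [x.seq 0]).IsChain τ ∧ (prepend v x).seq i ∉ F},
        massWeight R s A a x f c g t v := by
  have hmeas : MeasurableSet {z : MarkovShift τ | z.seq i ∉ F} :=
    (isClopen_setOf_seq i fun d => d ∉ F).isOpen.measurableSet
  rw [← lintegral_indicator_one hmeas, setLIntegral_approxMeasure hax hpos hc0 ht,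
    ← one_mul (∑' v : {v | v ∈ headSet b ∧ _}, _)]
  refine tsum_subtype_le_mul_tsum_of_injOn
    (f := fun v => massWeight R s A a x f c g t v *
      {z : MarkovShift τ | z.seq i ∉ F}.indicator 1 (prepend v x))
    id (injOn_id _) fun v hv hne => ?_
  refine ⟨⟨hv, (getLast?_and_isChain_of_massWeight_ne_zero (left_ne_zero_of_mul hne)).2,
    mem_of_indicator_ne_zero (right_ne_zero_of_mul hne)⟩, ?_⟩
  rw [one_mul]
  exact mul_le_of_le_one_right zero_le (indicator_le_self' (fun _ _ => zero_le) _)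

lemma IsWeightSetting.isTightMeasureSet (hw : IsWeightSetting R K c)
    (h : IsApproxSeq R s A a x f c γ t) {B : W} (hB : gammaSPR R B < ENNReal.ofReal γ)
    (g : G) (b : W) :
    IsTightMeasureSet (range fun k =>
      (approxMeasure R s A a x H f c g (t k)).restrict (cylinder τ [b])) := by
  rw [isTightMeasureSet_iff_exists_isCompact_measure_compl_le]
  intro ε hε
  obtain ⟨ε', hε', hsum⟩ := ENNReal.exists_pos_sum_of_countable hε.ne' ℕ
  choose F hF hle using fun i => hw.exists_finite_forall_le h hB g b i
    (ENNReal.coe_pos.2 (hε' i))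
  refine ⟨_, isCompact_setOf_forall_mem hF, ?_⟩
  rintro _ ⟨k, rfl⟩
  calc _ = (approxMeasure R s A a x H f c g (t k)).restrict (cylinder τ [b])
        (⋃ i, {z | z.seq i ∉ F i}) := by
        simp only [compl_ofPred, not_forall, ofPred_exists]
    _ ≤ ∑' i, (ε' i : ℝ≥0∞) := (measure_iUnion_le _).trans <| ENNReal.tsum_le_tsum fun i =>
        (approxMeasure_setOf_seq_notMem_le h.adm hw.pos hw.slow.1 (h.regular k).pos g b i
          (F i)).trans (hle i k)
    _ ≤ ε := hsum.le

end Tightness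

section TestFunctions

variable {W : Type*} [TopologicalSpace W] {τ : W → W → Prop}

lemma FiniteOnCylinders.isFiniteMeasure_restrict {m : Measure (MarkovShift τ)}
    (hm : FiniteOnCylinders m) {w : List W} (hw : w ≠ []) :
    IsFiniteMeasure (m.restrict (cylinder τ w)) :=
  ⟨by rw [Measure.restrict_apply_univ]; exact hm w hw⟩

lemma FiniteOnCylinders.setLIntegral_ne_top [DiscreteTopology W] {m : Measure (MarkovShift τ)}
    (hm : FiniteOnCylinders m) {w : List W} (hw : w ≠ []) {F : MarkovShift τ → ℝ≥0∞} {C : ℝ≥0∞}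
    (hC : C ≠ ∞) (hF : ∀ z ∈ cylinder τ w, F z ≤ C) : ∫⁻ z in cylinder τ w, F z ∂m ≠ ∞ := by
  refine ne_top_of_le_ne_top ?_ (setLIntegral_mono' (measurableSet_cylinder w) hF)
  rw [setLIntegral_const]
  exact ENNReal.mul_ne_top hC (hm w hw).ne

lemma WeakStarTendsto.tendsto_setLIntegral_singleton {m : ℕ → Measure (MarkovShift τ)}
    {m' : Measure (MarkovShift τ)} (h : WeakStarTendsto m m') (b : W) {φ : MarkovShift τ → ℝ}
    (hφ : Continuous φ) (hφ0 : ∀ z, 0 ≤ φ z) {C : ℝ} (hC : ∀ z, φ z ≤ C) :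
    Tendsto (fun k => ∫⁻ z in cylinder τ [b], ENNReal.ofReal (φ z) ∂(m k)) atTop
      (𝓝 (∫⁻ z in cylinder τ [b], ENNReal.ofReal (φ z) ∂m')) := by
  let F : MarkovShift τ →ᵇ ℝ := BoundedContinuousFunction.ofNormedAddCommGroup φ hφ C
    fun z => by rw [Real.norm_of_nonneg (hφ0 z)]; exact hC z
  have hintegral : ∀ μ : Measure (MarkovShift τ), FiniteOnCylinders μ →
      ∫⁻ z in cylinder τ [b], ENNReal.ofReal (φ z) ∂μ =
        ENNReal.ofReal (∫ z in cylinder τ [b], F z ∂μ) := by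
    intro μ hμ
    have := hμ.isFiniteMeasure_restrict (List.cons_ne_nil b [])
    exact (ofReal_integral_eq_lintegral_ofReal (F.integrable _) (Eventually.of_forall hφ0)).symm
  rw [hintegral m' h.2.1]
  simp only [hintegral _ (h.1 _)]
  exact ENNReal.tendsto_ofReal (h.2.2 b F)

lemma WeakStarTendsto.tendsto_setLIntegral [DiscreteTopology W]
    {m : ℕ → Measure (MarkovShift τ)} {m' : Measure (MarkovShift τ)} (h : WeakStarTendsto m m')
    {w : List W} (hw : w ≠ []) {φ : MarkovShift τ → ℝ} (hφ : Continuous φ) (hφ0 : ∀ z, 0 ≤ φ z)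
    {C : ℝ} (hC : ∀ z ∈ cylinder τ w, φ z ≤ C) :
    Tendsto (fun k => ∫⁻ z in cylinder τ w, ENNReal.ofReal (φ z) ∂(m k)) atTop
      (𝓝 (∫⁻ z in cylinder τ w, ENNReal.ofReal (φ z) ∂m')) := by
  obtain ⟨b, v, rfl⟩ := List.exists_cons_of_ne_nil hw
  have hsub : cylinder τ (b :: v) ⊆ cylinder τ [b] :=
    fun z hz => mem_cylinder_singleton.2 (hz 0 b rfl)
  have hindicator : ∀ μ : Measure (MarkovShift τ),
      ∫⁻ z in cylinder τ (b :: v), ENNReal.ofReal (φ z) ∂μ =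
        ∫⁻ z in cylinder τ [b], ENNReal.ofReal ((cylinder τ (b :: v)).indicator φ z) ∂μ := by
    intro μ
    have hcomp : (fun z => ENNReal.ofReal ((cylinder τ (b :: v)).indicator φ z)) =
        (cylinder τ (b :: v)).indicator fun z => ENNReal.ofReal (φ z) :=
      (indicator_comp_of_zero ENNReal.ofReal_zero).symm
    rw [hcomp, setLIntegral_indicator (measurableSet_cylinder _),
      inter_eq_self_of_subset_left hsub]
  simp only [hindicator]
  refine h.tendsto_setLIntegral_singleton b ((isClopen_cylinder _).continuous_indicator hφ)
    (fun z => indicator_nonneg (fun z _ => hφ0 z) z) (C := max C 0) fun z => ?_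
  exact indicator_apply_le' (fun hz => (hC z hz).trans (le_max_left _ _)) fun _ => le_max_right _ _

end TestFunctions

section TransferIdentity

variable {W : Type*} {τ : W → W → Prop}
  {R : MarkovShift τ → ℝ} {A a : W} {x : MarkovShift τ} {c : ℕ → ℝ} {r : ℝ}

lemma prepend_seq_zero_of_mem_headSet {v : List W} {b : W} {z : MarkovShift τ}
    (hv : v ∈ headSet b) (hvz : (v ++ [z.seq 0]).IsChain τ) : (prepend v z).seq 0 = b :=
  Option.some.inj ((prepend_seq_zero hvz).symm.trans (head?_append_of_head? hv))

lemma exists_eq_append_of_prepend_mem_cylinder {u w : List W} {b : W} {z : MarkovShift τ}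
    (hu : (u ++ [z.seq 0]).IsChain τ) (hlt : w.length < u.length)
    (hmem : prepend u z ∈ cylinder τ (w ++ [b])) : ∃ v ∈ headSet b, u = w ++ v := by
  have hprefix : w ++ [b] <+: u := List.prefix_iff_getElem?.2 fun i hi => by
    have hi' : i < u.length := by simp only [List.length_append, List.length_singleton] at hi; omega
    rw [List.getElem?_eq_getElem hi', ← prepend_seq_of_lt hu hi', mem_cylinder_iff.1 hmem i hi]
  obtain ⟨v, rfl⟩ := hprefix
  exact ⟨b :: v, rfl, (List.append_cons w b v).symm⟩

lemma endWeight_append (hpos : ∀ z, 0 < R z) (hc0 : ∀ n, 0 < c n) (hr : 0 < r)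
    {w v : List W} {b : W} (hwb : (w ++ [b]).IsChain τ) (hv : v ∈ headSet b)
    (hvx : (v ++ [x.seq 0]).IsChain τ) :
    ENNReal.ofReal (r ^ w.length) * (endWeight R a x (coeff c r) (w ++ v) *
        ENNReal.ofReal (birkhoffProd R w.length (prepend w (prepend v x)))⁻¹) =
      ENNReal.ofReal (c (w.length + v.length) / c v.length) * endWeight R a x (coeff c r) v := by
  have hw' : (w ++ [(prepend v x).seq 0]).IsChain τ := by
    rwa [prepend_seq_zero_of_mem_headSet hv hvx]
  unfold endWeight
  rw [getLast?_append_of_head? hv]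
  split_ifs
  swap
  · simp only [zero_mul, mul_zero]
  rw [wordWeight_append hpos hvx, wordWeight_of_isChain hw', List.length_append]
  set B := birkhoffProd R w.length (prepend w (prepend v x))
  have hB : 0 < B := birkhoffProd_pos hpos _ _
  have hcoeff : ENNReal.ofReal (r ^ w.length) * coeff c r (w.length + v.length) =
      ENNReal.ofReal (c (w.length + v.length) / c v.length) * coeff c r v.length := by
    have hcv := hc0 v.length
    have hcw := hc0 (w.length + v.length)
    rw [coeff, coeff, ← ENNReal.ofReal_mul (by positivity), ← ENNReal.ofReal_mul (by positivity),
      pow_add]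
    congr 1
    field_simp
  have hcancel : ENNReal.ofReal B * ENNReal.ofReal B⁻¹ = 1 := by
    rw [← ENNReal.ofReal_mul hB.le, mul_inv_cancel₀ hB.ne', ENNReal.ofReal_one]
  calc _ = (ENNReal.ofReal (r ^ w.length) * coeff c r (w.length + v.length)) *
        wordWeight R x v * (ENNReal.ofReal B * ENNReal.ofReal B⁻¹) := by ring
    _ = _ := by rw [hcoeff, hcancel, mul_one, mul_assoc]

variable {G ι : Type*} [Group G] {s : W → G} {H : ι → Subgroup G} {f : QuotSum H} {t : ℕ → ℝ}
  {K γ : ℝ}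

lemma massWeight_append (hpos : ∀ z, 0 < R z) (hc0 : ∀ n, 0 < c n) (hr : 0 < r) (g : G)
    {w v : List W} {b : W} (hwb : (w ++ [b]).IsChain τ) (hv : v ∈ headSet b)
    (hvx : (v ++ [x.seq 0]).IsChain τ) :
    ENNReal.ofReal (r ^ w.length) * (massWeight R s A a x f c g r (w ++ v) *
        ENNReal.ofReal (birkhoffProd R w.length (prepend w (prepend v x)))⁻¹) =
      ENNReal.ofReal (c (w.length + v.length) / c v.length) *
        massWeight R s A a x f c (g * wordProd s w) r v := by
  rw [massWeight, massWeight, inner_quotRep_wordProd_append, ← mul_inv_rev, ← mul_assoc _ _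
    (ENNReal.ofReal (_ / _)), ← endWeight_append (a := a) hpos hc0 hr hwb hv hvx]
  ring

lemma massWeight_append_mul_indicator (hpos : ∀ z, 0 < R z) (hc0 : ∀ n, 0 < c n) (hr : 0 < r)
    (g : G) {w v : List W} {b : W} (hwb : (w ++ [b]).IsChain τ) (hv : v ∈ headSet b)
    (φ : MarkovShift τ → ℝ≥0∞) :
    ENNReal.ofReal (r ^ w.length) * (massWeight R s A a x f c g r (w ++ v) *
        (cylinder τ (w ++ [b])).indicator
          (fun z => ENNReal.ofReal (birkhoffProd R w.length z)⁻¹ * φ z) (prepend (w ++ v) x)) =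
      ENNReal.ofReal (c (w.length + v.length) / c v.length) *
        (massWeight R s A a x f c (g * wordProd s w) r v * φ (prepend w (prepend v x))) := by
  by_cases hvx : (v ++ [x.seq 0]).IsChain τ
  · have hseq := prepend_seq_zero_of_mem_headSet hv hvx
    have hmem : prepend w (prepend v x) ∈ cylinder τ (w ++ [b]) :=
      (mem_cylinder_append_singleton (by rwa [hseq])).2 hseq
    rw [prepend_append (isChain_append_append (head?_append_of_head? hv) hwb hvx),
      indicator_of_mem hmem, ← mul_assoc (ENNReal.ofReal (_ / _)),
      ← massWeight_append hpos hc0 hr g hwb hv hvx]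
    ring
  · have hzero : massWeight R s A a x f c (g * wordProd s w) r v = 0 := by_contra fun hne =>
      hvx (getLast?_and_isChain_of_massWeight_ne_zero hne).2
    have hzero' : massWeight R s A a x f c g r (w ++ v) = 0 := by_contra fun hne => by
      have hwvx := (getLast?_and_isChain_of_massWeight_ne_zero hne).2
      exact hvx (isChain_append_singleton_of_append hwvx (head?_append_of_head? hv)).2
    rw [hzero, hzero', zero_mul, zero_mul, mul_zero, mul_zero]

/-- The words of length at most `N` with first letter `b`, whose mass vanishes in the limit. -/
def shortWords (b : W) (N : ℕ) : Set (List W) := {v | v ∈ headSet b ∧ v.length ≤ N}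

lemma HasBoundedWordSums.tsum_shortWords_ne_top {b : W} (h : HasBoundedWordSums R b x) (c : ℕ → ℝ)
    (N : ℕ) (r : ℝ) : ∑' v : shortWords b N, endWeight R a x (coeff c r) v ≠ ∞ := by
  obtain ⟨M, hM, hle⟩ := h
  have hsub : shortWords b N ⊆ ⋃ j ∈ Finset.range (N + 1), wordsFrom b j := by
    rintro v ⟨hv, hN⟩
    simp only [mem_iUnion, Finset.mem_range]
    exact ⟨v.length, by omega, hv, rfl⟩
  have hlength : ∀ j, ∑' v : wordsFrom b j, endWeight R a x (coeff c r) v ≤ coeff c r j * M := by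
    intro j
    calc _ ≤ ∑' v : wordsFrom b j, coeff c r j * wordWeight R x v := by
          refine ENNReal.tsum_le_tsum fun v => ?_
          unfold endWeight
          split_ifs
          · rw [v.2.2]
          · exact zero_le
      _ ≤ coeff c r j * M := by rw [ENNReal.tsum_mul_left]; gcongr; exact hle j
  refine ne_top_of_le_ne_top ?_ ((ENNReal.tsum_mono_subtype _ hsub).trans <|
    (ENNReal.tsum_biUnion_le _ _ _).trans <| Finset.sum_le_sum fun j _ => hlength j)
  exact ENNReal.sum_ne_top.2 fun j _ => ENNReal.mul_ne_top (coeff_ne_top c r j) hM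

lemma tsum_mul_le_add_tsum_shortWords {κ : ℕ → ℝ≥0∞} {N : ℕ} {δ C : ℝ≥0∞}
    (hδ : ∀ n, N < n → κ n ≤ δ) (hC : ∀ n, κ n ≤ C) (b : W) (F : List W → ℝ≥0∞) :
    ∑' v : headSet b, κ v.1.length * F v ≤
      δ * ∑' v : headSet b, F v + C * ∑' v : shortWords b N, F v := by
  have hcover : headSet b ⊆ {v | v ∈ headSet b ∧ N < v.length} ∪ shortWords b N := fun v hv =>
    (lt_or_ge N v.length).imp (⟨hv, ·⟩) (⟨hv, ·⟩)
  refine (ENNReal.tsum_mono_subtype (fun v => κ v.length * F v) hcover).trans <|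
    (ENNReal.tsum_union_le (fun v => κ v.length * F v) _ _).trans (add_le_add ?_ ?_)
  · calc _ ≤ ∑' v : {v | v ∈ headSet b ∧ N < v.length}, δ * F v :=
          ENNReal.tsum_le_tsum fun v => by gcongr; exact hδ _ v.2.2
      _ ≤ δ * ∑' v : headSet b, F v := by
          rw [ENNReal.tsum_mul_left]
          gcongr
          exact ENNReal.tsum_mono_subtype F fun v hv => hv.1
  · rw [← ENNReal.tsum_mul_left]
    exact ENNReal.tsum_le_tsum fun v => by gcongr; exact hC _

lemma BoundedDistortion.exists_inv_birkhoffProd_le (hK : BoundedDistortion R K)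
    (hpos : ∀ z, 0 < R z) (w : List W) (b : W) :
    ∃ C, ∀ z ∈ cylinder τ (w ++ [b]), (birkhoffProd R w.length z)⁻¹ ≤ C := by
  by_cases hne : (cylinder τ (w ++ [b])).Nonempty
  · obtain ⟨y, hy⟩ := hne
    refine ⟨K * (birkhoffProd R w.length y)⁻¹, fun z hz => ?_⟩
    have hyz := hK w.length y z fun i hi => by
      rw [mem_cylinder_iff.1 hy i (by simp; omega), mem_cylinder_iff.1 hz i (by simp; omega)]
    rw [inv_le_iff_one_le_mul₀ (birkhoffProd_pos hpos _ _), mul_right_comm, ← div_eq_mul_inv,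
      one_le_div (birkhoffProd_pos hpos _ _)]
    exact hyz
  · exact ⟨0, fun z hz => absurd ⟨z, hz⟩ hne⟩

lemma tsum_headSet_append_le {w : List W} {b d : W} (hd : (w ++ [b]).head? = some d)
    (Φ : List W → ℝ≥0∞) : ∑' v : headSet b, Φ (w ++ v) ≤ ∑' u : headSet d, Φ u :=
  ENNReal.tsum_comp_le_tsum_of_injective
    (f := fun v : headSet b => (⟨w ++ v, append_mem_headSet hd v.2⟩ : headSet d))
    (fun _ _ h => Subtype.ext (List.append_cancel_left (congrArg Subtype.val h))) fun u => Φ u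

lemma tsum_headSet_le_add_tsum_shortWords {w : List W} {b : W} (d : W) {Φ : List W → ℝ≥0∞}
    (hΦ : ∀ u, w.length < u.length → Φ u ≠ 0 → ∃ v ∈ headSet b, u = w ++ v) :
    ∑' u : headSet d, Φ u ≤
      ∑' v : headSet b, Φ (w ++ v) + ∑' u : shortWords d w.length, Φ u := by
  have hcover : headSet d ⊆ {u | w.length < u.length} ∪ shortWords d w.length := fun u hu =>
    (lt_or_ge w.length u.length).imp id (⟨hu, ·⟩)
  refine (ENNReal.tsum_mono_subtype Φ hcover).trans <|
    (ENNReal.tsum_union_le Φ _ _).trans (add_le_add ?_ le_rfl)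
  rw [← one_mul (∑' v : headSet b, Φ (w ++ v))]
  refine tsum_subtype_le_mul_tsum_of_rel (fun u v => u = w ++ v.1) (fun u hu hne => ?_)
    fun _ _ _ _ _ h h' => h.trans h'.symm
  obtain ⟨v, hv, rfl⟩ := hΦ u hu hne
  exact ⟨⟨v, hv⟩, rfl, (one_mul _).ge⟩

variable [Countable W] [TopologicalSpace W] [DiscreteTopology W]

lemma setLIntegral_cylinder_approxMeasure (hax : τ a (x.seq 0)) (hpos : ∀ z, 0 < R z)
    (hc0 : ∀ n, 0 < c n) (hr : 0 < r) (g : G) {w : List W} {d : W} (hd : w.head? = some d)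
    (F : MarkovShift τ → ℝ≥0∞) :
    ∫⁻ z in cylinder τ w, F z ∂(approxMeasure R s A a x H f c g r) =
      ∑' u : headSet d,
        massWeight R s A a x f c g r u * (cylinder τ w).indicator F (prepend u x) := by
  have hsub : cylinder τ w ⊆ cylinder τ [d] := fun z hz =>
    mem_cylinder_singleton.2 (hz 0 d (by rw [← List.head?_eq_getElem?, hd]))
  rw [← setLIntegral_approxMeasure hax hpos hc0 hr, setLIntegral_indicator
    (measurableSet_cylinder _), inter_eq_self_of_subset_left hsub]

lemma IsWeightSetting.setLIntegral_comp_prepend_le (hw : IsWeightSetting R K c)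
    (hax : τ a (x.seq 0)) (hr : 0 < r) {w : List W} {b : W} (hwb : (w ++ [b]).IsChain τ) (g : G)
    (φ : MarkovShift τ → ℝ≥0∞) :
    ∫⁻ z in cylinder τ [b], φ (prepend w z)
        ∂(approxMeasure R s A a x H f c (g * wordProd s w) r) ≤
      ENNReal.ofReal (r ^ w.length) * ∫⁻ z in cylinder τ (w ++ [b]),
        ENNReal.ofReal (birkhoffProd R w.length z)⁻¹ * φ z
          ∂(approxMeasure R s A a x H f c g r) := by
  obtain ⟨d, hd⟩ : ∃ d, (w ++ [b]).head? = some d :=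
    ⟨_, List.head?_eq_some_head (List.concat_ne_nil b w)⟩
  rw [setLIntegral_approxMeasure hax hw.pos hw.slow.1 hr,
    setLIntegral_cylinder_approxMeasure hax hw.pos hw.slow.1 hr g hd]
  refine le_trans ?_ (mul_le_mul_right (tsum_headSet_append_le hd fun u =>
    massWeight R s A a x f c g r u * (cylinder τ (w ++ [b])).indicator
      (fun z => ENNReal.ofReal (birkhoffProd R w.length z)⁻¹ * φ z) (prepend u x)) _)
  rw [← ENNReal.tsum_mul_left]
  refine ENNReal.tsum_le_tsum fun v => ?_
  rw [massWeight_append_mul_indicator hw.pos hw.slow.1 hr g hwb v.2]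
  refine le_mul_of_one_le_left zero_le ?_
  rw [ENNReal.one_le_ofReal, one_le_div (hw.slow.1 _)]
  exact hw.slow.2.1 (by omega)

lemma IsWeightSetting.mul_setLIntegral_le (hw : IsWeightSetting R K c) (hax : τ a (x.seq 0))
    (hr : 0 < r) {w : List W} {b d : W} (hwb : (w ++ [b]).IsChain τ)
    (hd : (w ++ [b]).head? = some d) (g : G) {φ : MarkovShift τ → ℝ≥0∞} {C C' : ℝ≥0∞}
    (hC : ∀ z, φ z ≤ C)
    (hC' : ∀ z ∈ cylinder τ (w ++ [b]), ENNReal.ofReal (birkhoffProd R w.length z)⁻¹ ≤ C')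
    {N : ℕ} {δ : ℝ} (hδ : ∀ n > N, c (w.length + n) / c n ≤ δ) :
    ENNReal.ofReal (r ^ w.length) * ∫⁻ z in cylinder τ (w ++ [b]),
        ENNReal.ofReal (birkhoffProd R w.length z)⁻¹ * φ z
          ∂(approxMeasure R s A a x H f c g r) ≤
      ENNReal.ofReal δ * ∫⁻ z in cylinder τ [b], φ (prepend w z)
          ∂(approxMeasure R s A a x H f c (g * wordProd s w) r) +
        ENNReal.ofReal (c w.length) * (C * ∑' v : shortWords b N,
          massWeight R s A a x f c (g * wordProd s w) r v) +
        ENNReal.ofReal (r ^ w.length) * (C' * C * ∑' v : shortWords d w.length,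
          massWeight R s A a x f c g r v) := by
  rw [setLIntegral_approxMeasure hax hw.pos hw.slow.1 hr,
    setLIntegral_cylinder_approxMeasure hax hw.pos hw.slow.1 hr g hd]
  set F := (cylinder τ (w ++ [b])).indicator
    fun z => ENNReal.ofReal (birkhoffProd R w.length z)⁻¹ * φ z with hF
  have hlong : ∀ u : List W, w.length < u.length →
      massWeight R s A a x f c g r u * F (prepend u x) ≠ 0 → ∃ v ∈ headSet b, u = w ++ v :=
    fun u hu hne => exists_eq_append_of_prepend_mem_cylinder
      (getLast?_and_isChain_of_massWeight_ne_zero (left_ne_zero_of_mul hne)).2 hu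
      (mem_of_indicator_ne_zero (right_ne_zero_of_mul hne))
  have hFC : ∀ z, F z ≤ C' * C := fun z =>
    indicator_apply_le' (fun hz => mul_le_mul' (hC' z hz) (hC z)) fun _ => zero_le
  refine (mul_le_mul_right (tsum_headSet_le_add_tsum_shortWords d hlong) _).trans ?_
  rw [mul_add]
  refine add_le_add ?_ ?_
  · rw [← ENNReal.tsum_mul_left]
    simp only [hF, massWeight_append_mul_indicator hw.pos hw.slow.1 hr g hwb (Subtype.prop _)]
    refine (tsum_mul_le_add_tsum_shortWords
      (κ := fun n => ENNReal.ofReal (c (w.length + n) / c n)) (N := N)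
      (fun n hn => ENNReal.ofReal_le_ofReal (hδ n hn))
      (fun n => ENNReal.ofReal_le_ofReal ((div_le_iff₀ (hw.slow.1 n)).2 (hw.submul _ _))) b
      fun v => massWeight R s A a x f c (g * wordProd s w) r v *
        φ (prepend w (prepend v x))).trans ?_
    gcongr
    rw [← ENNReal.tsum_mul_left]
    exact ENNReal.tsum_le_tsum fun v => by rw [mul_comm C]; gcongr; exact hC _
  · gcongr
    rw [← ENNReal.tsum_mul_left]
    exact ENNReal.tsum_le_tsum fun v => by rw [mul_comm (C' * C)]; gcongr; exact hFC _

lemma IsWeightSetting.exists_tendsto_zero_mul_setLIntegral_le (hw : IsWeightSetting R K c)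
    (h : IsApproxSeq R s A a x f c γ t) {w : List W} {b : W} (hwb : (w ++ [b]).IsChain τ)
    (g : G) {φ : MarkovShift τ → ℝ≥0∞} {C : ℝ≥0∞} (hCtop : C ≠ ∞) (hC : ∀ z, φ z ≤ C)
    {δ : ℝ} (hδ : 1 < δ) :
    ∃ E : ℕ → ℝ≥0∞, Tendsto E atTop (𝓝 0) ∧ ∀ k,
      ENNReal.ofReal (t k ^ w.length) * ∫⁻ z in cylinder τ (w ++ [b]),
          ENNReal.ofReal (birkhoffProd R w.length z)⁻¹ * φ z
            ∂(approxMeasure R s A a x H f c g (t k)) ≤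
        ENNReal.ofReal δ * ∫⁻ z in cylinder τ [b], φ (prepend w z)
          ∂(approxMeasure R s A a x H f c (g * wordProd s w) (t k)) + E k := by
  obtain ⟨d, hd⟩ : ∃ d, (w ++ [b]).head? = some d :=
    ⟨_, List.head?_eq_some_head (List.concat_ne_nil b w)⟩
  obtain ⟨C', hC'⟩ := hw.distortion.exists_inv_birkhoffProd_le hw.pos w b
  obtain ⟨N, hN⟩ := eventually_atTop.1 ((hw.slow.2.2.2 w.length).eventually (ge_mem_nhds hδ))
  have hshort : ∀ (d : W) (N : ℕ) (g : G) {B : ℝ≥0∞}, B ≠ ∞ → Tendsto (fun k =>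
      B * ∑' v : shortWords d N, massWeight R s A a x f c g (t k) v) atTop (𝓝 0) := by
    intro d N g B hB
    simpa only [mul_zero] using ENNReal.Tendsto.const_mul (h.tendsto_tsum_massWeight hw.slow.1
      ((hw.sums d x).tsum_shortWords_ne_top c N γ) g) (Or.inr hB)
  have hpow : Tendsto (fun k => ENNReal.ofReal (t k ^ w.length)) atTop
      (𝓝 (ENNReal.ofReal (γ ^ w.length))) := ENNReal.tendsto_ofReal (h.tendsto.pow _)
  refine ⟨_, ?_, fun k => (hw.mul_setLIntegral_le h.adm (h.regular k).pos hwb hd g hC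
    (fun z hz => ENNReal.ofReal_le_ofReal (hC' z hz)) (N := N) (δ := δ)
    fun n hn => by rw [add_comm]; exact hN n hn.le).trans (add_assoc _ _ _).le⟩
  simpa only [mul_zero, add_zero] using
    (ENNReal.Tendsto.const_mul (hshort b N (g * wordProd s w) hCtop)
      (Or.inr ENNReal.ofReal_ne_top)).add
    (ENNReal.Tendsto.mul hpow (Or.inr ENNReal.zero_ne_top)
      (hshort d w.length g (ENNReal.mul_ne_top ENNReal.ofReal_ne_top hCtop))
      (Or.inr ENNReal.ofReal_ne_top))

-- Prepending `w` multiplies the weight of a word of length `n` by `c_{|w|+n} / c_n`, up to the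
-- factor in the identity. This ratio tends to `1`, and the mass of the short words tends to `0`.
lemma IsWeightSetting.mul_setLIntegral_eq_comp_prepend (hw : IsWeightSetting R K c)
    (hR : Continuous R) (h : IsApproxSeq R s A a x f c γ t) {μ : G → Measure (MarkovShift τ)}
    (hμ : ∀ g, WeakStarTendsto (fun k => approxMeasure R s A a x H f c g (t k)) (μ g))
    {w : List W} {b : W} (hwb : (w ++ [b]).IsChain τ) (g : G) {φ : MarkovShift τ → ℝ}
    (hφ : Continuous φ) (hφ0 : ∀ z, 0 ≤ φ z) {C : ℝ} (hC : ∀ z, φ z ≤ C) :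
    ENNReal.ofReal (γ ^ w.length) * ∫⁻ z in cylinder τ (w ++ [b]),
        ENNReal.ofReal (birkhoffProd R w.length z)⁻¹ * ENNReal.ofReal (φ z) ∂(μ g) =
      ∫⁻ z in cylinder τ [b], ENNReal.ofReal (φ (prepend w z)) ∂(μ (g * wordProd s w)) := by
  have hne : w ++ [b] ≠ [] := List.concat_ne_nil b w
  obtain ⟨C', hC'⟩ := hw.distortion.exists_inv_birkhoffProd_le hw.pos w b
  have hinv : ∀ z, 0 ≤ (birkhoffProd R w.length z)⁻¹ := fun z =>
    inv_nonneg.2 (birkhoffProd_pos hw.pos _ z).le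
  have hbound : ∀ z ∈ cylinder τ (w ++ [b]), (birkhoffProd R w.length z)⁻¹ * φ z ≤ C' * C :=
    fun z hz => mul_le_mul (hC' z hz) (hC z) (hφ0 z) ((hinv z).trans (hC' z hz))
  have hcont : Continuous fun z => (birkhoffProd R w.length z)⁻¹ * φ z :=
    ((continuous_birkhoffProd hR _).inv₀ fun z => (birkhoffProd_pos hw.pos _ z).ne').mul hφ
  have hlim := (hμ g).tendsto_setLIntegral hne hcont (fun z => mul_nonneg (hinv z) (hφ0 z)) hbound
  have hfin := (hμ g).2.1.setLIntegral_ne_top hne ENNReal.ofReal_ne_top fun z hz =>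
    ENNReal.ofReal_le_ofReal (hbound z hz)
  have hlim' := (hμ (g * wordProd s w)).tendsto_setLIntegral (List.cons_ne_nil b [])
    (hφ.comp (continuous_prepend w)) (fun z => hφ0 _) (fun z _ => hC _)
  simp only [ENNReal.ofReal_mul (hinv _)] at hlim hfin
  simp only [Function.comp_apply] at hlim'
  have hlimγ := ENNReal.Tendsto.mul (ENNReal.tendsto_ofReal (h.tendsto.pow w.length))
    (Or.inr hfin) hlim (Or.inr ENNReal.ofReal_ne_top)
  refine le_antisymm ?_ (le_of_tendsto_of_tendsto' hlim' hlimγ fun k =>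
    hw.setLIntegral_comp_prepend_le h.adm (h.regular k).pos hwb g fun z => ENNReal.ofReal (φ z))
  set D := ∫⁻ z in cylinder τ [b], ENNReal.ofReal (φ (prepend w z)) ∂(μ (g * wordProd s w))
  have hδ : Tendsto (fun δ : ℝ => ENNReal.ofReal δ * D) (𝓝[>] 1) (𝓝 D) := by
    have hcont := ENNReal.Tendsto.mul_const (b := D)
      (ENNReal.tendsto_ofReal (tendsto_id (x := 𝓝 (1 : ℝ)))) (Or.inl (by simp))
    simp only [id_eq, ENNReal.ofReal_one, one_mul] at hcont
    exact hcont.mono_left nhdsWithin_le_nhds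
  refine ge_of_tendsto hδ (eventually_mem_nhdsWithin.mono fun δ hδ1 => ?_)
  obtain ⟨E, hE, hle⟩ := hw.exists_tendsto_zero_mul_setLIntegral_le h hwb g
    ENNReal.ofReal_ne_top (fun z => ENNReal.ofReal_le_ofReal (hC z)) hδ1
  refine le_of_tendsto_of_tendsto' hlimγ ?_ hle
  simpa only [add_zero] using
    (ENNReal.Tendsto.const_mul hlim' (Or.inr ENNReal.ofReal_ne_top)).add hE

end TransferIdentity

section Existence

variable {W : Type*} {τ : W → W → Prop}
  {R : MarkovShift τ → ℝ} {A a : W} {x : MarkovShift τ}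
  {G ι : Type*} [Group G] {s : W → G} {H : ι → Subgroup G} {f : QuotSum H} {c : ℕ → ℝ} {γ : ℝ}

lemma truncate_coeff_le_two_mul_coeff (hc0 : ∀ n, 0 < c n) (hγ : 0 < γ) {r : ℝ} (hr : γ ≤ r)
    {N : ℕ} (hN : (r / γ) ^ N ≤ 2) (n : ℕ) : truncate (coeff c γ) N n ≤ 2 * coeff c r n := by
  unfold truncate
  split_ifs with hn
  · have hcn := hc0 n
    have hr0 : 0 < r := hγ.trans_le hr
    have hpow : (r / γ) ^ n ≤ 2 := (pow_le_pow_right₀ ((one_le_div hγ).2 hr) hn).trans hN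
    have hcoeff : (γ ^ n)⁻¹ * c n ≤ 2 * ((r ^ n)⁻¹ * c n) :=
      calc (γ ^ n)⁻¹ * c n = (r / γ) ^ n * ((r ^ n)⁻¹ * c n) := by rw [div_pow]; field_simp
        _ ≤ 2 * ((r ^ n)⁻¹ * c n) := by gcongr
    simpa [coeff, ENNReal.ofReal_mul] using ENNReal.ofReal_le_ofReal hcoeff
  · exact zero_le

lemma exists_le_pathEnergy (hc0 : ∀ n, 0 < c n) (hγ : 0 < γ)
    (htop : pathEnergy R s A a x f (coeff c γ) = ∞) (k : ℕ) {δ : ℝ} (hδ : 0 < δ) :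
    ∃ r, γ < r ∧ r ≤ γ + δ ∧ (k : ℝ≥0∞) ≤ pathEnergy R s A a x f (coeff c r) := by
  rw [pathEnergy_eq_iSup] at htop
  obtain ⟨N, hN⟩ := lt_iSup_iff.1 (htop ▸ ENNReal.natCast_lt_top (4 * k))
  have hlim : Tendsto (fun r : ℝ => (r / γ) ^ N) (𝓝[>] γ) (𝓝 1) := by
    have hcont : ContinuousAt (fun r : ℝ => (r / γ) ^ N) γ := by fun_prop
    simpa [div_self hγ.ne'] using hcont.tendsto.mono_left nhdsWithin_le_nhds
  obtain ⟨r, ⟨hr2, hrδ⟩, hr : γ < r⟩ := (((hlim.eventually (ge_mem_nhds one_lt_two)).and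
    (mem_nhdsWithin_of_mem_nhds (ge_mem_nhds (lt_add_of_pos_right γ hδ)))).and
    self_mem_nhdsWithin).exists
  refine ⟨r, hr, hrδ, ?_⟩
  have hle : (4 : ℝ≥0∞) * k ≤ 4 * pathEnergy R s A a x f (coeff c r) :=
    calc (4 : ℝ≥0∞) * k = ((4 * k : ℕ) : ℝ≥0∞) := by push_cast; rfl
      _ ≤ pathEnergy R s A a x f fun n => 2 * coeff c r n :=
        hN.le.trans (pathEnergy_mono (truncate_coeff_le_two_mul_coeff hc0 hγ hr.le hr2))
      _ = 4 * pathEnergy R s A a x f (coeff c r) := by rw [pathEnergy_const_mul]; norm_num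
  exact (ENNReal.mul_le_mul_iff_right (by norm_num) (by norm_num)).1 hle

lemma ofReal_inner_densityVec_and_isRegular (hpos : ∀ z, 0 < R z) (hax : τ a (x.seq 0))
    (hsum : HasBoundedWordSums R A x) (hf : ∀ y, 0 ≤ f y) (hf0 : f ≠ 0) (hc : ∀ n, 0 ≤ c n)
    {t : ℝ} (ht : 0 < t) (hE0 : pathEnergy R s A a x f (coeff c t) ≠ 0)
    (hE : pathEnergy R s A a x f (coeff c t) ≠ ∞) :
    ENNReal.ofReal (inner ℝ (densityVec R s A a x H f c t) (densityVec R s A a x H f c t)) =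
      pathEnergy R s A a x f (coeff c t) ∧ IsRegular R s A a x f c t := by
  obtain ⟨hterm, hpush⟩ :=
    isPushWeight_density hpos hax hc ht hf hf0 hsum.tsum_pathWeight_single_ne_top hE
  have hsummable := hpush.summable_of_energy_ne_top hf hE
  have hinner : ENNReal.ofReal (inner ℝ (densityVec R s A a x H f c t)
      (densityVec R s A a x H f c t)) = _ := hpush.ofReal_inner_self hf hsummable
  exact ⟨hinner, ht, hterm, hpush, hsummable,
    ENNReal.ofReal_pos.1 (by rwa [hinner, pos_iff_ne_zero])⟩

lemma exists_isApproxSeq (hpos : ∀ z, 0 < R z) (hax : τ a (x.seq 0))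
    (hsum : HasBoundedWordSums R A x) (hf : ∀ y, 0 ≤ f y) (hf0 : f ≠ 0)
    (hγ : 0 < decayExponent R s A a x H f) (hc : IsSlowlyIncreasing c)
    (htop : pathEnergy R s A a x f (coeff c (decayExponent R s A a x H f)) = ∞) :
    ∃ t, IsApproxSeq R s A a x f c (decayExponent R s A a x H f) t := by
  set γ := decayExponent R s A a x H f
  choose t hlt hle hE using fun k : ℕ =>
    exists_le_pathEnergy hc.1 hγ htop (k + 1) (Nat.one_div_pos_of_nat (α := ℝ) (n := k))
  have hreg := fun k => ofReal_inner_densityVec_and_isRegular hpos hax hsum hf hf0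
    (fun n => (hc.1 n).le) (hγ.trans (hlt k))
    (ne_bot_of_le_ne_bot (Nat.cast_ne_zero.2 k.succ_ne_zero) (hE k))
    (pathEnergy_ne_top_of_decayExponent_lt hpos hax hsum hf hc (hlt k))
  have hnorm : ∀ k : ℕ, √k ≤ ‖densityVec R s A a x H f c (t k)‖ := by
    intro k
    refine Real.sqrt_le_iff.2 ⟨norm_nonneg _, ?_⟩
    rw [← real_inner_self_eq_norm_sq, ← ENNReal.ofReal_le_ofReal_iff real_inner_self_nonneg,
      (hreg k).1, ENNReal.ofReal_natCast]
    exact (Nat.cast_le.2 k.le_succ).trans (hE k)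
  have hlim : Tendsto (fun k : ℕ => γ + 1 / ((k : ℝ) + 1)) atTop (𝓝 γ) := by
    simpa only [add_zero] using
      (tendsto_const_nhds (x := γ)).add tendsto_one_div_add_atTop_nhds_zero_nat
  exact ⟨t, {
    adm := hax
    nonneg := hf
    pos := hγ
    lt := hlt
    le := fun k => (hle k).trans <| add_le_add_right
      ((div_le_one k.cast_add_one_pos).2 (le_add_of_nonneg_left k.cast_nonneg)) γ
    tendsto := tendsto_of_tendsto_of_tendsto_of_le_of_le tendsto_const_nhds hlim
      (fun k => (hlt k).le) hle
    regular := fun k => (hreg k).2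
    norm_tendsto := tendsto_atTop_mono hnorm
      (Real.tendsto_sqrt_atTop.comp tendsto_natCast_atTop_atTop) }⟩

end Existence

section Limits

variable {W : Type*} {τ : W → W → Prop}

lemma pairwise_disjoint_cylinder_singleton :
    Pairwise (Function.onFun Disjoint fun b : W => cylinder τ [b]) := fun _ _ hbd =>
  Set.disjoint_left.2 fun _ hz hz' =>
    hbd ((mem_cylinder_singleton.1 hz).symm.trans (mem_cylinder_singleton.1 hz'))

lemma iUnion_cylinder_singleton : ⋃ b : W, cylinder τ [b] = univ :=
  eq_univ_of_forall fun _ => mem_iUnion.2 ⟨_, mem_cylinder_singleton.2 rfl⟩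

lemma cylinder_subset_cylinder_head {w : List W} (hw : w ≠ []) :
    cylinder τ w ⊆ cylinder τ [w.head hw] := fun _ hz =>
  mem_cylinder_singleton.2
    (hz 0 _ (by rw [← List.head?_eq_getElem?, List.head?_eq_some_head]))

variable [TopologicalSpace W]

lemma finiteOnCylinders_of_singleton {m : Measure (MarkovShift τ)}
    (h : ∀ b : W, m (cylinder τ [b]) < ∞) : FiniteOnCylinders m :=
  fun _ hw => (measure_mono (cylinder_subset_cylinder_head hw)).trans_lt (h _)

variable [DiscreteTopology W]

/-- The measure glued from measures on the one-letter cylinders. -/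
noncomputable def glue (L : W → Measure (MarkovShift τ)) : Measure (MarkovShift τ) :=
  Measure.sum fun b => (L b).restrict (cylinder τ [b])

lemma glue_restrict (L : W → Measure (MarkovShift τ)) (b : W) :
    (glue L).restrict (cylinder τ [b]) = (L b).restrict (cylinder τ [b]) := by
  ext S hS
  have hmeas := hS.inter (measurableSet_cylinder (τ := τ) [b])
  rw [glue, Measure.restrict_apply hS, Measure.sum_apply _ hmeas, tsum_eq_single b,
    Measure.restrict_apply hmeas, Measure.restrict_apply hS, inter_assoc, inter_self]
  intro d hd
  rw [Measure.restrict_apply hmeas, inter_assoc,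
    (pairwise_disjoint_cylinder_singleton hd.symm).inter_eq, inter_empty, measure_empty]

lemma exists_forall_integral_eq_setIntegral (b : W) (F : MarkovShift τ →ᵇ ℝ) :
    ∃ F' : MarkovShift τ →ᵇ ℝ, ∀ m : Measure (MarkovShift τ),
      ∫ z, F' z ∂m = ∫ z in cylinder τ [b], F z ∂m :=
  ⟨BoundedContinuousFunction.ofNormedAddCommGroup ((cylinder τ [b]).indicator F)
    ((isClopen_cylinder [b]).continuous_indicator F.continuous) ‖F‖
    fun z => (norm_indicator_le_norm_self _ _).trans (F.norm_coe_le_norm z),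
  fun _ => integral_indicator (measurableSet_cylinder _)⟩

variable [Countable W] {R : MarkovShift τ → ℝ} {A a : W} {x : MarkovShift τ}
  {G ι : Type*} [Group G] {s : W → G} {H : ι → Subgroup G} {f : QuotSum H} {c : ℕ → ℝ}
  {t : ℕ → ℝ} {K γ : ℝ}

lemma IsWeightSetting.finiteOnCylinders_approxMeasure (hw : IsWeightSetting R K c)
    (h : IsApproxSeq R s A a x f c γ t) (g : G) (k : ℕ) :
    FiniteOnCylinders (approxMeasure R s A a x H f c g (t k)) := by
  refine finiteOnCylinders_of_singleton fun b => ?_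
  obtain ⟨M, hM, hle⟩ := hw.exists_tsum_massWeight_le h b
  rw [approxMeasure_cylinder h.adm hw.pos hw.slow.1 (h.regular k).pos]
  exact (hle k g).trans_lt hM.lt_top

lemma IsWeightSetting.exists_weakStarTendsto [Countable G] (hw : IsWeightSetting R K c)
    (h : IsApproxSeq R s A a x f c γ t)
    (htight : ∀ (g : G) (b : W), IsTightMeasureSet (range fun k =>
      (approxMeasure R s A a x H f c g (t k)).restrict (cylinder τ [b]))) :
    ∃ φ : ℕ → ℕ, StrictMono φ ∧ ∃ μ : G → Measure (MarkovShift τ),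
      ∀ g, WeakStarTendsto (fun k => approxMeasure R s A a x H f c g ((t ∘ φ) k)) (μ g) := by
  choose M hM hle using fun b => hw.exists_tsum_massWeight_le h b
  have hnonempty : Nonempty (MarkovShift τ) := ⟨x⟩
  have hmass : ∀ (i : G × W) k,
      (approxMeasure R s A a x H f c i.1 (t k)).restrict (cylinder τ [i.2]) univ ≤ M i.2 := by
    intro i k
    rw [Measure.restrict_apply_univ,
      approxMeasure_cylinder h.adm hw.pos hw.slow.1 (h.regular k).pos]
    exact hle i.2 k i.1
  obtain ⟨φ, hφ, L, hL, hlim⟩ := exists_subseq_tendsto_integral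
    (fun (i : G × W) k => (approxMeasure R s A a x H f c i.1 (t k)).restrict (cylinder τ [i.2]))
    (fun i => hM i.2) hmass (fun i => htight i.1 i.2)
  refine ⟨φ, hφ, fun g => glue fun b => L (g, b), fun g => ⟨fun k =>
    hw.finiteOnCylinders_approxMeasure (h.comp hφ) g k, ?_, fun b F => ?_⟩⟩
  · refine finiteOnCylinders_of_singleton fun b => ?_
    rw [← Measure.restrict_apply_univ, glue_restrict]
    exact measure_lt_top _ _
  · obtain ⟨F', hF'⟩ := exists_forall_integral_eq_setIntegral b F
    have hlimF := hlim (g, b) F'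
    simp only [hF', Measure.restrict_restrict (measurableSet_cylinder _), inter_self] at hlimF
    rw [glue_restrict]
    exact hlimF

variable {μ : G → Measure (MarkovShift τ)}

lemma IsWeightSetting.approxMeasure_cylinder_self (hw : IsWeightSetting R K c)
    (h : IsApproxSeq R s A a x f c γ t) (g : G) (k : ℕ) :
    approxMeasure R s A a x H f c g (t k) (cylinder τ [A]) =
      ENNReal.ofReal (inner ℝ (quotRep H g (densityVec R s A a x H f c (t k)))
              (densityVec R s A a x H f c (t k)) /
            inner ℝ (densityVec R s A a x H f c (t k)) (densityVec R s A a x H f c (t k))) := by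
  have hreg := h.regular k
  rw [approxMeasure_cylinder h.adm hw.pos hw.slow.1 hreg.pos]
  simp only [massWeight_eq_mul_inv hreg, ENNReal.tsum_mul_right]
  rw [ENNReal.ofReal_div_of_pos hreg.inner_pos, div_eq_mul_inv, inner_quotRep_left]
  congr 1
  set P := quotRep H g⁻¹ (densityVec R s A a x H f c (t k))
  calc _ = ∑' v, pathWeight R A a x (coeff c (t k)) v *
          ENNReal.ofReal (inner ℝ (quotRep H (wordProd s v) f) P) := by
        rw [tsum_subtype (headSet A) fun v => endWeight R a x (coeff c (t k)) v *
          ENNReal.ofReal (inner ℝ (quotRep H (wordProd s v) f) P)]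
        refine tsum_congr fun v => ?_
        by_cases hv : v ∈ headSet A
        · rw [indicator_of_mem hv, endWeight_of_mem_headSet hv]
        · rw [indicator_of_notMem hv, pathWeight_of_notMem fun hmem => hv hmem.1, zero_mul]
    _ = _ := hreg.push.tsum_inner h.nonneg hreg.summable
        fun y => hreg.densityVec_nonneg h.nonneg _

lemma IsWeightSetting.tendsto_inner (hw : IsWeightSetting R K c)
    (h : IsApproxSeq R s A a x f c γ t)
    (hμ : ∀ g, WeakStarTendsto (fun k => approxMeasure R s A a x H f c g (t k)) (μ g)) (g : G) :
    Tendsto (fun k => inner ℝ (quotRep H g (densityVec R s A a x H f c (t k)))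
          (densityVec R s A a x H f c (t k)) /
        inner ℝ (densityVec R s A a x H f c (t k)) (densityVec R s A a x H f c (t k)))
      atTop (𝓝 (μ g (cylinder τ [A])).toReal) := by
  have hmass := (hμ g).tendsto_setLIntegral_singleton A (φ := fun _ => 1) continuous_const
    (fun _ => zero_le_one) (fun _ => le_rfl)
  simp only [ENNReal.ofReal_one, lintegral_one, Measure.restrict_apply_univ] at hmass
  refine ((ENNReal.tendsto_toReal ((hμ g).2.1 [A] (List.cons_ne_nil A [])).ne).comp
    hmass).congr fun k => ?_
  have hQ := (h.regular k).densityVec_nonneg h.nonneg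
  rw [Function.comp_apply, hw.approxMeasure_cylinder_self h, ENNReal.toReal_ofReal]
  exact div_nonneg (inner_nonneg_of_nonneg (fun _ => hQ _) hQ) (h.regular k).inner_pos.le

lemma IsWeightSetting.integrableOn_and_pow_mul_integral_eq (hw : IsWeightSetting R K c)
    (hR : Continuous R) (h : IsApproxSeq R s A a x f c γ t)
    (hμ : ∀ g, WeakStarTendsto (fun k => approxMeasure R s A a x H f c g (t k)) (μ g))
    {w : List W} {b : W} (hwb : (w ++ [b]).IsChain τ) :
    IntegrableOn (fun z => (birkhoffProd R w.length z)⁻¹) (cylinder τ (w ++ [b])) (μ 1) ∧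
      γ ^ w.length * ∫ z in cylinder τ (w ++ [b]), (birkhoffProd R w.length z)⁻¹ ∂(μ 1) =
        (μ (wordProd s w) (cylinder τ [b])).toReal := by
  have hinv : ∀ z, 0 ≤ (birkhoffProd R w.length z)⁻¹ := fun z =>
    inv_nonneg.2 (birkhoffProd_pos hw.pos _ z).le
  have hcont : Continuous fun z => (birkhoffProd R w.length z)⁻¹ :=
    (continuous_birkhoffProd hR _).inv₀ fun z => (birkhoffProd_pos hw.pos _ z).ne'
  have hfinite := (hμ 1).2.1.isFiniteMeasure_restrict (List.concat_ne_nil b w)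
  obtain ⟨C, hC⟩ := hw.distortion.exists_inv_birkhoffProd_le hw.pos w b
  refine ⟨Integrable.of_bound hcont.aestronglyMeasurable C
    ((ae_restrict_iff' (measurableSet_cylinder _)).2 (Eventually.of_forall fun z hz => ?_)), ?_⟩
  · rw [Real.norm_of_nonneg (hinv z)]
    exact hC z hz
  have htransfer := hw.mul_setLIntegral_eq_comp_prepend hR h hμ hwb 1 (φ := fun _ => 1)
    continuous_const (fun _ => zero_le_one) (fun _ => le_rfl)
  simp only [ENNReal.ofReal_one, mul_one, one_mul, lintegral_one,
    Measure.restrict_apply_univ] at htransfer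
  rw [← htransfer, ENNReal.toReal_mul, ENNReal.toReal_ofReal (pow_nonneg h.pos.le _),
    integral_eq_lintegral_of_nonneg_ae (Eventually.of_forall hinv) hcont.aestronglyMeasurable]

end Limits

end MarkovShift

lemma absolutelyContinuous_of_forall_lintegral_le {X : Type*} [TopologicalSpace X]
    [HasOuterApproxClosed X] [MeasurableSpace X] [OpensMeasurableSpace X] {m m' : Measure X}
    [IsFiniteMeasure m] [m.WeaklyRegular] [IsFiniteMeasure m'] {C : ℝ≥0∞} (hC : C ≠ ∞)
    (h : ∀ F : X →ᵇ NNReal, ∫⁻ z, F z ∂m ≤ C * ∫⁻ z, F z ∂m') : m ≪ m' := by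
  refine Measure.AbsolutelyContinuous.mk fun S hS hS0 => ?_
  rw [hS.measure_eq_iSup_isClosed_of_ne_top (measure_ne_top _ _)]
  simp only [ENNReal.iSup_eq_zero]
  intro F hFS hF
  have hle : m F ≤ C * m' F := le_of_tendsto_of_tendsto'
    (HasOuterApproxClosed.tendsto_lintegral_apprSeq hF m)
    (ENNReal.Tendsto.const_mul (HasOuterApproxClosed.tendsto_lintegral_apprSeq hF m')
      (Or.inr hC)) fun n => h _
  rwa [measure_mono_null hFS hS0, mul_zero, nonpos_iff_eq_zero] at hle

namespace MarkovShift

section Domination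

variable {W : Type*} {τ : W → W → Prop}
  {R : MarkovShift τ → ℝ} {A a : W} {x : MarkovShift τ}
  {G ι : Type*} [Group G] {s : W → G} {H : ι → Subgroup G} {f : QuotSum H} {c : ℕ → ℝ}
  {t : ℕ → ℝ} {K γ : ℝ}

lemma skewProduct_iterate (z : MarkovShift τ) (g : G) (n : ℕ) :
    (skewProduct s)^[n] (z, g) = (shift^[n] z, (wordProd s (initWord z n))⁻¹ * g) := by
  induction n with
  | zero => simp [initWord, wordProd]
  | succ n ih =>
    rw [Function.iterate_succ_apply', ih, skewProduct, Function.iterate_succ_apply',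
      ← initWord_append, wordProd_append, shift_iterate_seq, zero_add]
    simp [wordProd, mul_assoc]

lemma IsTransitiveExtension.exists_word [TopologicalSpace W] [DiscreteTopology W]
    (h : IsTransitiveExtension τ s) (hmix : IsMixing τ) (A : W) (g : G) :
    ∃ p : List W, (p ++ [A]).IsChain τ ∧ (p ++ [A]).head? = some A ∧ wordProd s p = g := by
  obtain ⟨y, hy⟩ := hmix.exists_seq_zero_eq A
  have hopen := (isClopen_cylinder (τ := τ) [A]).isOpen
  have hne : (cylinder τ [A]).Nonempty := ⟨y, mem_cylinder_singleton.2 hy⟩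
  obtain ⟨n, z, hz, hreturn, hfiber⟩ := h _ _ hopen hopen hne hne g 1
  rw [skewProduct_iterate] at hreturn hfiber
  have hzA : z.seq n = A := by
    simpa only [shift_iterate_seq, zero_add] using mem_cylinder_singleton.1 hreturn
  have hinit : initWord z n ++ [A] = initWord z (n + 1) := by rw [← hzA, initWord_append]
  exact ⟨initWord z n, hinit ▸ isChain_initWord _ _,
    by rw [hinit, head?_initWord_succ, mem_cylinder_singleton.1 hz], inv_mul_eq_one.1 hfiber⟩

lemma IsWeightSetting.exists_quotRep_wordProd_le (hw : IsWeightSetting R K c)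
    (h : IsApproxSeq R s A a x f c γ t) {p : List W} (hp : (p ++ [A]).IsChain τ)
    (hpA : (p ++ [A]).head? = some A) :
    ∃ C : ℝ≥0∞, C ≠ ∞ ∧ ∀ k (y : Σ j : ι, G ⧸ H j),
      ENNReal.ofReal (quotRep H (wordProd s p) (densityVec R s A a x H f c (t k)) y) ≤
        C * ENNReal.ofReal (densityVec R s A a x H f c (t k) y) := by
  obtain ⟨z, rfl⟩ := hw.mixing.exists_seq_zero_eq A
  refine ⟨ENNReal.ofReal ((γ + 1) ^ p.length) * (ENNReal.ofReal K / wordWeight R z p),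
    ENNReal.mul_ne_top ENNReal.ofReal_ne_top (div_wordWeight_ne_top hw.pos hp K), fun k y => ?_⟩
  have hreg := h.regular k
  set κ := coeff c (t k)
  have hprefix : ∀ v ∈ headSet (z.seq 0), pathWeight R (z.seq 0) a x κ v ≤
      ENNReal.ofReal ((γ + 1) ^ p.length) * (ENNReal.ofReal K / wordWeight R z p) *
        pathWeight R (z.seq 0) a x κ (p ++ v) := by
    intro v hv
    rw [← endWeight_of_mem_headSet hv, ← endWeight_of_mem_headSet (append_mem_headSet hpA hv)]
    refine (endWeight_le_prepend hw.distortion hw.pos hw.slow.2.1 hreg.pos hp hv).trans ?_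
    gcongr
    · exact hreg.pos.le
    · exact h.le k
  rw [quotRep_apply_apply, densityVec, (hreg.push.repConv_apply h.nonneg hreg.summable _).2,
    (hreg.push.repConv_apply h.nonneg hreg.summable _).2, weightedSum, weightedSum,
    ← tsum_univ fun v => pathWeight R (z.seq 0) a x κ v *
      ENNReal.ofReal (quotRep H (wordProd s v) f ((wordProd s p)⁻¹ • y)),
    ← tsum_univ fun v => pathWeight R (z.seq 0) a x κ v *
      ENNReal.ofReal (quotRep H (wordProd s v) f y)]
  refine tsum_subtype_le_mul_tsum_of_injOn
    (f := fun v => pathWeight R (z.seq 0) a x κ v *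
      ENNReal.ofReal (quotRep H (wordProd s v) f ((wordProd s p)⁻¹ • y)))
    (g := fun v => pathWeight R (z.seq 0) a x κ v * ENNReal.ofReal (quotRep H (wordProd s v) f y))
    (p ++ ·) (List.append_right_injective p).injOn fun v _ hne => ⟨mem_univ _, ?_⟩
  have hv : v ∈ headSet (z.seq 0) := by
    by_contra hv
    exact hne (by rw [pathWeight_of_notMem fun hmem => hv hmem.1, zero_mul])
  rw [wordProd_append, quotRep_mul_apply, quotRep_apply_apply (wordProd s p), ← mul_assoc]
  gcongr
  exact hprefix v hv

lemma IsApproxSeq.massWeight_le_mul (h : IsApproxSeq R s A a x f c γ t) {g : G} {C : ℝ≥0∞} {k : ℕ}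
    (hC : ∀ y : Σ j : ι, G ⧸ H j,
      ENNReal.ofReal (quotRep H g⁻¹ (densityVec R s A a x H f c (t k)) y) ≤
        C * ENNReal.ofReal (densityVec R s A a x H f c (t k) y)) (v : List W) :
    massWeight R s A a x f c g (t k) v ≤ C * massWeight R s A a x f c 1 (t k) v := by
  have hQ := (h.regular k).densityVec_nonneg h.nonneg
  have hf : ∀ y, 0 ≤ quotRep H (wordProd s v) f y := fun _ => h.nonneg _
  have hQg : ∀ (g : G) y, 0 ≤ quotRep H g (densityVec R s A a x H f c (t k)) y := fun _ _ => hQ _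
  have hinner : ENNReal.ofReal (inner ℝ (quotRep H (wordProd s v) f)
        (quotRep H g⁻¹ (densityVec R s A a x H f c (t k)))) ≤
      C * ENNReal.ofReal (inner ℝ (quotRep H (wordProd s v) f)
        (quotRep H 1⁻¹ (densityVec R s A a x H f c (t k)))) := by
    rw [ofReal_inner_eq_tsum hf (hQg _), ofReal_inner_eq_tsum hf (hQg _), ← ENNReal.tsum_mul_left]
    refine ENNReal.tsum_le_tsum fun y => ?_
    rw [mul_left_comm]
    gcongr
    simpa using hC y
  rw [massWeight_eq_mul_inv (h.regular k), massWeight_eq_mul_inv (h.regular k), ← mul_assoc,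
    mul_left_comm C]
  gcongr

variable [TopologicalSpace W] [DiscreteTopology W] [Countable W] {μ : G → Measure (MarkovShift τ)}

lemma IsWeightSetting.absolutelyContinuous_restrict (hw : IsWeightSetting R K c)
    (h : IsApproxSeq R s A a x f c γ t)
    (hμ : ∀ g, WeakStarTendsto (fun k => approxMeasure R s A a x H f c g (t k)) (μ g))
    {g : G} {C : ℝ≥0∞} (hC : C ≠ ∞)
    (hle : ∀ k v, massWeight R s A a x f c g (t k) v ≤ C * massWeight R s A a x f c 1 (t k) v)
    (b : W) : (μ g).restrict (cylinder τ [b]) ≪ (μ 1).restrict (cylinder τ [b]) := by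
  have hfinite := fun g => (hμ g).2.1.isFiniteMeasure_restrict (List.cons_ne_nil b [])
  refine absolutelyContinuous_of_forall_lintegral_le hC fun F => ?_
  have hlim := fun g => (hμ g).tendsto_setLIntegral_singleton b (φ := fun z => (F z : ℝ))
    (by fun_prop) (fun z => NNReal.coe_nonneg _) (C := nndist F 0)
    fun z => by exact_mod_cast BoundedContinuousFunction.NNReal.upper_bound F z
  simp only [ENNReal.ofReal_coe_nnreal] at hlim
  refine le_of_tendsto_of_tendsto' (hlim g)
    (ENNReal.Tendsto.const_mul (hlim 1) (Or.inr hC)) fun k => ?_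
  rw [setLIntegral_approxMeasure h.adm hw.pos hw.slow.1 (h.regular k).pos,
    setLIntegral_approxMeasure h.adm hw.pos hw.slow.1 (h.regular k).pos, ← ENNReal.tsum_mul_left]
  refine ENNReal.tsum_le_tsum fun v => ?_
  rw [← mul_assoc]
  gcongr
  exact hle k v

lemma measure_eq_zero_of_forall_restrict_cylinder {m : Measure (MarkovShift τ)}
    {S : Set (MarkovShift τ)} (h : ∀ b, m.restrict (cylinder τ [b]) S = 0) : m S = 0 := by
  rw [← Measure.restrict_univ (μ := m), ← iUnion_cylinder_singleton,
    Measure.restrict_iUnion pairwise_disjoint_cylinder_singleton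
      fun b => measurableSet_cylinder _]
  exact Measure.sum_apply_eq_zero.2 h

lemma IsWeightSetting.absolutelyContinuous (hw : IsWeightSetting R K c)
    (h : IsApproxSeq R s A a x f c γ t)
    (hμ : ∀ g, WeakStarTendsto (fun k => approxMeasure R s A a x H f c g (t k)) (μ g))
    (htr : IsTransitiveExtension τ s) (g : G) : μ g ≪ μ 1 := by
  obtain ⟨p, hp, hpA, hpg⟩ := htr.exists_word hw.mixing A g⁻¹
  obtain ⟨C, hC, hle⟩ := hw.exists_quotRep_wordProd_le h hp hpA
  rw [hpg] at hle
  exact fun S hS => measure_eq_zero_of_forall_restrict_cylinder fun b =>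
    hw.absolutelyContinuous_restrict h hμ hC (fun k => h.massWeight_le_mul (hle k)) b
      (Measure.absolutelyContinuous_of_le Measure.restrict_le_self hS)

end Domination

section Cocycle

variable {W : Type*} {τ : W → W → Prop}

lemma mem_cylinder_concat {w : List W} {b : W} {z : MarkovShift τ} :
    z ∈ cylinder τ (w ++ [b]) ↔ z ∈ cylinder τ w ∧ z.seq w.length = b := by
  simp only [mem_cylinder_iff, List.length_append, List.length_singleton]
  constructor
  · intro h
    exact ⟨fun i hi => by rw [h i (by omega), List.getElem_append_left hi],
      by rw [h _ (by omega), List.getElem_concat_length rfl]⟩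
  · rintro ⟨h, rfl⟩ i hi
    rcases (Nat.lt_succ_iff_lt_or_eq.1 hi) with hi | rfl
    · rw [h i hi, List.getElem_append_left hi]
    · rw [List.getElem_concat_length rfl]

lemma cylinder_eq_iUnion_concat (w : List W) :
    cylinder τ w = ⋃ b : {b : W // (w ++ [b]).IsChain τ}, cylinder τ (w ++ [b.1]) := by
  ext z
  simp only [mem_iUnion, mem_cylinder_concat]
  refine ⟨fun hz => ⟨⟨z.seq w.length, ?_⟩, hz, rfl⟩, fun ⟨_, hz, _⟩ => hz⟩
  have hchain := isChain_initWord z (w.length + 1)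
  rwa [← initWord_append, initWord_length_of_mem_cylinder hz] at hchain

lemma pairwise_disjoint_cylinder_concat (w : List W) :
    Pairwise (Function.onFun Disjoint fun b : W => cylinder τ (w ++ [b])) := fun _ _ hbd =>
  Set.disjoint_left.2 fun _ hz hz' =>
    hbd ((mem_cylinder_concat.1 hz).2.symm.trans (mem_cylinder_concat.1 hz').2)

lemma shift_iterate_image_cylinder_eq_iUnion (w : List W) :
    shift^[w.length] '' cylinder τ w =
      ⋃ b : {b : W // (w ++ [b]).IsChain τ}, cylinder τ [b.1] := by
  rw [shift_iterate_image_cylinder]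
  ext z
  simp only [mem_iUnion, mem_cylinder_singleton]
  exact ⟨fun hz => ⟨⟨z.seq 0, hz⟩, rfl⟩, fun ⟨b, hb⟩ => by rw [mem_ofPred_eq, hb]; exact b.2⟩

variable [TopologicalSpace W] [Countable W]

lemma FiniteOnCylinders.sigmaFinite {m : Measure (MarkovShift τ)}
    (hm : FiniteOnCylinders m) : SigmaFinite m := by
  refine Measure.sigmaFinite_of_countable (countable_range fun b : W => cylinder τ [b]) ?_ ?_
  · rintro _ ⟨b, rfl⟩
    exact hm [b] (List.cons_ne_nil b [])
  · rw [sUnion_range, iUnion_cylinder_singleton]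

variable [DiscreteTopology W] {R : MarkovShift τ → ℝ} {A a : W} {x : MarkovShift τ}
  {G ι : Type*} [Group G] {s : W → G} {H : ι → Subgroup G} {f : QuotSum H} {c : ℕ → ℝ}
  {t : ℕ → ℝ} {K γ : ℝ} {μ : G → Measure (MarkovShift τ)}

lemma IsWeightSetting.map_prepend_restrict (hw : IsWeightSetting R K c) (hR : Continuous R)
    (h : IsApproxSeq R s A a x f c γ t)
    (hμ : ∀ g, WeakStarTendsto (fun k => approxMeasure R s A a x H f c g (t k)) (μ g))
    {w : List W} {b : W} (hwb : (w ++ [b]).IsChain τ) :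
    ((μ 1).restrict (cylinder τ [b])).map (prepend w) =
      ((μ (wordProd s w)⁻¹).restrict (cylinder τ (w ++ [b]))).withDensity
        fun z => ENNReal.ofReal (γ ^ w.length * (birkhoffProd R w.length z)⁻¹) := by
  have hcont : Continuous fun z => γ ^ w.length * (birkhoffProd R w.length z)⁻¹ :=
    continuous_const.mul ((continuous_birkhoffProd hR _).inv₀ fun z =>
      (birkhoffProd_pos hw.pos _ z).ne')
  have hfinite := (hμ 1).2.1.isFiniteMeasure_restrict (List.cons_ne_nil b [])
  have hmapfinite := Measure.isFiniteMeasure_map ((μ 1).restrict (cylinder τ [b])) (prepend w)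
  refine ext_of_forall_lintegral_eq_of_IsFiniteMeasure fun F => ?_
  have hFm : Measurable fun z => ((F z : NNReal) : ℝ≥0∞) :=
    F.continuous.measurable.coe_nnreal_ennreal
  have htransfer := hw.mul_setLIntegral_eq_comp_prepend hR h hμ hwb (wordProd s w)⁻¹
    (φ := fun z => (F z : ℝ))
    (by fun_prop) (fun z => NNReal.coe_nonneg _) (C := nndist F 0)
    fun z => by exact_mod_cast BoundedContinuousFunction.NNReal.upper_bound F z
  rw [inv_mul_cancel] at htransfer
  simp only [ENNReal.ofReal_coe_nnreal] at htransfer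
  rw [lintegral_map hFm (continuous_prepend w).measurable, ← htransfer,
    lintegral_withDensity_eq_lintegral_mul _ hcont.measurable.ennreal_ofReal hFm,
    ← lintegral_const_mul' _ _ ENNReal.ofReal_ne_top]
  refine lintegral_congr fun z => ?_
  rw [Pi.mul_apply, ENNReal.ofReal_mul (pow_nonneg h.pos.le _), mul_assoc]

lemma IsWeightSetting.branchPush_eq (hw : IsWeightSetting R K c) (hR : Continuous R)
    (h : IsApproxSeq R s A a x f c γ t)
    (hμ : ∀ g, WeakStarTendsto (fun k => approxMeasure R s A a x H f c g (t k)) (μ g))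
    (w : List W) :
    branchPush w (μ 1) = ((μ (wordProd s w)⁻¹).restrict (cylinder τ w)).withDensity
      fun z => ENNReal.ofReal (γ ^ w.length * (birkhoffProd R w.length z)⁻¹) := by
  rw [branchPush, shift_iterate_image_cylinder_eq_iUnion,
    Measure.restrict_iUnion
      (pairwise_disjoint_cylinder_singleton.comp_of_injective Subtype.val_injective)
      fun b => measurableSet_cylinder _,
    Measure.map_sum (continuous_prepend w).measurable.aemeasurable]
  rw [cylinder_eq_iUnion_concat w, Measure.restrict_iUnion
      ((pairwise_disjoint_cylinder_concat w).comp_of_injective Subtype.val_injective)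
      fun b => measurableSet_cylinder _, withDensity_sum]
  exact congrArg Measure.sum (funext fun b => hw.map_prepend_restrict hR h hμ b.2)

lemma IsWeightSetting.isTwistedByCocycle (hw : IsWeightSetting R K c) (hR : Continuous R)
    (h : IsApproxSeq R s A a x f c γ t)
    (hμ : ∀ g, WeakStarTendsto (fun k => approxMeasure R s A a x H f c g (t k)) (μ g))
    (htr : IsTransitiveExtension τ s) : IsTwistedByCocycle R s γ (μ 1) := by
  have hσ : ∀ g, SigmaFinite (μ g) := fun g => (hμ g).2.1.sigmaFinite
  refine ⟨fun g z => ((μ g⁻¹).rnDeriv (μ 1) z).toReal,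
    fun g => (Measure.measurable_rnDeriv _ _).ennreal_toReal, fun _ _ => ENNReal.toReal_nonneg,
    fun w _ _ => ?_⟩
  set g := wordProd s w with hg
  have hdensity :
      (μ 1).withDensity (fun z => ENNReal.ofReal ((μ g⁻¹).rnDeriv (μ 1) z).toReal) = μ g⁻¹ := by
    rw [withDensity_congr_ae (ofReal_toReal_ae_eq (Measure.rnDeriv_lt_top _ _))]
    exact Measure.withDensity_rnDeriv_eq _ _ (hw.absolutelyContinuous h hμ htr _)
  have hcont : Continuous fun z => γ ^ w.length * (birkhoffProd R w.length z)⁻¹ :=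
    continuous_const.mul ((continuous_birkhoffProd hR _).inv₀ fun z =>
      (birkhoffProd_pos hw.pos _ z).ne')
  rw [hw.branchPush_eq hR h hμ, ← hg, ← hdensity, restrict_withDensity (measurableSet_cylinder _),
    ← withDensity_mul _ (Measure.measurable_rnDeriv _ _).ennreal_toReal.ennreal_ofReal
      hcont.measurable.ennreal_ofReal]
  congr 1
  funext z
  rw [Pi.mul_apply, mul_comm, ← ENNReal.ofReal_mul]
  exact mul_nonneg (pow_nonneg h.pos.le _) (inv_nonneg.2 (birkhoffProd_pos hw.pos _ z).le)

end Cocycle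

section MainTheorem

variable {W : Type*} [TopologicalSpace W] {τ : W → W → Prop}
  {R : MarkovShift τ → ℝ} {A a : W} {x : MarkovShift τ}
  {G ι : Type*} [Group G] {s : W → G} {H : ι → Subgroup G} {f : QuotSum H} {c : ℕ → ℝ}
  {t : ℕ → ℝ} {K γ : ℝ}

lemma decayExponent_pos_of_compactSpace [CompactSpace (MarkovShift τ)] (hpos : ∀ z, 0 < R z)
    (hR : Continuous R) (hax : τ a (x.seq 0)) (hmix : IsMixing τ) (hsum : HasBoundedWordSums R A x)
    (hf : ∀ y, 0 ≤ f y) (hf0 : f ≠ 0) : 0 < decayExponent R s A a x H f := by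
  obtain ⟨z, -, hz⟩ := isCompact_univ.exists_isMinOn ⟨x, mem_univ x⟩ hR.continuousOn
  exact decayExponent_pos_of_le hpos hax hmix hsum hf hf0 (hpos z) fun y => hz (mem_univ y)

lemma IsWeightSetting.isTightMeasureSet_of_compactSpace_or [DiscreteTopology W] [Countable W]
    (hw : IsWeightSetting R K c) (h : IsApproxSeq R s A a x f c γ t)
    (hcase : CompactSpace (MarkovShift τ) ∨ ∃ B : W, gammaSPR R B < ENNReal.ofReal γ)
    (g : G) (b : W) :
    IsTightMeasureSet (range fun k =>
      (approxMeasure R s A a x H f c g (t k)).restrict (cylinder τ [b])) := by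
  rcases hcase with hcompact | ⟨B, hB⟩
  · exact IsTightMeasureSet.of_compactSpace
  · exact hw.isTightMeasureSet h hB g b

end MainTheorem

end MarkovShift

open MarkovShift in
theorem mainTheorem6_general {W : Type*} [Countable W] [TopologicalSpace W] [DiscreteTopology W]
    (τ : W → W → Prop) (hmix : IsMixing τ)
    (R : MarkovShift τ → ℝ) (hRpos : ∀ z, 0 < R z) (hR : IsLocallyHolder R)
    (hper : HasBoundedPeriodicSums R)
    {G : Type*} [Group G] [Countable G] (s : W → G) {ι : Type*} (H : ι → Subgroup G)
    (A a : W) (x : MarkovShift τ) (hax : τ a (x.seq 0))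
    (f : QuotSum H) (hf : ∀ y, 0 ≤ f y) (hf0 : f ≠ 0)
    (hcase : CompactSpace (MarkovShift τ) ∨
      ∃ B : W, gammaSPR R B < ENNReal.ofReal (decayExponent R s A a x H f)) :
    ∃ c : ℕ → ℝ, IsSlowlyIncreasing c ∧
    ∃ t : ℕ → ℝ, (∀ k, decayExponent R s A a x H f < t k) ∧
      Tendsto t atTop (𝓝 (decayExponent R s A a x H f)) ∧
      (∀ k, (∀ g, Summable fun n : ℕ => densityTerm R s A a x c (t k) g (n + 1)) ∧
        (Summable fun g : G => density R s A a x c (t k) g • quotRep H g f) ∧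
        densityVec R s A a x H f c (t k) ≠ 0) ∧
    ∃ Υ : G → ℝ,
      (∀ g, Tendsto (fun k =>
          inner ℝ (quotRep H g (densityVec R s A a x H f c (t k)))
              (densityVec R s A a x H f c (t k)) /
            inner ℝ (densityVec R s A a x H f c (t k)) (densityVec R s A a x H f c (t k)))
        atTop (𝓝 (Υ g))) ∧
    ∃ ν : Measure (MarkovShift τ),
      FiniteOnCylinders ν ∧
      IsTwistedLimit R s A a x H f c t ν ∧
      (IsTransitiveExtension τ s →
        IsTwistedByCocycle R s (decayExponent R s A a x H f) ν) ∧
      ∀ (n : ℕ) (w : List W), w.length = n → (w ++ [A]).IsChain τ →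
        IntegrableOn (fun z => (birkhoffProd R n z)⁻¹) (cylinder τ (w ++ [A])) ν ∧
        decayExponent R s A a x H f ^ n *
            ∫ z in cylinder τ (w ++ [A]), (birkhoffProd R n z)⁻¹ ∂ν =
          Υ (wordProd s w) := by
  obtain ⟨K, hK⟩ := hR.exists_boundedDistortion hRpos
  have hRcont : Continuous R := hR.continuous hRpos
  have hsums := hper.hasBoundedWordSums hmix hRpos hK
  have hγ : 0 < decayExponent R s A a x H f := by
    rcases hcase with hcompact | ⟨B, hB⟩
    · exact decayExponent_pos_of_compactSpace hRpos hRcont hax hmix (hsums A x) hf hf0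
    · exact ENNReal.ofReal_pos.1 (bot_le.trans_lt hB)
  obtain ⟨c, hc, hsub, htop⟩ := exists_isSlowlyIncreasing_pathEnergy_eq_top hγ fun _ =>
    pathEnergy_eq_top_of_lt_decayExponent hRpos hax (hsums A x) hf
  have hw : IsWeightSetting R K c := ⟨hRpos, hmix, hK, hsums, hc, hsub⟩
  obtain ⟨t, ht⟩ := exists_isApproxSeq hRpos hax (hsums A x) hf hf0 hγ hc htop
  obtain ⟨φ, hφ, μ, hμ⟩ := hw.exists_weakStarTendsto ht
    (hw.isTightMeasureSet_of_compactSpace_or ht hcase)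
  have htφ := ht.comp hφ
  refine ⟨c, hc, t ∘ φ, htφ.lt, htφ.tendsto, fun k => ⟨(htφ.regular k).summable_term,
    (htφ.regular k).summable, (htφ.regular k).densityVec_ne_zero⟩,
    fun g => (μ g (cylinder τ [A])).toReal, hw.tendsto_inner htφ hμ, μ 1, (hμ 1).2.1,
    ⟨μ, rfl, hμ⟩, hw.isTwistedByCocycle hRcont htφ hμ, ?_⟩
  rintro _ w rfl hwA
  exact hw.integrableOn_and_pow_mul_integral_eq hRcont htφ hμ hwA

open MarkovShift in
theorem mainTheorem6 {W : Type*} [Countable W] [TopologicalSpace W] [DiscreteTopology W]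
    (τ : W → W → Prop) (hmix : IsMixing τ)
    (R : MarkovShift τ → ℝ) (hRpos : ∀ z, 0 < R z) (hR : IsLocallyHolder R)
    (hP : ∀ B : W, gurevicPressure R B = 0) (hSPR : IsStronglyPositiveRecurrent R)
    {G : Type*} [Group G] [Countable G] (s : W → G)
    {ι : Type*} [Countable ι] (H : ι → Subgroup G)
    (A a : W) (x : MarkovShift τ) (hax : τ a (x.seq 0))
    (f : QuotSum H) (hf : ∀ y, 0 ≤ f y) (hf0 : f ≠ 0)
    (hcase : CompactSpace (MarkovShift τ) ∨
      (x.seq 0 = A ∧ ∃ B : W, gammaSPR R B < ENNReal.ofReal (decayExponent R s A a x H f))) :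
    ∃ c : ℕ → ℝ, IsSlowlyIncreasing c ∧
    ∃ t : ℕ → ℝ, (∀ k, decayExponent R s A a x H f < t k) ∧
      Tendsto t atTop (𝓝 (decayExponent R s A a x H f)) ∧
      (∀ k, (∀ g, Summable fun n : ℕ => densityTerm R s A a x c (t k) g (n + 1)) ∧
        (Summable fun g : G => density R s A a x c (t k) g • quotRep H g f) ∧
        densityVec R s A a x H f c (t k) ≠ 0) ∧
    ∃ Υ : G → ℝ,
      (∀ g, Tendsto (fun k =>
          inner ℝ (quotRep H g (densityVec R s A a x H f c (t k)))
              (densityVec R s A a x H f c (t k)) /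
            inner ℝ (densityVec R s A a x H f c (t k)) (densityVec R s A a x H f c (t k)))
        atTop (𝓝 (Υ g))) ∧
    ∃ ν : Measure (MarkovShift τ),
      FiniteOnCylinders ν ∧
      IsTwistedLimit R s A a x H f c t ν ∧
      (IsTransitiveExtension τ s →
        IsTwistedByCocycle R s (decayExponent R s A a x H f) ν) ∧
      ∀ (n : ℕ) (w : List W), w.length = n → (w ++ [A]).IsChain τ →
        IntegrableOn (fun z => (birkhoffProd R n z)⁻¹) (cylinder τ (w ++ [A])) ν ∧
        decayExponent R s A a x H f ^ n *
            ∫ z in cylinder τ (w ++ [A]), (birkhoffProd R n z)⁻¹ ∂ν =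
          Υ (wordProd s w) := by
  exact mainTheorem6_general τ hmix R hRpos hR hSPR.1.hasBoundedPeriodicSums s H A a x hax f hf hf0
    (hcase.imp_right And.right)
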